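/- **Theorem 3.1 (Restricted Symmetric Bimonoidal Intermuting Coherence).** *SMI categories.* A *symmetric bimonoidal intermuting (SMI) category* is a category with two symmetric monoidal structures $(\vee,\bot,\check b,\check c,\check\delta,\check\sigma)$ and $(\wedge,\top,\hat b,\hat c,\hat\delta,\hat\sigma)$, where for $\vee$ the structural natural isomorphisms are $\check b^{\to}_{A,B,C}:A\vee(B\vee C)\to(A\vee B)\vee C$, $\check c_{A,B}:A\vee B\to B\vee A$, $\check\delta^{\to}_A:A\vee\bot\to A$, $\check\sigma^{\to}_A:\bot\vee A\to A$ (inverses are written with superscript $\leftarrow$), and analogously for $\wedge$ and $\top$, together with a natural transformation $$c^k_{A,B,C,D}:(A\wedge B)\vee(C\wedge D)\to(A\vee C)\wedge(B\vee D),$$ isomorphisms $\hat w^{\to}_\bot:\bot\wedge\bot\to\bot$ and $\check w^{\to}_\top:\top\vee\top\to\top$ with inverses $\hat w^{\leftarrow}_\bot$, $\check w^{\leftarrow}_\top$, and an arrow $\kappa:\bot\to\top$, such that for all objects: 1. $\hat b^{\to}_{A\vee D,B\vee E,C\vee F}\circ(\mathbf 1_{A\vee D}\wedge c^k_{B,C,E,F})\circ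 c^k_{A,B\wedge C,D,E\wedge F}=(c^k_{A,B,D,E}\wedge\mathbf 1_{C\vee F})\circ c^k_{A\wedge B,C,D\wedge E,F}\circ(\hat b^{\to}_{A,B,C}\vee\hat b^{\to}_{D,E,F})$; 2. $c^k_{A\vee B,D\vee E,C,F}\circ(c^k_{A,D,B,E}\vee\mathbf 1_{C\wedge F})\circ\check b^{\to}_{A\wedge D,B\wedge E,C\wedge F}=(\check b^{\to}_{A,B,C}\wedge\check b^{\to}_{D,E,F})\circ c^k_{A,D,B\vee C,E\vee F}\circ(\mathbf 1_{A\wedge D}\vee c^k_{B,E,C,F})$; 3. $\hat c_{A\vee C,B\vee D}\circ c^k_{A,B,C,D}=c^k_{B,A,D,C}\circ(\hat c_{A,B}\vee\hat c_{C,D})$; 4. $c^k_{B,D,A,C}\circ\check c_{A\wedge C,B\wedge D}=(\check c_{A,B}\wedge\check c_{C,D})\circ c^k_{A,C,B,D}$; 5. $c^k_{A,B,\bot,\bot}=(\check\delta^{\leftarrow}_A\wedge\check\delta^{\leftarrow}_B)\circ\check\delta^{\to}_{A\wedge B}\circ(\mathbf 1_{A\wedge B}\vee\hat w^{\to}_\bot)$;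 6. $c^k_{A,\top,B,\top}=(\mathbf 1_{A\vee B}\wedge\check w^{\leftarrow}_\top)\circ\hat\delta^{\leftarrow}_{A\vee B}\circ(\hat\delta^{\to}_A\vee\hat\delta^{\to}_B)$; 7. $\check b^{\to}_{\top,\top,\top}=(\check w^{\leftarrow}_\top\vee\mathbf 1_\top)\circ(\mathbf 1_\top\vee\check w^{\to}_\top)$; 8. $\hat b^{\to}_{\bot,\bot,\bot}=(\hat w^{\leftarrow}_\bot\wedge\mathbf 1_\bot)\circ(\mathbf 1_\bot\wedge\hat w^{\to}_\bot)$; 9. $\mathbf 1_\top\vee\kappa=\check w^{\leftarrow}_\top\circ\check\delta^{\to}_\top$; 10. $\mathbf 1_\bot\wedge\kappa=\hat\delta^{\leftarrow}_\bot\circ\hat w^{\to}_\bot$; 11. $c^k_{\top,\bot,\bot,\top}=(\check\delta^{\leftarrow}_\top\wedge\check\sigma^{\leftarrow}_\top)\circ\hat\delta^{\leftarrow}_\top\circ\kappa\circ\check\delta^{\to}_\bot\circ(\hat\sigma^{\to}_\bot\vee\hat\delta^{\to}_\bot)$; 12. $\check c_{\top,\top}=\check w^{\leftarrow}_\top\circ\check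 w^{\to}_\top$; 13. $\hat c_{\bot,\bot}=\hat w^{\leftarrow}_\bot\circ\hat w^{\to}_\bot$. *The free SMI category.* Let $\mathcal M$ be the SMI category freely generated by an infinite set $\mathcal P$ of letters. Its objects are the propositional formulae built from the letters in $\mathcal P$ and the constants $\bot,\top$ with the binary connectives $\vee,\wedge$. Its arrows are the equivalence classes of arrow terms, generated by $\circ$, $\vee$, $\wedge$ from identities and the primitive terms $\check b^{\to},\check b^{\leftarrow},\hat b^{\to},\hat b^{\leftarrow},\check c,\hat c,\check\delta^{\to},\check\delta^{\leftarrow},\hat\delta^{\to},\hat\delta^{\leftarrow},\check\sigma^{\to},\check\sigma^{\leftarrow},\hat\sigma^{\to},\hat\sigma^{\leftarrow},c^k,\hat w_\bot^{\to},\hat w_\bot^{\leftarrow},\check w_\top^{\to},\check w_\top^{\leftarrow},\kappa$, under the smallest equivalence relation, congruent with respect to $\circ,\vee,\wedge$, that makes $\mathcal M$ an SMI category. *Pure and diversified objects.* For a formula $A$, let $\nu(A)$ be the formula obtained from $A$ by replacing, as long as possible, subformulae $B\vee\bot$, $\bot\vee B$, $B\wedge\top$, $\top\wedge B$ by $B$,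 subformulae $\bot\wedge\bot$ by $\bot$ and subformulae $\top\vee\top$ by $\top$. The object $A$ is *pure* if neither $\bot$ nor $\top$ occurs in $\nu(A)$, and *diversified* if every letter occurs in $A$ at most once. *Statement.* Let $A$ and $B$ be objects of $\mathcal M$ such that either both $A$ and $B$ are pure and diversified, or no letter occurs in $A$ and no letter occurs in $B$. Then there is at most one arrow $A\to B$ in $\mathcal M$. -/

import Mathlib

namespace SMI

open CategoryTheory

universe v u

/-! ## Symmetric bimonoidal intermuting categories -/

/-- Two symmetric monoidal structures on one category: `disj` has tensor `∨` and unit `⊥`,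
`conj` has tensor `∧` and unit `⊤`. -/
class SymmBimonoidal (C : Type u) [Category.{v} C] where
  disj : MonoidalCategory C
  disjSymm : @SymmetricCategory C _ disj
  conj : MonoidalCategory C
  conjSymm : @SymmetricCategory C _ conj

section SymmBimonoidal

variable {C : Type u} [Category.{v} C] [S : SymmBimonoidal C]

abbrev vee (A B : C) : C := S.disj.tensorObj A B
abbrev wedge (A B : C) : C := S.conj.tensorObj A B
variable (C) in
abbrev bot : C := S.disj.tensorUnit
variable (C) in
abbrev top : C := S.conj.tensorUnit

local infixr:65 " ⋎ " => vee
local infixr:65 " ⋏ " => wedge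

abbrev veeHom {A A' B B' : C} (f : A ⟶ A') (g : B ⟶ B') : (A ⋎ B) ⟶ (A' ⋎ B') :=
  S.disj.tensorHom f g
abbrev wedgeHom {A A' B B' : C} (f : A ⟶ A') (g : B ⟶ B') : (A ⋏ B) ⟶ (A' ⋏ B') :=
  S.conj.tensorHom f g

/-- Associativity isomorphism `A ∨ (B ∨ C) ≅ (A ∨ B) ∨ C`. -/
abbrev bVee (A B D : C) : (A ⋎ (B ⋎ D)) ≅ ((A ⋎ B) ⋎ D) := (S.disj.associator A B D).symm
/-- Associativity isomorphism `A ∧ (B ∧ C) ≅ (A ∧ B) ∧ C`. -/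
abbrev bWedge (A B D : C) : (A ⋏ (B ⋏ D)) ≅ ((A ⋏ B) ⋏ D) := (S.conj.associator A B D).symm
abbrev cVee (A B : C) : (A ⋎ B) ≅ (B ⋎ A) := S.disjSymm.braiding A B
abbrev cWedge (A B : C) : (A ⋏ B) ≅ (B ⋏ A) := S.conjSymm.braiding A B
abbrev deltaVee (A : C) : (A ⋎ bot C) ≅ A := S.disj.rightUnitor A
abbrev deltaWedge (A : C) : (A ⋏ top C) ≅ A := S.conj.rightUnitor A
abbrev sigmaVee (A : C) : (bot C ⋎ A) ≅ A := S.disj.leftUnitor A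
abbrev sigmaWedge (A : C) : (top C ⋏ A) ≅ A := S.conj.leftUnitor A

end SymmBimonoidal

local infixr:65 " ⋎ " => vee
local infixr:65 " ⋏ " => wedge
local infixr:70 " ⋎ₕ " => veeHom
local infixr:70 " ⋏ₕ " => wedgeHom

/-- A symmetric bimonoidal intermuting category. -/
class SMICategory (C : Type u) [Category.{v} C] extends SymmBimonoidal C where
  /-- intermutation -/
  ck (A B D E : C) : ((A ⋏ B) ⋎ (D ⋏ E)) ⟶ ((A ⋎ D) ⋏ (B ⋎ E))
  /-- `wBot.hom : ⊥ ∧ ⊥ ⟶ ⊥` -/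
  wBot : (bot C ⋏ bot C) ≅ bot C
  /-- `wTop.hom : ⊤ ∨ ⊤ ⟶ ⊤` -/
  wTop : (top C ⋎ top C) ≅ top C
  kappa : bot C ⟶ top C
  ck_naturality {A A' B B' D D' E E' : C}
    (f : A ⟶ A') (g : B ⟶ B') (h : D ⟶ D') (k : E ⟶ E') :
    ((f ⋏ₕ g) ⋎ₕ (h ⋏ₕ k)) ≫ ck A' B' D' E' = ck A B D E ≫ ((f ⋎ₕ h) ⋏ₕ (g ⋎ₕ k))
  ck_bWedge (A B D E F G : C) :
    ck A (B ⋏ D) E (F ⋏ G) ≫ (𝟙 (A ⋎ E) ⋏ₕ ck B D F G) ≫ (bWedge (A ⋎ E) (B ⋎ F) (D ⋎ G)).hom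
      = ((bWedge A B D).hom ⋎ₕ (bWedge E F G).hom) ≫ ck (A ⋏ B) D (E ⋏ F) G ≫
        (ck A B E F ⋏ₕ 𝟙 (D ⋎ G))
  ck_bVee (A B D E F G : C) :
    (bVee (A ⋏ E) (B ⋏ F) (D ⋏ G)).hom ≫ (ck A E B F ⋎ₕ 𝟙 (D ⋏ G)) ≫ ck (A ⋎ B) (E ⋎ F) D G
      = (𝟙 (A ⋏ E) ⋎ₕ ck B F D G) ≫ ck A E (B ⋎ D) (F ⋎ G) ≫
        ((bVee A B D).hom ⋏ₕ (bVee E F G).hom)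
  ck_cWedge (A B D E : C) :
    ck A B D E ≫ (cWedge (A ⋎ D) (B ⋎ E)).hom
      = ((cWedge A B).hom ⋎ₕ (cWedge D E).hom) ≫ ck B A E D
  ck_cVee (A B D E : C) :
    (cVee (A ⋏ D) (B ⋏ E)).hom ≫ ck B E A D
      = ck A D B E ≫ ((cVee A B).hom ⋏ₕ (cVee D E).hom)
  ck_bot (A B : C) :
    ck A B (bot C) (bot C)
      = (𝟙 (A ⋏ B) ⋎ₕ wBot.hom) ≫ (deltaVee (A ⋏ B)).hom ≫
        ((deltaVee A).inv ⋏ₕ (deltaVee B).inv)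
  ck_top (A B : C) :
    ck A (top C) B (top C)
      = ((deltaWedge A).hom ⋎ₕ (deltaWedge B).hom) ≫ (deltaWedge (A ⋎ B)).inv ≫
        (𝟙 (A ⋎ B) ⋏ₕ wTop.inv)
  bVee_top :
    (bVee (top C) (top C) (top C)).hom
      = (𝟙 (top C) ⋎ₕ wTop.hom) ≫ (wTop.inv ⋎ₕ 𝟙 (top C))
  bWedge_bot :
    (bWedge (bot C) (bot C) (bot C)).hom
      = (𝟙 (bot C) ⋏ₕ wBot.hom) ≫ (wBot.inv ⋏ₕ 𝟙 (bot C))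
  top_vee_kappa : (𝟙 (top C) ⋎ₕ kappa) = (deltaVee (top C)).hom ≫ wTop.inv
  bot_wedge_kappa : (𝟙 (bot C) ⋏ₕ kappa) = wBot.hom ≫ (deltaWedge (bot C)).inv
  ck_kappa :
    ck (top C) (bot C) (bot C) (top C)
      = ((sigmaWedge (bot C)).hom ⋎ₕ (deltaWedge (bot C)).hom) ≫ (deltaVee (bot C)).hom ≫ kappa ≫
        (deltaWedge (top C)).inv ≫ ((deltaVee (top C)).inv ⋏ₕ (sigmaVee (top C)).inv)
  cVee_top : (cVee (top C) (top C)).hom = wTop.hom ≫ wTop.inv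
  cWedge_bot : (cWedge (bot C) (bot C)).hom = wBot.hom ≫ wBot.inv

end SMI

/-! ## The SMI category freely generated by a set of letters -/

namespace FreeSMI

open CategoryTheory

universe u

/-- The objects: propositional formulae over the letters `P`. -/
inductive Formula (P : Type u) : Type u
  | letter (p : P) : Formula P
  | bot : Formula P
  | top : Formula P
  | vee (A B : Formula P) : Formula P
  | wedge (A B : Formula P) : Formula P

variable {P : Type u}

local infixr:65 " ⋎ " => Formula.vee
local infixr:65 " ⋏ " => Formula.wedge
local notation "⊥'" => Formula.bot
local notation "⊤'" => Formula.top

/-- Arrow terms. The suffixes `Hom` and `Inv` stand for the superscripts `→` and `←`. -/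
inductive ArrowTerm : Formula P → Formula P → Type u
  | one (A : Formula P) : ArrowTerm A A
  | bVeeHom (A B C : Formula P) : ArrowTerm (A ⋎ (B ⋎ C)) ((A ⋎ B) ⋎ C)
  | bVeeInv (A B C : Formula P) : ArrowTerm ((A ⋎ B) ⋎ C) (A ⋎ (B ⋎ C))
  | bWedgeHom (A B C : Formula P) : ArrowTerm (A ⋏ (B ⋏ C)) ((A ⋏ B) ⋏ C)
  | bWedgeInv (A B C : Formula P) : ArrowTerm ((A ⋏ B) ⋏ C) (A ⋏ (B ⋏ C))
  | cVee (A B : Formula P) : ArrowTerm (A ⋎ B) (B ⋎ A)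
  | cWedge (A B : Formula P) : ArrowTerm (A ⋏ B) (B ⋏ A)
  | deltaVeeHom (A : Formula P) : ArrowTerm (A ⋎ ⊥') A
  | deltaVeeInv (A : Formula P) : ArrowTerm A (A ⋎ ⊥')
  | deltaWedgeHom (A : Formula P) : ArrowTerm (A ⋏ ⊤') A
  | deltaWedgeInv (A : Formula P) : ArrowTerm A (A ⋏ ⊤')
  | sigmaVeeHom (A : Formula P) : ArrowTerm (⊥' ⋎ A) A
  | sigmaVeeInv (A : Formula P) : ArrowTerm A (⊥' ⋎ A)
  | sigmaWedgeHom (A : Formula P) : ArrowTerm (⊤' ⋏ A) A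
  | sigmaWedgeInv (A : Formula P) : ArrowTerm A (⊤' ⋏ A)
  | ck (A B C D : Formula P) : ArrowTerm ((A ⋏ B) ⋎ (C ⋏ D)) ((A ⋎ C) ⋏ (B ⋎ D))
  | wBotHom : ArrowTerm (⊥' ⋏ ⊥') ⊥'
  | wBotInv : ArrowTerm ⊥' (⊥' ⋏ ⊥')
  | wTopHom : ArrowTerm (⊤' ⋎ ⊤') ⊤'
  | wTopInv : ArrowTerm ⊤' (⊤' ⋎ ⊤')
  | kappa : ArrowTerm ⊥' ⊤'
  /-- Composition, in diagrammatic order: first `f`, then `g`. -/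
  | comp {A B C : Formula P} (f : ArrowTerm A B) (g : ArrowTerm B C) : ArrowTerm A C
  | veeHom {A A' B B' : Formula P} (f : ArrowTerm A A') (g : ArrowTerm B B') :
      ArrowTerm (A ⋎ B) (A' ⋎ B')
  | wedgeHom {A A' B B' : Formula P} (f : ArrowTerm A A') (g : ArrowTerm B B') :
      ArrowTerm (A ⋏ B) (A' ⋏ B')

local infixr:60 " ⨟ " => ArrowTerm.comp
local infixr:70 " ⋎ₕ " => ArrowTerm.veeHom
local infixr:70 " ⋏ₕ " => ArrowTerm.wedgeHom

open ArrowTerm in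
/-- The smallest equivalence relation on arrow terms that makes the formulae into an SMI
category: the congruence generated by the equations of SMI categories. -/
inductive Rel : {A B : Formula P} → ArrowTerm A B → ArrowTerm A B → Prop
  -- equivalence relation, congruent with respect to composition, `∨` and `∧`
  | refl {A B : Formula P} (f : ArrowTerm A B) : Rel f f
  | symm {A B : Formula P} {f g : ArrowTerm A B} : Rel f g → Rel g f
  | trans {A B : Formula P} {f g h : ArrowTerm A B} : Rel f g → Rel g h → Rel f h
  | comp {A B C : Formula P} {f f' : ArrowTerm A B} {g g' : ArrowTerm B C} :
      Rel f f' → Rel g g' → Rel (f ⨟ g) (f' ⨟ g')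
  | veeHom {A A' B B' : Formula P} {f f' : ArrowTerm A A'} {g g' : ArrowTerm B B'} :
      Rel f f' → Rel g g' → Rel (f ⋎ₕ g) (f' ⋎ₕ g')
  | wedgeHom {A A' B B' : Formula P} {f f' : ArrowTerm A A'} {g g' : ArrowTerm B B'} :
      Rel f f' → Rel g g' → Rel (f ⋏ₕ g) (f' ⋏ₕ g')
  -- category
  | id_comp {A B : Formula P} (f : ArrowTerm A B) : Rel (one A ⨟ f) f
  | comp_id {A B : Formula P} (f : ArrowTerm A B) : Rel (f ⨟ one B) f
  | assoc {A B C D : Formula P} (f : ArrowTerm A B) (g : ArrowTerm B C) (h : ArrowTerm C D) :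
      Rel ((f ⨟ g) ⨟ h) (f ⨟ (g ⨟ h))
  -- `∨` and `∧` are bifunctors
  | vee_id (A B : Formula P) : Rel (one A ⋎ₕ one B) (one (A ⋎ B))
  | vee_comp {A A' A'' B B' B'' : Formula P} (f : ArrowTerm A A') (f' : ArrowTerm A' A'')
      (g : ArrowTerm B B') (g' : ArrowTerm B' B'') :
      Rel ((f ⨟ f') ⋎ₕ (g ⨟ g')) ((f ⋎ₕ g) ⨟ (f' ⋎ₕ g'))
  | wedge_id (A B : Formula P) : Rel (one A ⋏ₕ one B) (one (A ⋏ B))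
  | wedge_comp {A A' A'' B B' B'' : Formula P} (f : ArrowTerm A A') (f' : ArrowTerm A' A'')
      (g : ArrowTerm B B') (g' : ArrowTerm B' B'') :
      Rel ((f ⨟ f') ⋏ₕ (g ⨟ g')) ((f ⋏ₕ g) ⨟ (f' ⋏ₕ g'))
  -- symmetric monoidal structure of `∨` and `⊥`
  | bVee_hom_inv (A B C : Formula P) : Rel (bVeeHom A B C ⨟ bVeeInv A B C) (one _)
  | bVee_inv_hom (A B C : Formula P) : Rel (bVeeInv A B C ⨟ bVeeHom A B C) (one _)
  | bVee_nat {A A' B B' C C' : Formula P}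
      (f : ArrowTerm A A') (g : ArrowTerm B B') (h : ArrowTerm C C') :
      Rel ((f ⋎ₕ (g ⋎ₕ h)) ⨟ bVeeHom A' B' C') (bVeeHom A B C ⨟ ((f ⋎ₕ g) ⋎ₕ h))
  | cVee_cVee (A B : Formula P) : Rel (cVee A B ⨟ cVee B A) (one (A ⋎ B))
  | cVee_nat {A A' B B' : Formula P} (f : ArrowTerm A A') (g : ArrowTerm B B') :
      Rel ((f ⋎ₕ g) ⨟ cVee A' B') (cVee A B ⨟ (g ⋎ₕ f))
  | deltaVee_hom_inv (A : Formula P) : Rel (deltaVeeHom A ⨟ deltaVeeInv A) (one _)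
  | deltaVee_inv_hom (A : Formula P) : Rel (deltaVeeInv A ⨟ deltaVeeHom A) (one _)
  | deltaVee_nat {A A' : Formula P} (f : ArrowTerm A A') :
      Rel ((f ⋎ₕ one ⊥') ⨟ deltaVeeHom A') (deltaVeeHom A ⨟ f)
  | sigmaVee_hom_inv (A : Formula P) : Rel (sigmaVeeHom A ⨟ sigmaVeeInv A) (one _)
  | sigmaVee_inv_hom (A : Formula P) : Rel (sigmaVeeInv A ⨟ sigmaVeeHom A) (one _)
  | sigmaVee_nat {A A' : Formula P} (f : ArrowTerm A A') :
      Rel ((one ⊥' ⋎ₕ f) ⨟ sigmaVeeHom A') (sigmaVeeHom A ⨟ f)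
  | vee_pentagon (A B C D : Formula P) :
      Rel ((one A ⋎ₕ bVeeHom B C D) ⨟ bVeeHom A (B ⋎ C) D ⨟ (bVeeHom A B C ⋎ₕ one D))
        (bVeeHom A B (C ⋎ D) ⨟ bVeeHom (A ⋎ B) C D)
  | vee_triangle (A B : Formula P) :
      Rel (bVeeHom A ⊥' B ⨟ (deltaVeeHom A ⋎ₕ one B)) (one A ⋎ₕ sigmaVeeHom B)
  | vee_hexagon (A B C : Formula P) :
      Rel (bVeeHom A B C ⨟ cVee (A ⋎ B) C ⨟ bVeeHom C A B)
        ((one A ⋎ₕ cVee B C) ⨟ bVeeHom A C B ⨟ (cVee A C ⋎ₕ one B))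
  -- symmetric monoidal structure of `∧` and `⊤`
  | bWedge_hom_inv (A B C : Formula P) : Rel (bWedgeHom A B C ⨟ bWedgeInv A B C) (one _)
  | bWedge_inv_hom (A B C : Formula P) : Rel (bWedgeInv A B C ⨟ bWedgeHom A B C) (one _)
  | bWedge_nat {A A' B B' C C' : Formula P}
      (f : ArrowTerm A A') (g : ArrowTerm B B') (h : ArrowTerm C C') :
      Rel ((f ⋏ₕ (g ⋏ₕ h)) ⨟ bWedgeHom A' B' C') (bWedgeHom A B C ⨟ ((f ⋏ₕ g) ⋏ₕ h))
  | cWedge_cWedge (A B : Formula P) : Rel (cWedge A B ⨟ cWedge B A) (one (A ⋏ B))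
  | cWedge_nat {A A' B B' : Formula P} (f : ArrowTerm A A') (g : ArrowTerm B B') :
      Rel ((f ⋏ₕ g) ⨟ cWedge A' B') (cWedge A B ⨟ (g ⋏ₕ f))
  | deltaWedge_hom_inv (A : Formula P) : Rel (deltaWedgeHom A ⨟ deltaWedgeInv A) (one _)
  | deltaWedge_inv_hom (A : Formula P) : Rel (deltaWedgeInv A ⨟ deltaWedgeHom A) (one _)
  | deltaWedge_nat {A A' : Formula P} (f : ArrowTerm A A') :
      Rel ((f ⋏ₕ one ⊤') ⨟ deltaWedgeHom A') (deltaWedgeHom A ⨟ f)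
  | sigmaWedge_hom_inv (A : Formula P) : Rel (sigmaWedgeHom A ⨟ sigmaWedgeInv A) (one _)
  | sigmaWedge_inv_hom (A : Formula P) : Rel (sigmaWedgeInv A ⨟ sigmaWedgeHom A) (one _)
  | sigmaWedge_nat {A A' : Formula P} (f : ArrowTerm A A') :
      Rel ((one ⊤' ⋏ₕ f) ⨟ sigmaWedgeHom A') (sigmaWedgeHom A ⨟ f)
  | wedge_pentagon (A B C D : Formula P) :
      Rel ((one A ⋏ₕ bWedgeHom B C D) ⨟ bWedgeHom A (B ⋏ C) D ⨟ (bWedgeHom A B C ⋏ₕ one D))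
        (bWedgeHom A B (C ⋏ D) ⨟ bWedgeHom (A ⋏ B) C D)
  | wedge_triangle (A B : Formula P) :
      Rel (bWedgeHom A ⊤' B ⨟ (deltaWedgeHom A ⋏ₕ one B)) (one A ⋏ₕ sigmaWedgeHom B)
  | wedge_hexagon (A B C : Formula P) :
      Rel (bWedgeHom A B C ⨟ cWedge (A ⋏ B) C ⨟ bWedgeHom C A B)
        ((one A ⋏ₕ cWedge B C) ⨟ bWedgeHom A C B ⨟ (cWedge A C ⋏ₕ one B))
  -- the isomorphisms `w` and the intermutation `ck`
  | wBot_hom_inv : Rel (wBotHom ⨟ wBotInv) (one (⊥' ⋏ ⊥'))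
  | wBot_inv_hom : Rel (wBotInv ⨟ wBotHom) (one ⊥')
  | wTop_hom_inv : Rel (wTopHom ⨟ wTopInv) (one (⊤' ⋎ ⊤'))
  | wTop_inv_hom : Rel (wTopInv ⨟ wTopHom) (one ⊤')
  | ck_nat {A A' B B' C C' D D' : Formula P} (f : ArrowTerm A A') (g : ArrowTerm B B')
      (h : ArrowTerm C C') (k : ArrowTerm D D') :
      Rel (((f ⋏ₕ g) ⋎ₕ (h ⋏ₕ k)) ⨟ ck A' B' C' D') (ck A B C D ⨟ ((f ⋎ₕ h) ⋏ₕ (g ⋎ₕ k)))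
  | ck_bWedge (A B C D E F : Formula P) :
      Rel (ck A (B ⋏ C) D (E ⋏ F) ⨟ (one (A ⋎ D) ⋏ₕ ck B C E F) ⨟
          bWedgeHom (A ⋎ D) (B ⋎ E) (C ⋎ F))
        ((bWedgeHom A B C ⋎ₕ bWedgeHom D E F) ⨟ ck (A ⋏ B) C (D ⋏ E) F ⨟
          (ck A B D E ⋏ₕ one (C ⋎ F)))
  | ck_bVee (A B C D E F : Formula P) :
      Rel (bVeeHom (A ⋏ D) (B ⋏ E) (C ⋏ F) ⨟ (ck A D B E ⋎ₕ one (C ⋏ F)) ⨟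
          ck (A ⋎ B) (D ⋎ E) C F)
        ((one (A ⋏ D) ⋎ₕ ck B E C F) ⨟ ck A D (B ⋎ C) (E ⋎ F) ⨟
          (bVeeHom A B C ⋏ₕ bVeeHom D E F))
  | ck_cWedge (A B C D : Formula P) :
      Rel (ck A B C D ⨟ cWedge (A ⋎ C) (B ⋎ D)) ((cWedge A B ⋎ₕ cWedge C D) ⨟ ck B A D C)
  | ck_cVee (A B C D : Formula P) :
      Rel (cVee (A ⋏ C) (B ⋏ D) ⨟ ck B D A C) (ck A C B D ⨟ (cVee A B ⋏ₕ cVee C D))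
  | ck_bot (A B : Formula P) :
      Rel (ck A B ⊥' ⊥')
        ((one (A ⋏ B) ⋎ₕ wBotHom) ⨟ deltaVeeHom (A ⋏ B) ⨟ (deltaVeeInv A ⋏ₕ deltaVeeInv B))
  | ck_top (A B : Formula P) :
      Rel (ck A ⊤' B ⊤')
        ((deltaWedgeHom A ⋎ₕ deltaWedgeHom B) ⨟ deltaWedgeInv (A ⋎ B) ⨟ (one (A ⋎ B) ⋏ₕ wTopInv))
  | bVee_top : Rel (bVeeHom ⊤' ⊤' ⊤') ((one ⊤' ⋎ₕ wTopHom) ⨟ (wTopInv ⋎ₕ one ⊤'))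
  | bWedge_bot : Rel (bWedgeHom ⊥' ⊥' ⊥') ((one ⊥' ⋏ₕ wBotHom) ⨟ (wBotInv ⋏ₕ one ⊥'))
  | top_vee_kappa : Rel (one ⊤' ⋎ₕ kappa) (deltaVeeHom ⊤' ⨟ wTopInv)
  | bot_wedge_kappa : Rel (one ⊥' ⋏ₕ kappa) (wBotHom ⨟ deltaWedgeInv ⊥')
  | ck_kappa :
      Rel (ck ⊤' ⊥' ⊥' ⊤')
        ((sigmaWedgeHom ⊥' ⋎ₕ deltaWedgeHom ⊥') ⨟ deltaVeeHom ⊥' ⨟ kappa ⨟ deltaWedgeInv ⊤' ⨟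
          (deltaVeeInv ⊤' ⋏ₕ sigmaVeeInv ⊤'))
  | cVee_top : Rel (cVee ⊤' ⊤') (wTopHom ⨟ wTopInv)
  | cWedge_bot : Rel (cWedge ⊥' ⊥') (wBotHom ⨟ wBotInv)

instance homSetoid (A B : Formula P) : Setoid (ArrowTerm A B) :=
  ⟨Rel, Rel.refl, Rel.symm, Rel.trans⟩

/-- The free SMI category: its arrows are the equivalence classes of arrow terms. -/
instance category : Category.{u} (Formula P) where
  Hom A B := Quotient (homSetoid A B)
  id A := ⟦ArrowTerm.one A⟧
  comp := Quotient.map₂ ArrowTerm.comp fun _ _ h _ _ h' => Rel.comp h h'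
  id_comp := by rintro A B ⟨f⟩; exact Quotient.sound (Rel.id_comp f)
  comp_id := by rintro A B ⟨f⟩; exact Quotient.sound (Rel.comp_id f)
  assoc := by rintro A B C D ⟨f⟩ ⟨g⟩ ⟨h⟩; exact Quotient.sound (Rel.assoc f g h)

/-- The arrow represented by an arrow term. -/
def arr {A B : Formula P} (f : ArrowTerm A B) : A ⟶ B := (⟦f⟧ : Quotient (homSetoid A B))

theorem arr_eq {A B : Formula P} {f g : ArrowTerm A B} (h : Rel f g) : arr f = arr g :=
  Quotient.sound h

/-- Mutually inverse arrow terms represent an isomorphism. -/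
def arrIso {A B : Formula P} (f : ArrowTerm A B) (g : ArrowTerm B A)
    (h : Rel (f ⨟ g) (ArrowTerm.one A)) (h' : Rel (g ⨟ f) (ArrowTerm.one B)) : A ≅ B where
  hom := arr f
  inv := arr g
  hom_inv_id := arr_eq h
  inv_hom_id := arr_eq h'

def veeMap {A A' B B' : Formula P} : (A ⟶ A') → (B ⟶ B') → ((A ⋎ B) ⟶ (A' ⋎ B')) :=
  Quotient.map₂ ArrowTerm.veeHom fun _ _ h _ _ h' => Rel.veeHom h h'

def wedgeMap {A A' B B' : Formula P} : (A ⟶ A') → (B ⟶ B') → ((A ⋏ B) ⟶ (A' ⋏ B')) :=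
  Quotient.map₂ ArrowTerm.wedgeHom fun _ _ h _ _ h' => Rel.wedgeHom h h'

theorem eq_of_inv_eq {A B : Formula P} {f g : A ⟶ B} {f' g' : B ⟶ A} (hf : f' ≫ f = 𝟙 B)
    (hg : g ≫ g' = 𝟙 A) (h : f' = g') : f = g := by
  rw [← Category.id_comp f, ← hg, ← h, Category.assoc, hf, Category.comp_id]

theorem bVee_hom_inv (A B C : Formula P) :
    arr (.bVeeHom A B C) ≫ arr (.bVeeInv A B C) = 𝟙 _ := arr_eq (Rel.bVee_hom_inv A B C)

theorem bVee_inv_hom (A B C : Formula P) :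
    arr (.bVeeInv A B C) ≫ arr (.bVeeHom A B C) = 𝟙 _ := arr_eq (Rel.bVee_inv_hom A B C)

theorem cVee_cVee (A B : Formula P) :
    arr (.cVee A B) ≫ arr (.cVee B A) = 𝟙 _ := arr_eq (Rel.cVee_cVee A B)

theorem bWedge_hom_inv (A B C : Formula P) :
    arr (.bWedgeHom A B C) ≫ arr (.bWedgeInv A B C) = 𝟙 _ := arr_eq (Rel.bWedge_hom_inv A B C)

theorem bWedge_inv_hom (A B C : Formula P) :
    arr (.bWedgeInv A B C) ≫ arr (.bWedgeHom A B C) = 𝟙 _ := arr_eq (Rel.bWedge_inv_hom A B C)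

theorem cWedge_cWedge (A B : Formula P) :
    arr (.cWedge A B) ≫ arr (.cWedge B A) = 𝟙 _ := arr_eq (Rel.cWedge_cWedge A B)

theorem veeMap_id (A B : Formula P) : veeMap (𝟙 A) (𝟙 B) = 𝟙 (Formula.vee A B) :=
  arr_eq (Rel.vee_id A B)

theorem veeMap_comp {A A' A'' B B' B'' : Formula P} :
    ∀ (f : A ⟶ A') (g : B ⟶ B') (f' : A' ⟶ A'') (g' : B' ⟶ B''),
      veeMap f g ≫ veeMap f' g' = veeMap (f ≫ f') (g ≫ g') := by
  rintro ⟨f⟩ ⟨g⟩ ⟨f'⟩ ⟨g'⟩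
  exact (arr_eq (Rel.vee_comp f f' g g')).symm

abbrev veeMonoidalStruct : MonoidalCategoryStruct (Formula P) where
  tensorObj := Formula.vee
  tensorUnit := Formula.bot
  tensorHom := veeMap
  whiskerLeft A _ _ g := veeMap (𝟙 A) g
  whiskerRight f B := veeMap f (𝟙 B)
  associator A B C := (arrIso _ _ (Rel.bVee_hom_inv A B C) (Rel.bVee_inv_hom A B C)).symm
  leftUnitor A := arrIso _ _ (Rel.sigmaVee_hom_inv A) (Rel.sigmaVee_inv_hom A)
  rightUnitor A := arrIso _ _ (Rel.deltaVee_hom_inv A) (Rel.deltaVee_inv_hom A)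

abbrev veeMonoidal : MonoidalCategory (Formula P) :=
  letI := veeMonoidalStruct (P := P)
  MonoidalCategory.ofTensorHom
    (id_tensorHom_id := veeMap_id)
    (id_tensorHom := fun _ _ _ _ => rfl)
    (tensorHom_id := fun _ _ => rfl)
    (tensorHom_comp_tensorHom := veeMap_comp)
    (associator_naturality := by
      rintro _ _ _ _ _ _ ⟨f⟩ ⟨g⟩ ⟨h⟩
      rw [← Iso.inv_comp_eq, ← Category.assoc, ← Iso.eq_comp_inv]
      exact (arr_eq (Rel.bVee_nat f g h)).symm)
    (leftUnitor_naturality := by rintro _ _ ⟨f⟩; exact arr_eq (Rel.sigmaVee_nat f))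
    (rightUnitor_naturality := by rintro _ _ ⟨f⟩; exact arr_eq (Rel.deltaVee_nat f))
    (pentagon := fun A B C D => by
      refine eq_of_inv_eq ?_ ?_ (arr_eq (Rel.vee_pentagon A B C D))
      · change (veeMap (𝟙 A) (arr (.bVeeHom B C D)) ≫ arr (.bVeeHom A (.vee B C) D) ≫
          veeMap (arr (.bVeeHom A B C)) (𝟙 D)) ≫
          veeMap (arr (.bVeeInv A B C)) (𝟙 D) ≫ arr (.bVeeInv A (.vee B C) D) ≫
            veeMap (𝟙 A) (arr (.bVeeInv B C D)) = 𝟙 _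
        simp [reassoc_of% veeMap_comp, veeMap_comp, veeMap_id, reassoc_of% bVee_hom_inv,
          bVee_hom_inv]
      · change (arr (.bVeeInv (.vee A B) C D) ≫ arr (.bVeeInv A B (.vee C D))) ≫
          arr (.bVeeHom A B (.vee C D)) ≫ arr (.bVeeHom (.vee A B) C D) = 𝟙 _
        simp [reassoc_of% bVee_inv_hom, bVee_inv_hom])
    (triangle := fun A B => by
      rw [← Iso.eq_inv_comp]
      exact (arr_eq (Rel.vee_triangle A B)).symm)

abbrev veeSymmetric : @SymmetricCategory (Formula P) _ veeMonoidal :=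
  letI := veeMonoidal (P := P)
  { braiding := fun A B => arrIso _ _ (Rel.cVee_cVee A B) (Rel.cVee_cVee B A)
    braiding_naturality_right := by
      rintro A _ _ ⟨g⟩; exact arr_eq (Rel.cVee_nat (ArrowTerm.one A) g)
    braiding_naturality_left := by
      rintro _ _ ⟨f⟩ B; exact arr_eq (Rel.cVee_nat f (ArrowTerm.one B))
    hexagon_forward := fun A B C => by
      refine eq_of_inv_eq ?_ ?_ (arr_eq (Rel.vee_hexagon B C A))
      · change (arr (.bVeeHom B C A) ≫ arr (.cVee (.vee B C) A) ≫ arr (.bVeeHom A B C)) ≫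
          arr (.bVeeInv A B C) ≫ arr (.cVee A (.vee B C)) ≫ arr (.bVeeInv B C A) = 𝟙 _
        simp [reassoc_of% bVee_hom_inv, bVee_hom_inv, reassoc_of% cVee_cVee]
      · change (veeMap (arr (.cVee A B)) (𝟙 C) ≫ arr (.bVeeInv B A C) ≫
          veeMap (𝟙 B) (arr (.cVee A C))) ≫ veeMap (𝟙 B) (arr (.cVee C A)) ≫
          arr (.bVeeHom B A C) ≫ veeMap (arr (.cVee B A)) (𝟙 C) = 𝟙 _
        simp [reassoc_of% veeMap_comp, veeMap_comp, veeMap_id, reassoc_of% bVee_inv_hom,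
          cVee_cVee]
    hexagon_reverse := fun A B C => arr_eq (Rel.vee_hexagon A B C)
    symmetry := fun A B => arr_eq (Rel.cVee_cVee A B) }

theorem wedgeMap_id (A B : Formula P) : wedgeMap (𝟙 A) (𝟙 B) = 𝟙 (Formula.wedge A B) :=
  arr_eq (Rel.wedge_id A B)

theorem wedgeMap_comp {A A' A'' B B' B'' : Formula P} :
    ∀ (f : A ⟶ A') (g : B ⟶ B') (f' : A' ⟶ A'') (g' : B' ⟶ B''),
      wedgeMap f g ≫ wedgeMap f' g' = wedgeMap (f ≫ f') (g ≫ g') := by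
  rintro ⟨f⟩ ⟨g⟩ ⟨f'⟩ ⟨g'⟩
  exact (arr_eq (Rel.wedge_comp f f' g g')).symm

abbrev wedgeMonoidalStruct : MonoidalCategoryStruct (Formula P) where
  tensorObj := Formula.wedge
  tensorUnit := Formula.top
  tensorHom := wedgeMap
  whiskerLeft A _ _ g := wedgeMap (𝟙 A) g
  whiskerRight f B := wedgeMap f (𝟙 B)
  associator A B C := (arrIso _ _ (Rel.bWedge_hom_inv A B C) (Rel.bWedge_inv_hom A B C)).symm
  leftUnitor A := arrIso _ _ (Rel.sigmaWedge_hom_inv A) (Rel.sigmaWedge_inv_hom A)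
  rightUnitor A := arrIso _ _ (Rel.deltaWedge_hom_inv A) (Rel.deltaWedge_inv_hom A)

abbrev wedgeMonoidal : MonoidalCategory (Formula P) :=
  letI := wedgeMonoidalStruct (P := P)
  MonoidalCategory.ofTensorHom
    (id_tensorHom_id := wedgeMap_id)
    (id_tensorHom := fun _ _ _ _ => rfl)
    (tensorHom_id := fun _ _ => rfl)
    (tensorHom_comp_tensorHom := wedgeMap_comp)
    (associator_naturality := by
      rintro _ _ _ _ _ _ ⟨f⟩ ⟨g⟩ ⟨h⟩
      rw [← Iso.inv_comp_eq, ← Category.assoc, ← Iso.eq_comp_inv]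
      exact (arr_eq (Rel.bWedge_nat f g h)).symm)
    (leftUnitor_naturality := by rintro _ _ ⟨f⟩; exact arr_eq (Rel.sigmaWedge_nat f))
    (rightUnitor_naturality := by rintro _ _ ⟨f⟩; exact arr_eq (Rel.deltaWedge_nat f))
    (pentagon := fun A B C D => by
      refine eq_of_inv_eq ?_ ?_ (arr_eq (Rel.wedge_pentagon A B C D))
      · change (wedgeMap (𝟙 A) (arr (.bWedgeHom B C D)) ≫ arr (.bWedgeHom A (.wedge B C) D) ≫
          wedgeMap (arr (.bWedgeHom A B C)) (𝟙 D)) ≫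
          wedgeMap (arr (.bWedgeInv A B C)) (𝟙 D) ≫ arr (.bWedgeInv A (.wedge B C) D) ≫
            wedgeMap (𝟙 A) (arr (.bWedgeInv B C D)) = 𝟙 _
        simp [reassoc_of% wedgeMap_comp, wedgeMap_comp, wedgeMap_id, reassoc_of% bWedge_hom_inv,
          bWedge_hom_inv]
      · change (arr (.bWedgeInv (.wedge A B) C D) ≫ arr (.bWedgeInv A B (.wedge C D))) ≫
          arr (.bWedgeHom A B (.wedge C D)) ≫ arr (.bWedgeHom (.wedge A B) C D) = 𝟙 _
        simp [reassoc_of% bWedge_inv_hom, bWedge_inv_hom])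
    (triangle := fun A B => by
      rw [← Iso.eq_inv_comp]
      exact (arr_eq (Rel.wedge_triangle A B)).symm)

abbrev wedgeSymmetric : @SymmetricCategory (Formula P) _ wedgeMonoidal :=
  letI := wedgeMonoidal (P := P)
  { braiding := fun A B => arrIso _ _ (Rel.cWedge_cWedge A B) (Rel.cWedge_cWedge B A)
    braiding_naturality_right := by
      rintro A _ _ ⟨g⟩; exact arr_eq (Rel.cWedge_nat (ArrowTerm.one A) g)
    braiding_naturality_left := by
      rintro _ _ ⟨f⟩ B; exact arr_eq (Rel.cWedge_nat f (ArrowTerm.one B))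
    hexagon_forward := fun A B C => by
      refine eq_of_inv_eq ?_ ?_ (arr_eq (Rel.wedge_hexagon B C A))
      · change (arr (.bWedgeHom B C A) ≫ arr (.cWedge (.wedge B C) A) ≫ arr (.bWedgeHom A B C)) ≫
          arr (.bWedgeInv A B C) ≫ arr (.cWedge A (.wedge B C)) ≫ arr (.bWedgeInv B C A) = 𝟙 _
        simp [reassoc_of% bWedge_hom_inv, bWedge_hom_inv, reassoc_of% cWedge_cWedge]
      · change (wedgeMap (arr (.cWedge A B)) (𝟙 C) ≫ arr (.bWedgeInv B A C) ≫
          wedgeMap (𝟙 B) (arr (.cWedge A C))) ≫ wedgeMap (𝟙 B) (arr (.cWedge C A)) ≫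
          arr (.bWedgeHom B A C) ≫ wedgeMap (arr (.cWedge B A)) (𝟙 C) = 𝟙 _
        simp [reassoc_of% wedgeMap_comp, wedgeMap_comp, wedgeMap_id, reassoc_of% bWedge_inv_hom,
          cWedge_cWedge]
    hexagon_reverse := fun A B C => arr_eq (Rel.wedge_hexagon A B C)
    symmetry := fun A B => arr_eq (Rel.cWedge_cWedge A B) }

/-- The free SMI category is an SMI category. -/
instance smiCategory : SMI.SMICategory (Formula P) where
  disj := veeMonoidal
  disjSymm := veeSymmetric
  conj := wedgeMonoidal
  conjSymm := wedgeSymmetric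
  ck A B D E := arr (.ck A B D E)
  wBot := arrIso _ _ Rel.wBot_hom_inv Rel.wBot_inv_hom
  wTop := arrIso _ _ Rel.wTop_hom_inv Rel.wTop_inv_hom
  kappa := arr .kappa
  ck_naturality := by
    rintro _ _ _ _ _ _ _ _ ⟨f⟩ ⟨g⟩ ⟨h⟩ ⟨k⟩; exact arr_eq (Rel.ck_nat f g h k)
  ck_bWedge A B D E F G := arr_eq (Rel.ck_bWedge A B D E F G)
  ck_bVee A B D E F G := arr_eq (Rel.ck_bVee A B D E F G)
  ck_cWedge A B D E := arr_eq (Rel.ck_cWedge A B D E)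
  ck_cVee A B D E := arr_eq (Rel.ck_cVee A B D E)
  ck_bot A B := arr_eq (Rel.ck_bot A B)
  ck_top A B := arr_eq (Rel.ck_top A B)
  bVee_top := arr_eq Rel.bVee_top
  bWedge_bot := arr_eq Rel.bWedge_bot
  top_vee_kappa := arr_eq Rel.top_vee_kappa
  bot_wedge_kappa := arr_eq Rel.bot_wedge_kappa
  ck_kappa := arr_eq Rel.ck_kappa
  cVee_top := arr_eq Rel.cVee_top
  cWedge_bot := arr_eq Rel.cWedge_bot

/-! ## Pure and diversified objects -/

namespace Formula

/-- The letters of a formula, listed from left to right, with repetitions. -/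
def letters : Formula P → List P
  | letter p => [p]
  | bot => []
  | top => []
  | vee A B => A.letters ++ B.letters
  | wedge A B => A.letters ++ B.letters

/-- No letter occurs in the formula. -/
def Letterless (A : Formula P) : Prop := A.letters = []

/-- Every letter occurs at most once in the formula. -/
def Diversified (A : Formula P) : Prop := A.letters.Nodup

/-- `A ∨ B` for reduced `A` and `B`, itself reduced: `A ∨ ⊥` and `⊥ ∨ A` are replaced by `A`,
and `⊤ ∨ ⊤` is replaced by `⊤`. -/
def reduceVee : Formula P → Formula P → Formula P
  | A, bot => A
  | bot, B => B
  | top, top => top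
  | A, B => vee A B

/-- `A ∧ B` for reduced `A` and `B`, itself reduced: `A ∧ ⊤` and `⊤ ∧ A` are replaced by `A`,
and `⊥ ∧ ⊥` is replaced by `⊥`. -/
def reduceWedge : Formula P → Formula P → Formula P
  | A, top => A
  | top, B => B
  | bot, bot => bot
  | A, B => wedge A B

/-- The reduced form of a formula: the result of replacing, as long as possible, subformulae
`B ∨ ⊥`, `⊥ ∨ B`, `B ∧ ⊤`, `⊤ ∧ B` by `B`, `⊥ ∧ ⊥` by `⊥` and `⊤ ∨ ⊤` by `⊤`. -/
def nu : Formula P → Formula P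
  | letter p => letter p
  | bot => bot
  | top => top
  | vee A B => reduceVee A.nu B.nu
  | wedge A B => reduceWedge A.nu B.nu

/-- `⊥` occurs in the formula. -/
def BotOccurs : Formula P → Prop
  | letter _ => False
  | bot => True
  | top => False
  | vee A B => A.BotOccurs ∨ B.BotOccurs
  | wedge A B => A.BotOccurs ∨ B.BotOccurs

/-- `⊤` occurs in the formula. -/
def TopOccurs : Formula P → Prop
  | letter _ => False
  | bot => False
  | top => True
  | vee A B => A.TopOccurs ∨ B.TopOccurs
  | wedge A B => A.TopOccurs ∨ B.TopOccurs

/-- The units do not occur in the reduced form. -/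
def Pure (A : Formula P) : Prop := ¬ A.nu.BotOccurs ∧ ¬ A.nu.TopOccurs

end Formula

end FreeSMI

/-! Letterless case. Among letterless formulae `⊤` is terminal and `⊥` is initial: each such formula
has, by recursion, an arrow to `⊤` and an arrow from `⊥`, and the SMI equations at the units make
both families natural in every arrow (`comp_toTop`, `fromBot_comp`). The truth value of the formula
decides which of the two is invertible (`isIso_toTop_and_isIso_fromBot`); the mixed cases rest on `1
∨ κ` at `⊤` and `1 ∧ κ` at `⊥` being isomorphisms. Arrows preserve truth, so an arrow `A ⟶ B` forces
`A ≅ ⊥` or `B ≅ ⊤`, and parallel arrows agree.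

Pure case. Since `A ≅ ν(A)`, the formulae may be taken free of units; the proof is by induction on
the number of letters. Let `B = B₁ ∧ B₂`, let `S` be the set of letters of `B₁`, and write `X^S` for
`X` with the letters outside `S` replaced by `⊤`. There are arrows `X ⟶ X^S ∧ X^{Sᶜ}`, natural in
`X` (`split_natural`), because conjunction respects the SMI structure, with intermutation and the
exchange of middle factors as its structure maps. At `B₁ ∧ B₂` this arrow is invertible, as
`B₁^{Sᶜ}` and `B₂^S` are isomorphic to `⊤`. So an arrow into `B` is determined by its two
substitution instances, which have fewer letters. Arrows out of a disjunction are treated dually,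
with `⊥` in place of `⊤` (`merge_natural`).

The induction needs `A^S` to be pure, which can fail only if some disjunction in `A` has exactly one
disjunct meeting `S`. This is excluded by a valuation (`veeBalanced_of_hom`): a conjunct of `B` can
be falsified by a set of letters no two of which are joined by a conjunction; arrows preserve such
joins, so the set has the same property in `A`, and there the bad disjunction makes `A` true.

There is no arrow from a conjunction to a disjunction: the joins by conjunctions connect all letters
of the source but not those of the target (`isEmpty_hom_wedge_vee`). Finally, the only arrow from a
letter to itself is the identity (`eq_id_of_letter`): arrows to the letter that merely delete false
disjuncts and true conjuncts are stable under precomposition (`pulls`), and on the letter itself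
only the identity is of this kind. -/

namespace CategoryTheory.MonoidalCategory

open CategoryTheory

universe v u

variable {C : Type u} [Category.{v} C] [MonoidalCategory C] [SymmetricCategory C]

/-- By the hexagons the large braiding consists of four crossings. The exchange after it crosses
`Y₂` back over `X₁`, and symmetry cancels this against one of the four. -/
theorem tensorμ_braiding (X₁ X₂ Y₁ Y₂ : C) :
    tensorμ X₁ X₂ Y₁ Y₂ ≫ ((β_ X₁ Y₁).hom ⊗ₘ (β_ X₂ Y₂).hom) =
      (β_ (X₁ ⊗ X₂) (Y₁ ⊗ Y₂)).hom ≫ tensorμ Y₁ Y₂ X₁ X₂ := by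
  dsimp only [tensorμ]
  simp only [BraidedCategory.braiding_tensor_left_hom, BraidedCategory.braiding_tensor_right_hom]
  have e : (β_ X₁ Y₂).hom ≫ (β_ Y₂ X₁).hom = 𝟙 _ := SymmetricCategory.symmetry _ _
  symm
  calc
    _ = 𝟙 _ ⊗≫ X₁ ◁ (β_ X₂ Y₁).hom ▷ Y₂ ⊗≫
      ((β_ X₁ Y₁).hom ▷ (X₂ ⊗ Y₂) ≫ (Y₁ ⊗ X₁) ◁ (β_ X₂ Y₂).hom) ⊗≫
        Y₁ ◁ ((β_ X₁ Y₂).hom ≫ (β_ Y₂ X₁).hom) ▷ X₂ ⊗≫ 𝟙 _ := by monoidal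
    _ = _ := by rw [e, tensorHom_def]; monoidal

end CategoryTheory.MonoidalCategory

namespace FreeSMI

open CategoryTheory

universe u

variable {P : Type u}

local infixr:65 " ⋎ " => Formula.vee
local infixr:65 " ⋏ " => Formula.wedge
local notation "⊥'" => Formula.bot
local notation "⊤'" => Formula.top
local infixr:70 " ⋎ₘ " => veeMap
local infixr:70 " ⋏ₘ " => wedgeMap

/-! ## Equations between arrows of the free SMI category -/

theorem arr_one (A : Formula P) : arr (.one A) = 𝟙 A := rfl

theorem arr_comp {A B C : Formula P} (f : ArrowTerm A B) (g : ArrowTerm B C) :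
    arr (.comp f g) = arr f ≫ arr g := rfl

theorem arr_veeHom {A A' B B' : Formula P} (f : ArrowTerm A A') (g : ArrowTerm B B') :
    arr (.veeHom f g) = arr f ⋎ₘ arr g := rfl

theorem arr_wedgeHom {A A' B B' : Formula P} (f : ArrowTerm A A') (g : ArrowTerm B B') :
    arr (.wedgeHom f g) = arr f ⋏ₘ arr g := rfl

theorem exists_arr {A B : Formula P} (f : A ⟶ B) : ∃ t : ArrowTerm A B, arr t = f := by
  obtain ⟨t⟩ := f
  exact ⟨t, rfl⟩

section Equations

variable {A A' B B' C C' D D' : Formula P}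

theorem bVeeHom_natural (f : A ⟶ A') (g : B ⟶ B') (h : C ⟶ C') :
    (f ⋎ₘ g ⋎ₘ h) ≫ arr (.bVeeHom A' B' C') = arr (.bVeeHom A B C) ≫ ((f ⋎ₘ g) ⋎ₘ h) := by
  obtain ⟨f, rfl⟩ := exists_arr f
  obtain ⟨g, rfl⟩ := exists_arr g
  obtain ⟨h, rfl⟩ := exists_arr h
  exact arr_eq (Rel.bVee_nat f g h)

theorem bWedgeHom_natural (f : A ⟶ A') (g : B ⟶ B') (h : C ⟶ C') :
    (f ⋏ₘ g ⋏ₘ h) ≫ arr (.bWedgeHom A' B' C') = arr (.bWedgeHom A B C) ≫ ((f ⋏ₘ g) ⋏ₘ h) := by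
  obtain ⟨f, rfl⟩ := exists_arr f
  obtain ⟨g, rfl⟩ := exists_arr g
  obtain ⟨h, rfl⟩ := exists_arr h
  exact arr_eq (Rel.bWedge_nat f g h)

theorem bVeeInv_natural (f : A ⟶ A') (g : B ⟶ B') (h : C ⟶ C') :
    ((f ⋎ₘ g) ⋎ₘ h) ≫ arr (.bVeeInv A' B' C') = arr (.bVeeInv A B C) ≫ (f ⋎ₘ g ⋎ₘ h) := by
  have := congr_arg (fun k => arr (.bVeeInv A B C) ≫ k ≫ arr (.bVeeInv A' B' C'))
    (bVeeHom_natural f g h)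
  simpa [reassoc_of% bVee_inv_hom, bVee_hom_inv] using this.symm

theorem bWedgeInv_natural (f : A ⟶ A') (g : B ⟶ B') (h : C ⟶ C') :
    ((f ⋏ₘ g) ⋏ₘ h) ≫ arr (.bWedgeInv A' B' C') = arr (.bWedgeInv A B C) ≫ (f ⋏ₘ g ⋏ₘ h) := by
  have := congr_arg (fun k => arr (.bWedgeInv A B C) ≫ k ≫ arr (.bWedgeInv A' B' C'))
    (bWedgeHom_natural f g h)
  simpa [reassoc_of% bWedge_inv_hom, bWedge_hom_inv] using this.symm

theorem cVee_natural (f : A ⟶ A') (g : B ⟶ B') :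
    (f ⋎ₘ g) ≫ arr (.cVee A' B') = arr (.cVee A B) ≫ (g ⋎ₘ f) := by
  obtain ⟨f, rfl⟩ := exists_arr f
  obtain ⟨g, rfl⟩ := exists_arr g
  exact arr_eq (Rel.cVee_nat f g)

theorem cWedge_natural (f : A ⟶ A') (g : B ⟶ B') :
    (f ⋏ₘ g) ≫ arr (.cWedge A' B') = arr (.cWedge A B) ≫ (g ⋏ₘ f) := by
  obtain ⟨f, rfl⟩ := exists_arr f
  obtain ⟨g, rfl⟩ := exists_arr g
  exact arr_eq (Rel.cWedge_nat f g)

theorem ck_natural (f : A ⟶ A') (g : B ⟶ B') (h : C ⟶ C') (k : D ⟶ D') :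
    ((f ⋏ₘ g) ⋎ₘ (h ⋏ₘ k)) ≫ arr (.ck A' B' C' D') =
      arr (.ck A B C D) ≫ ((f ⋎ₘ h) ⋏ₘ (g ⋎ₘ k)) := by
  obtain ⟨f, rfl⟩ := exists_arr f
  obtain ⟨g, rfl⟩ := exists_arr g
  obtain ⟨h, rfl⟩ := exists_arr h
  obtain ⟨k, rfl⟩ := exists_arr k
  exact arr_eq (Rel.ck_nat f g h k)

theorem deltaVeeHom_natural (f : A ⟶ A') :
    (f ⋎ₘ 𝟙 ⊥') ≫ arr (.deltaVeeHom A') = arr (.deltaVeeHom A) ≫ f := by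
  obtain ⟨f, rfl⟩ := exists_arr f
  exact arr_eq (Rel.deltaVee_nat f)

theorem sigmaVeeHom_natural (f : A ⟶ A') :
    (𝟙 ⊥' ⋎ₘ f) ≫ arr (.sigmaVeeHom A') = arr (.sigmaVeeHom A) ≫ f := by
  obtain ⟨f, rfl⟩ := exists_arr f
  exact arr_eq (Rel.sigmaVee_nat f)

theorem deltaWedgeHom_natural (f : A ⟶ A') :
    (f ⋏ₘ 𝟙 ⊤') ≫ arr (.deltaWedgeHom A') = arr (.deltaWedgeHom A) ≫ f := by
  obtain ⟨f, rfl⟩ := exists_arr f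
  exact arr_eq (Rel.deltaWedge_nat f)

theorem sigmaWedgeHom_natural (f : A ⟶ A') :
    (𝟙 ⊤' ⋏ₘ f) ≫ arr (.sigmaWedgeHom A') = arr (.sigmaWedgeHom A) ≫ f := by
  obtain ⟨f, rfl⟩ := exists_arr f
  exact arr_eq (Rel.sigmaWedge_nat f)

theorem deltaVee_hom_inv (A : Formula P) :
    arr (.deltaVeeHom A) ≫ arr (.deltaVeeInv A) = 𝟙 _ := arr_eq (Rel.deltaVee_hom_inv A)

theorem deltaVee_inv_hom (A : Formula P) :
    arr (.deltaVeeInv A) ≫ arr (.deltaVeeHom A) = 𝟙 _ := arr_eq (Rel.deltaVee_inv_hom A)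

theorem sigmaVee_hom_inv (A : Formula P) :
    arr (.sigmaVeeHom A) ≫ arr (.sigmaVeeInv A) = 𝟙 _ := arr_eq (Rel.sigmaVee_hom_inv A)

theorem sigmaVee_inv_hom (A : Formula P) :
    arr (.sigmaVeeInv A) ≫ arr (.sigmaVeeHom A) = 𝟙 _ := arr_eq (Rel.sigmaVee_inv_hom A)

theorem deltaWedge_hom_inv (A : Formula P) :
    arr (.deltaWedgeHom A) ≫ arr (.deltaWedgeInv A) = 𝟙 _ := arr_eq (Rel.deltaWedge_hom_inv A)

theorem deltaWedge_inv_hom (A : Formula P) :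
    arr (.deltaWedgeInv A) ≫ arr (.deltaWedgeHom A) = 𝟙 _ := arr_eq (Rel.deltaWedge_inv_hom A)

theorem sigmaWedge_hom_inv (A : Formula P) :
    arr (.sigmaWedgeHom A) ≫ arr (.sigmaWedgeInv A) = 𝟙 _ := arr_eq (Rel.sigmaWedge_hom_inv A)

theorem sigmaWedge_inv_hom (A : Formula P) :
    arr (.sigmaWedgeInv A) ≫ arr (.sigmaWedgeHom A) = 𝟙 _ := arr_eq (Rel.sigmaWedge_inv_hom A)

theorem deltaWedgeInv_natural (f : A ⟶ A') :
    f ≫ arr (.deltaWedgeInv A') = arr (.deltaWedgeInv A) ≫ (f ⋏ₘ 𝟙 ⊤') := by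
  have := congr_arg (fun k => arr (.deltaWedgeInv A) ≫ k ≫ arr (.deltaWedgeInv A'))
    (deltaWedgeHom_natural f)
  simpa [reassoc_of% deltaWedge_inv_hom, deltaWedge_hom_inv] using this.symm

end Equations

theorem wBot_hom_inv : arr (P := P) .wBotHom ≫ arr .wBotInv = 𝟙 _ := arr_eq Rel.wBot_hom_inv

theorem wBot_inv_hom : arr (P := P) .wBotInv ≫ arr .wBotHom = 𝟙 _ := arr_eq Rel.wBot_inv_hom

theorem wTop_hom_inv : arr (P := P) .wTopHom ≫ arr .wTopInv = 𝟙 _ := arr_eq Rel.wTop_hom_inv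

theorem wTop_inv_hom : arr (P := P) .wTopInv ≫ arr .wTopHom = 𝟙 _ := arr_eq Rel.wTop_inv_hom

/-! The two unit objects and the coherence isomorphisms of symmetric monoidal categories. -/

theorem sigmaVeeHom_bot :
    arr (.sigmaVeeHom (.bot : Formula P)) = arr (.deltaVeeHom .bot) :=
  letI := veeMonoidal (P := P)
  MonoidalCategory.unitors_equal (C := Formula P)

theorem sigmaWedgeHom_top :
    arr (.sigmaWedgeHom (.top : Formula P)) = arr (.deltaWedgeHom .top) :=
  letI := wedgeMonoidal (P := P)
  MonoidalCategory.unitors_equal (C := Formula P)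

theorem cVee_deltaVeeHom (A : Formula P) :
    arr (.cVee .bot A) ≫ arr (.deltaVeeHom A) = arr (.sigmaVeeHom A) :=
  letI := veeMonoidal (P := P)
  letI := veeSymmetric (P := P)
  braiding_rightUnitor A

theorem cVee_sigmaVeeHom (A : Formula P) :
    arr (.cVee A .bot) ≫ arr (.sigmaVeeHom A) = arr (.deltaVeeHom A) :=
  letI := veeMonoidal (P := P)
  letI := veeSymmetric (P := P)
  braiding_leftUnitor A

theorem cWedge_deltaWedgeHom (A : Formula P) :
    arr (.cWedge .top A) ≫ arr (.deltaWedgeHom A) = arr (.sigmaWedgeHom A) :=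
  letI := wedgeMonoidal (P := P)
  letI := wedgeSymmetric (P := P)
  braiding_rightUnitor A

theorem cWedge_sigmaWedgeHom (A : Formula P) :
    arr (.cWedge A .top) ≫ arr (.sigmaWedgeHom A) = arr (.deltaWedgeHom A) :=
  letI := wedgeMonoidal (P := P)
  letI := wedgeSymmetric (P := P)
  braiding_leftUnitor A

/-! ## Invariants of arrow terms -/

/-- No primitive term creates or destroys a letter; only commutativity and intermutation reorder
them. -/
theorem ArrowTerm.letters_perm {A B : Formula P} (f : ArrowTerm A B) :
    A.letters.Perm B.letters := by
  induction f with
  | comp f g hf hg => exact hf.trans hg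
  | veeHom f g hf hg => exact hf.append hg
  | wedgeHom f g hf hg => exact hf.append hg
  | cVee A B => exact List.perm_append_comm
  | cWedge A B => exact List.perm_append_comm
  | ck A B C D =>
    simp only [Formula.letters, List.append_assoc]
    refine List.Perm.append_left _ ?_
    simp only [← List.append_assoc]
    exact List.Perm.append_right _ List.perm_append_comm
  | _ => simp [Formula.letters]

theorem letters_perm {A B : Formula P} (f : A ⟶ B) : A.letters.Perm B.letters := by
  obtain ⟨f, rfl⟩ := exists_arr f
  exact f.letters_perm

namespace Formula

/-- The truth value of a formula under an assignment of truth values to the letters. -/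
def eval (v : P → Bool) : Formula P → Bool
  | letter p => v p
  | bot => false
  | top => true
  | vee A B => A.eval v || B.eval v
  | wedge A B => A.eval v && B.eval v

/-- Some occurrences of `p` and `q` are joined by a conjunction. -/
def Conj (p q : P) : Formula P → Prop
  | letter _ => False
  | bot => False
  | top => False
  | vee A B => A.Conj p q ∨ B.Conj p q
  | wedge A B => A.Conj p q ∨ B.Conj p q ∨ (p ∈ A.letters ∧ q ∈ B.letters) ∨
      (q ∈ A.letters ∧ p ∈ B.letters)

/-- Simultaneous substitution of formulae for letters. -/
def subst (σ : P → Formula P) : Formula P → Formula P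
  | letter p => σ p
  | bot => bot
  | top => top
  | vee A B => vee (A.subst σ) (B.subst σ)
  | wedge A B => wedge (A.subst σ) (B.subst σ)

end Formula

/-- Every primitive term is a valid implication of propositional logic, `κ` being the one from
falsity to truth. -/
theorem eval_le {A B : Formula P} (v : P → Bool) (f : A ⟶ B) : A.eval v → B.eval v := by
  obtain ⟨f, rfl⟩ := exists_arr f
  induction f with
  | one => exact id
  | comp f g hf hg => exact fun h => hg (hf h)
  | _ => simp only [Formula.eval, Bool.or_eq_true, Bool.and_eq_true]; grind

/-- Out of `(A ⋏ B) ⋎ (C ⋏ D)`, intermutation keeps the joins of `A` with `B` and of `C` with `D`,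
and adds those of `A` with `D` and of `B` with `C`. The other primitive terms do not affect joins.
-/
theorem conj_of_conj {A B : Formula P} {p q : P} (f : A ⟶ B) : A.Conj p q → B.Conj p q := by
  obtain ⟨f, rfl⟩ := exists_arr f
  induction f with
  | comp f g hf hg => exact fun h => hg (hf h)
  | veeHom f g hf hg => exact Or.imp hf hg
  | wedgeHom f g hf hg =>
    -- A join across the two conjuncts depends only on which letters they contain, and arrows
    -- preserve that.
    simp only [Formula.Conj, ← f.letters_perm.mem_iff, ← g.letters_perm.mem_iff]
    tauto
  | one => exact id
  | _ => simp only [Formula.Conj, Formula.letters, List.mem_append, List.not_mem_nil]; tauto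

/-! ### Substitution in arrow terms -/

namespace ArrowTerm

/-- Substitution in arrow terms. -/
def subst (σ : P → Formula P) {A B : Formula P} :
    ArrowTerm A B → ArrowTerm (A.subst σ) (B.subst σ)
  | one _ => one _
  | bVeeHom _ _ _ => bVeeHom _ _ _
  | bVeeInv _ _ _ => bVeeInv _ _ _
  | bWedgeHom _ _ _ => bWedgeHom _ _ _
  | bWedgeInv _ _ _ => bWedgeInv _ _ _
  | cVee _ _ => cVee _ _
  | cWedge _ _ => cWedge _ _
  | deltaVeeHom _ => deltaVeeHom _
  | deltaVeeInv _ => deltaVeeInv _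
  | deltaWedgeHom _ => deltaWedgeHom _
  | deltaWedgeInv _ => deltaWedgeInv _
  | sigmaVeeHom _ => sigmaVeeHom _
  | sigmaVeeInv _ => sigmaVeeInv _
  | sigmaWedgeHom _ => sigmaWedgeHom _
  | sigmaWedgeInv _ => sigmaWedgeInv _
  | ck _ _ _ _ => ck _ _ _ _
  | wBotHom => wBotHom
  | wBotInv => wBotInv
  | wTopHom => wTopHom
  | wTopInv => wTopInv
  | kappa => kappa
  | comp f g => comp (f.subst σ) (g.subst σ)
  | veeHom f g => veeHom (f.subst σ) (g.subst σ)
  | wedgeHom f g => wedgeHom (f.subst σ) (g.subst σ)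

end ArrowTerm

/-- The defining equations are schematic in the formulae, so a substitution instance of one is again
one of them. -/
theorem Rel.subst (σ : P → Formula P) {A B : Formula P} {f g : ArrowTerm A B} (h : Rel f g) :
    Rel (f.subst σ) (g.subst σ) := by
  induction h with
  | refl => exact .refl _
  | symm _ h => exact h.symm
  | trans _ _ h h' => exact h.trans h'
  | comp _ _ h h' => exact .comp h h'
  | veeHom _ _ h h' => exact .veeHom h h'
  | wedgeHom _ _ h h' => exact .wedgeHom h h'
  | id_comp => apply Rel.id_comp
  | comp_id => apply Rel.comp_id
  | assoc => apply Rel.assoc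
  | vee_id => apply Rel.vee_id
  | vee_comp => apply Rel.vee_comp
  | wedge_id => apply Rel.wedge_id
  | wedge_comp => apply Rel.wedge_comp
  | bVee_hom_inv => apply Rel.bVee_hom_inv
  | bVee_inv_hom => apply Rel.bVee_inv_hom
  | bVee_nat => apply Rel.bVee_nat
  | cVee_cVee => apply Rel.cVee_cVee
  | cVee_nat => apply Rel.cVee_nat
  | deltaVee_hom_inv => apply Rel.deltaVee_hom_inv
  | deltaVee_inv_hom => apply Rel.deltaVee_inv_hom
  | deltaVee_nat => apply Rel.deltaVee_nat
  | sigmaVee_hom_inv => apply Rel.sigmaVee_hom_inv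
  | sigmaVee_inv_hom => apply Rel.sigmaVee_inv_hom
  | sigmaVee_nat => apply Rel.sigmaVee_nat
  | vee_pentagon => apply Rel.vee_pentagon
  | vee_triangle => apply Rel.vee_triangle
  | vee_hexagon => apply Rel.vee_hexagon
  | bWedge_hom_inv => apply Rel.bWedge_hom_inv
  | bWedge_inv_hom => apply Rel.bWedge_inv_hom
  | bWedge_nat => apply Rel.bWedge_nat
  | cWedge_cWedge => apply Rel.cWedge_cWedge
  | cWedge_nat => apply Rel.cWedge_nat
  | deltaWedge_hom_inv => apply Rel.deltaWedge_hom_inv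
  | deltaWedge_inv_hom => apply Rel.deltaWedge_inv_hom
  | deltaWedge_nat => apply Rel.deltaWedge_nat
  | sigmaWedge_hom_inv => apply Rel.sigmaWedge_hom_inv
  | sigmaWedge_inv_hom => apply Rel.sigmaWedge_inv_hom
  | sigmaWedge_nat => apply Rel.sigmaWedge_nat
  | wedge_pentagon => apply Rel.wedge_pentagon
  | wedge_triangle => apply Rel.wedge_triangle
  | wedge_hexagon => apply Rel.wedge_hexagon
  | wBot_hom_inv => apply Rel.wBot_hom_inv
  | wBot_inv_hom => apply Rel.wBot_inv_hom
  | wTop_hom_inv => apply Rel.wTop_hom_inv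
  | wTop_inv_hom => apply Rel.wTop_inv_hom
  | ck_nat => apply Rel.ck_nat
  | ck_bWedge => apply Rel.ck_bWedge
  | ck_bVee => apply Rel.ck_bVee
  | ck_cWedge => apply Rel.ck_cWedge
  | ck_cVee => apply Rel.ck_cVee
  | ck_bot => apply Rel.ck_bot
  | ck_top => apply Rel.ck_top
  | bVee_top => apply Rel.bVee_top
  | bWedge_bot => apply Rel.bWedge_bot
  | top_vee_kappa => apply Rel.top_vee_kappa
  | bot_wedge_kappa => apply Rel.bot_wedge_kappa
  | ck_kappa => apply Rel.ck_kappa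
  | cVee_top => apply Rel.cVee_top
  | cWedge_bot => apply Rel.cWedge_bot

/-- Substitution in arrows. -/
def substMap (σ : P → Formula P) {A B : Formula P} : (A ⟶ B) → (A.subst σ ⟶ B.subst σ) :=
  Quotient.map (ArrowTerm.subst σ) fun _ _ h => h.subst σ

/-! ### Composition in one argument, and the equations at the units -/

section Equations

variable {A A' A'' B B' B'' : Formula P}

theorem veeMap_comp_left (f : A ⟶ A') (f' : A' ⟶ A'') (g : B ⟶ B') :
    (f ≫ f') ⋎ₘ g = (f ⋎ₘ g) ≫ (f' ⋎ₘ 𝟙 B') := by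
  rw [veeMap_comp, Category.comp_id]

theorem veeMap_comp_right (f : A ⟶ A') (g : B ⟶ B') (g' : B' ⟶ B'') :
    f ⋎ₘ (g ≫ g') = (f ⋎ₘ g) ≫ (𝟙 A' ⋎ₘ g') := by
  rw [veeMap_comp, Category.comp_id]

theorem wedgeMap_comp_left (f : A ⟶ A') (f' : A' ⟶ A'') (g : B ⟶ B') :
    (f ≫ f') ⋏ₘ g = (f ⋏ₘ g) ≫ (f' ⋏ₘ 𝟙 B') := by
  rw [wedgeMap_comp, Category.comp_id]

theorem wedgeMap_comp_right (f : A ⟶ A') (g : B ⟶ B') (g' : B' ⟶ B'') :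
    f ⋏ₘ (g ≫ g') = (f ⋏ₘ g) ≫ (𝟙 A' ⋏ₘ g') := by
  rw [wedgeMap_comp, Category.comp_id]

/-- The primed variants put the other arrow into the second factor, as suits composites that begin
with a structural arrow (`fromBot`, `merge`); the unprimed ones serve `toTop` and `split`. -/
theorem veeMap_comp_left' (f : A ⟶ A') (f' : A' ⟶ A'') (g : B ⟶ B') :
    (f ≫ f') ⋎ₘ g = (f ⋎ₘ 𝟙 B) ≫ (f' ⋎ₘ g) := by
  rw [veeMap_comp, Category.id_comp]

theorem veeMap_comp_right' (f : A ⟶ A') (g : B ⟶ B') (g' : B' ⟶ B'') :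
    f ⋎ₘ (g ≫ g') = (𝟙 A ⋎ₘ g) ≫ (f ⋎ₘ g') := by
  rw [veeMap_comp, Category.id_comp]

theorem wedgeMap_comp_left' (f : A ⟶ A') (f' : A' ⟶ A'') (g : B ⟶ B') :
    (f ≫ f') ⋏ₘ g = (f ⋏ₘ 𝟙 B) ≫ (f' ⋏ₘ g) := by
  rw [wedgeMap_comp, Category.id_comp]

theorem wedgeMap_comp_right' (f : A ⟶ A') (g : B ⟶ B') (g' : B' ⟶ B'') :
    f ⋏ₘ (g ≫ g') = (𝟙 A ⋏ₘ g) ≫ (f ⋏ₘ g') := by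
  rw [wedgeMap_comp, Category.id_comp]

theorem inv_comp_eq_of_comp_eq {f : A ⟶ B} {g : B ⟶ A} {x : A ⟶ A'} {y : B ⟶ A'}
    (e : f ≫ y = x) (h : g ≫ f = 𝟙 B) : g ≫ x = y := by
  rw [← e, reassoc_of% h]

theorem comp_inv_eq_of_comp_eq {f : A ⟶ B} {g : B ⟶ A} {x : A' ⟶ A} {y : A' ⟶ B}
    (e : x ≫ f = y) (h : f ≫ g = 𝟙 A) : y ≫ g = x := by
  rw [← e, Category.assoc, h, Category.comp_id]

theorem bVeeHom_top :
    arr (.bVeeHom ⊤' ⊤' (⊤' : Formula P)) = (𝟙 _ ⋎ₘ arr .wTopHom) ≫ (arr .wTopInv ⋎ₘ 𝟙 _) :=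
  arr_eq Rel.bVee_top

theorem bWedgeHom_bot :
    arr (.bWedgeHom ⊥' ⊥' (⊥' : Formula P)) = (𝟙 _ ⋏ₘ arr .wBotHom) ≫ (arr .wBotInv ⋏ₘ 𝟙 _) :=
  arr_eq Rel.bWedge_bot

theorem cVee_top : arr (.cVee ⊤' (⊤' : Formula P)) = 𝟙 _ :=
  (arr_eq Rel.cVee_top).trans wTop_hom_inv

theorem cWedge_bot : arr (.cWedge ⊥' (⊥' : Formula P)) = 𝟙 _ :=
  (arr_eq Rel.cWedge_bot).trans wBot_hom_inv

theorem bVeeHom_deltaVeeHom (A B : Formula P) :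
    arr (.bVeeHom A ⊥' B) ≫ (arr (.deltaVeeHom A) ⋎ₘ 𝟙 B) = 𝟙 A ⋎ₘ arr (.sigmaVeeHom B) :=
  arr_eq (Rel.vee_triangle A B)

theorem bWedgeHom_deltaWedgeHom (A B : Formula P) :
    arr (.bWedgeHom A ⊤' B) ≫ (arr (.deltaWedgeHom A) ⋏ₘ 𝟙 B) = 𝟙 A ⋏ₘ arr (.sigmaWedgeHom B) :=
  arr_eq (Rel.wedge_triangle A B)

theorem top_vee_kappa :
    𝟙 (⊤' : Formula P) ⋎ₘ arr .kappa = arr (.deltaVeeHom ⊤') ≫ arr .wTopInv :=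
  arr_eq Rel.top_vee_kappa

theorem bot_wedge_kappa :
    𝟙 (⊥' : Formula P) ⋏ₘ arr .kappa = arr .wBotHom ≫ arr (.deltaWedgeInv ⊥') :=
  arr_eq Rel.bot_wedge_kappa

theorem ck_bot (A B : Formula P) :
    arr (.ck A B ⊥' ⊥') = (𝟙 (A ⋏ B) ⋎ₘ arr .wBotHom) ≫ arr (.deltaVeeHom (A ⋏ B)) ≫
      (arr (.deltaVeeInv A) ⋏ₘ arr (.deltaVeeInv B)) :=
  arr_eq (Rel.ck_bot A B)

theorem ck_top (A B : Formula P) :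
    arr (.ck A ⊤' B ⊤') = (arr (.deltaWedgeHom A) ⋎ₘ arr (.deltaWedgeHom B)) ≫
      arr (.deltaWedgeInv (A ⋎ B)) ≫ (𝟙 (A ⋎ B) ⋏ₘ arr .wTopInv) :=
  arr_eq (Rel.ck_top A B)

/-- Apply `κ` first on the right, where `bot_wedge_kappa` evaluates it, and then on the left, where
it passes through the unitor. -/
theorem kappa_wedge_kappa :
    arr (.kappa (P := P)) ⋏ₘ arr .kappa = arr .wBotHom ≫ arr .kappa ≫ arr (.deltaWedgeInv ⊤') := by
  rw [deltaWedgeInv_natural, ← reassoc_of% bot_wedge_kappa, wedgeMap_comp, Category.id_comp,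
    Category.comp_id]

theorem kappa_vee_kappa :
    arr (.kappa (P := P)) ⋎ₘ arr .kappa = arr (.deltaVeeHom ⊥') ≫ arr .kappa ≫ arr .wTopInv := by
  rw [← reassoc_of% deltaVeeHom_natural, ← top_vee_kappa, veeMap_comp, Category.id_comp,
    Category.comp_id]

end Equations

/-! ## Letterless formulae -/

namespace Formula.Letterless

variable {A B : Formula P}

theorem left_of_vee (h : (A ⋎ B).Letterless) : A.Letterless := (List.append_eq_nil_iff.1 h).1

theorem right_of_vee (h : (A ⋎ B).Letterless) : B.Letterless := (List.append_eq_nil_iff.1 h).2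

theorem left_of_wedge (h : (A ⋏ B).Letterless) : A.Letterless := (List.append_eq_nil_iff.1 h).1

theorem right_of_wedge (h : (A ⋏ B).Letterless) : B.Letterless := (List.append_eq_nil_iff.1 h).2

theorem vee (hA : A.Letterless) (hB : B.Letterless) : (A ⋎ B).Letterless :=
  List.append_eq_nil_iff.2 ⟨hA, hB⟩

theorem wedge (hA : A.Letterless) (hB : B.Letterless) : (A ⋏ B).Letterless :=
  List.append_eq_nil_iff.2 ⟨hA, hB⟩

theorem of_hom (h : A.Letterless) (f : A ⟶ B) : B.Letterless :=
  List.nil_perm.1 (h ▸ letters_perm f)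

theorem of_hom' (h : B.Letterless) (f : A ⟶ B) : A.Letterless :=
  List.perm_nil.1 (h ▸ letters_perm f)

end Formula.Letterless

/-- The arrow from a letterless formula to `⊤`. -/
def toTop : ∀ A : Formula P, A.Letterless → (A ⟶ ⊤')
  | .letter _, h => (List.cons_ne_nil _ _ h).elim
  | .bot, _ => arr .kappa
  | .top, _ => 𝟙 _
  | .vee A B, h => (toTop A h.left_of_vee ⋎ₘ toTop B h.right_of_vee) ≫ arr .wTopHom
  | .wedge A B, h =>
    (toTop A h.left_of_wedge ⋏ₘ toTop B h.right_of_wedge) ≫ arr (.deltaWedgeHom ⊤')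

/-- The arrow from `⊥` to a letterless formula. -/
def fromBot : ∀ A : Formula P, A.Letterless → (⊥' ⟶ A)
  | .letter _, h => (List.cons_ne_nil _ _ h).elim
  | .bot, _ => 𝟙 _
  | .top, _ => arr .kappa
  | .vee A B, h =>
    arr (.deltaVeeInv ⊥') ≫ (fromBot A h.left_of_vee ⋎ₘ fromBot B h.right_of_vee)
  | .wedge A B, h => arr .wBotInv ≫ (fromBot A h.left_of_wedge ⋏ₘ fromBot B h.right_of_wedge)

/-- Here and in the lemmas that follow, naturality moves the structural arrow to the units, where an
equation of SMI or monoidal categories evaluates it. -/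
theorem bVeeHom_toTop (A B C : Formula P) (h : (A ⋎ B ⋎ C).Letterless)
    (h' : ((A ⋎ B) ⋎ C).Letterless) :
    arr (.bVeeHom A B C) ≫ toTop _ h' = toTop _ h := by
  simp only [toTop, veeMap_comp_left, veeMap_comp_right, Category.assoc]
  rw [← reassoc_of% bVeeHom_natural, bVeeHom_top]
  simp [reassoc_of% veeMap_comp, wTop_inv_hom, veeMap_id]

theorem cVee_toTop (A B : Formula P) (h : (A ⋎ B).Letterless) (h' : (B ⋎ A).Letterless) :
    arr (.cVee A B) ≫ toTop _ h' = toTop _ h := by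
  simp only [toTop]
  rw [← reassoc_of% cVee_natural, cVee_top, Category.id_comp]

theorem bWedgeHom_toTop (A B C : Formula P) (h : (A ⋏ B ⋏ C).Letterless)
    (h' : ((A ⋏ B) ⋏ C).Letterless) :
    arr (.bWedgeHom A B C) ≫ toTop _ h' = toTop _ h := by
  simp only [toTop, wedgeMap_comp_left, wedgeMap_comp_right, Category.assoc]
  rw [← reassoc_of% bWedgeHom_natural, reassoc_of% bWedgeHom_deltaWedgeHom, sigmaWedgeHom_top]

theorem cWedge_toTop (A B : Formula P) (h : (A ⋏ B).Letterless) (h' : (B ⋏ A).Letterless) :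
    arr (.cWedge A B) ≫ toTop _ h' = toTop _ h := by
  simp only [toTop]
  rw [← reassoc_of% cWedge_natural, cWedge_deltaWedgeHom, sigmaWedgeHom_top]

/-- The disjunct `⊥` contributes `κ`, and `top_vee_kappa` says that `1 ∨ κ` followed by `⊤ ∨ ⊤ ⟶ ⊤`
is the unitor. -/
theorem deltaVeeHom_toTop (A : Formula P) (h : A.Letterless) (h' : (A ⋎ ⊥').Letterless) :
    arr (.deltaVeeHom A) ≫ toTop A h = toTop _ h' := by
  simp only [toTop]
  rw [← Category.id_comp (arr .kappa), ← Category.comp_id (toTop A _), ← veeMap_comp,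
    top_vee_kappa, reassoc_of% deltaVeeHom_natural, Category.assoc, Category.assoc, wTop_inv_hom,
    Category.comp_id]

theorem deltaWedgeHom_toTop (A : Formula P) (h : A.Letterless) (h' : (A ⋏ ⊤').Letterless) :
    arr (.deltaWedgeHom A) ≫ toTop A h = toTop _ h' := by
  simp only [toTop]
  rw [deltaWedgeHom_natural]

theorem ck_toTop (A B C D : Formula P) (h : ((A ⋏ B) ⋎ (C ⋏ D)).Letterless)
    (h' : ((A ⋎ C) ⋏ (B ⋎ D)).Letterless) :
    arr (.ck A B C D) ≫ toTop _ h' = toTop _ h := by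
  simp only [toTop, ← wedgeMap_comp, ← veeMap_comp, Category.assoc]
  rw [← reassoc_of% ck_natural, ck_top]
  simp only [Category.assoc, reassoc_of% wedgeMap_comp, Category.id_comp, wTop_inv_hom,
    deltaWedgeHom_natural, reassoc_of% deltaWedge_inv_hom]

theorem bVeeHom_fromBot (A B C : Formula P) (h : (A ⋎ B ⋎ C).Letterless)
    (h' : ((A ⋎ B) ⋎ C).Letterless) :
    fromBot _ h ≫ arr (.bVeeHom A B C) = fromBot _ h' := by
  -- This is the triangle at `⊥`, where the left and right unitors coincide.
  have e : (𝟙 _ ⋎ₘ arr (.deltaVeeInv ⊥')) ≫ arr (.bVeeHom ⊥' ⊥' (⊥' : Formula P)) =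
      arr (.deltaVeeInv ⊥') ⋎ₘ 𝟙 _ := by
    have := congr_arg (fun k => (𝟙 _ ⋎ₘ arr (.deltaVeeInv ⊥')) ≫ k ≫ (arr (.deltaVeeInv ⊥') ⋎ₘ 𝟙 _))
      (bVeeHom_deltaVeeHom ⊥' (⊥' : Formula P))
    simpa [veeMap_comp, reassoc_of% veeMap_comp, deltaVee_hom_inv, deltaVee_inv_hom, veeMap_id,
      sigmaVeeHom_bot] using this
  simp only [fromBot, veeMap_comp_left', veeMap_comp_right', Category.assoc]
  rw [bVeeHom_natural, reassoc_of% e]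

theorem cVee_fromBot (A B : Formula P) (h : (A ⋎ B).Letterless) (h' : (B ⋎ A).Letterless) :
    fromBot _ h ≫ arr (.cVee A B) = fromBot _ h' := by
  have e : arr (.deltaVeeInv ⊥') ≫ arr (.cVee ⊥' (⊥' : Formula P)) = arr (.deltaVeeInv ⊥') := by
    have := congr_arg (fun k => arr (.deltaVeeInv ⊥') ≫ k ≫ arr (.deltaVeeInv ⊥'))
      (cVee_deltaVeeHom (⊥' : Formula P))
    simpa [deltaVee_hom_inv, deltaVee_inv_hom, sigmaVeeHom_bot] using this
  simp only [fromBot, Category.assoc]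
  rw [cVee_natural, reassoc_of% e]

theorem bWedgeHom_fromBot (A B C : Formula P) (h : (A ⋏ B ⋏ C).Letterless)
    (h' : ((A ⋏ B) ⋏ C).Letterless) :
    fromBot _ h ≫ arr (.bWedgeHom A B C) = fromBot _ h' := by
  have e : (𝟙 _ ⋏ₘ arr .wBotInv) ≫ arr (.bWedgeHom ⊥' ⊥' (⊥' : Formula P)) =
      arr .wBotInv ⋏ₘ 𝟙 _ := by
    rw [bWedgeHom_bot, reassoc_of% wedgeMap_comp]
    simp [wBot_inv_hom, wedgeMap_id]
  simp only [fromBot, wedgeMap_comp_left', wedgeMap_comp_right', Category.assoc]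
  rw [bWedgeHom_natural, reassoc_of% e]

theorem cWedge_fromBot (A B : Formula P) (h : (A ⋏ B).Letterless) (h' : (B ⋏ A).Letterless) :
    fromBot _ h ≫ arr (.cWedge A B) = fromBot _ h' := by
  simp only [fromBot, Category.assoc]
  rw [cWedge_natural, cWedge_bot, Category.id_comp]

theorem deltaVeeHom_fromBot (A : Formula P) (h : A.Letterless) (h' : (A ⋎ ⊥').Letterless) :
    fromBot _ h' ≫ arr (.deltaVeeHom A) = fromBot A h := by
  simp only [fromBot, Category.assoc]
  rw [deltaVeeHom_natural, reassoc_of% deltaVee_inv_hom]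

theorem deltaWedgeHom_fromBot (A : Formula P) (h : A.Letterless) (h' : (A ⋏ ⊤').Letterless) :
    fromBot _ h' ≫ arr (.deltaWedgeHom A) = fromBot A h := by
  simp only [fromBot, Category.assoc]
  rw [← Category.id_comp (fromBot A _), ← Category.comp_id (arr .kappa), ← wedgeMap_comp,
    bot_wedge_kappa, Category.assoc, deltaWedgeHom_natural, Category.assoc,
    reassoc_of% deltaWedge_inv_hom, reassoc_of% wBot_inv_hom, Category.id_comp]

theorem ck_fromBot (A B C D : Formula P) (h : ((A ⋏ B) ⋎ (C ⋏ D)).Letterless)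
    (h' : ((A ⋎ C) ⋏ (B ⋎ D)).Letterless) :
    fromBot _ h ≫ arr (.ck A B C D) = fromBot _ h' := by
  simp only [fromBot, ← wedgeMap_comp, ← veeMap_comp, Category.assoc]
  rw [ck_natural, ck_bot]
  simp only [Category.assoc]
  rw [reassoc_of% veeMap_comp, wBot_inv_hom, Category.comp_id, reassoc_of% deltaVeeHom_natural,
    reassoc_of% deltaVee_inv_hom]

/-- For `B = ⊤`, where `toTop` is the identity, this makes `⊤` terminal among letterless formulae.
In a composite the middle formula is letterless because arrows preserve letters; inverses are
cancelled, and `σ` reduces to `δ` through commutativity. -/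
theorem comp_toTop {A B : Formula P} (f : A ⟶ B) (hA : A.Letterless) (hB : B.Letterless) :
    f ≫ toTop B hB = toTop A hA := by
  obtain ⟨f, rfl⟩ := exists_arr f
  induction f with
  | one => exact Category.id_comp _
  | comp f g hf hg =>
    rw [arr_comp, Category.assoc, hg (hA.of_hom (arr f)) hB, hf]
  | veeHom f g hf hg =>
    rw [arr_veeHom, toTop, toTop, ← hf hA.left_of_vee hB.left_of_vee,
      ← hg hA.right_of_vee hB.right_of_vee, reassoc_of% veeMap_comp]
  | wedgeHom f g hf hg =>
    rw [arr_wedgeHom, toTop, toTop, ← hf hA.left_of_wedge hB.left_of_wedge,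
      ← hg hA.right_of_wedge hB.right_of_wedge, reassoc_of% wedgeMap_comp]
  | bVeeHom A B C => exact bVeeHom_toTop A B C hA hB
  | bVeeInv A B C =>
    exact inv_comp_eq_of_comp_eq (bVeeHom_toTop A B C hB hA) (bVee_inv_hom A B C)
  | bWedgeHom A B C => exact bWedgeHom_toTop A B C hA hB
  | bWedgeInv A B C =>
    exact inv_comp_eq_of_comp_eq (bWedgeHom_toTop A B C hB hA)
      (bWedge_inv_hom A B C)
  | cVee A B => exact cVee_toTop A B hA hB
  | cWedge A B => exact cWedge_toTop A B hA hB
  | deltaVeeHom A => exact deltaVeeHom_toTop A hB hA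
  | deltaVeeInv A =>
    exact inv_comp_eq_of_comp_eq (deltaVeeHom_toTop A hA hB) (deltaVee_inv_hom A)
  | deltaWedgeHom A => exact deltaWedgeHom_toTop A hB hA
  | deltaWedgeInv A =>
    exact inv_comp_eq_of_comp_eq (deltaWedgeHom_toTop A hA hB)
      (deltaWedge_inv_hom A)
  | sigmaVeeHom A =>
    rw [← cVee_deltaVeeHom, Category.assoc, deltaVeeHom_toTop A hB (hB.vee rfl), cVee_toTop]
  | sigmaVeeInv A =>
    refine inv_comp_eq_of_comp_eq ?_ (sigmaVee_inv_hom A)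
    rw [← cVee_deltaVeeHom, Category.assoc, deltaVeeHom_toTop A hA (hA.vee rfl), cVee_toTop]
  | sigmaWedgeHom A =>
    rw [← cWedge_deltaWedgeHom, Category.assoc, deltaWedgeHom_toTop A hB (hB.wedge rfl),
      cWedge_toTop]
  | sigmaWedgeInv A =>
    refine inv_comp_eq_of_comp_eq ?_ (sigmaWedge_inv_hom A)
    rw [← cWedge_deltaWedgeHom, Category.assoc, deltaWedgeHom_toTop A hA (hA.wedge rfl),
      cWedge_toTop]
  | ck A B C D => exact ck_toTop A B C D hA hB
  | wBotHom =>
    simp only [toTop]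
    rw [kappa_wedge_kappa, Category.assoc, Category.assoc, deltaWedge_inv_hom, Category.comp_id]
  | wBotInv =>
    simp only [toTop]
    rw [kappa_wedge_kappa, Category.assoc, Category.assoc, deltaWedge_inv_hom, Category.comp_id,
      reassoc_of% wBot_inv_hom]
  | wTopHom => simp [toTop, veeMap_id]
  | wTopInv => simp [toTop, veeMap_id, wTop_inv_hom]
  | kappa => simp [toTop]

/-- For `A = ⊥` this makes `⊥` initial among letterless formulae. -/
theorem fromBot_comp {A B : Formula P} (f : A ⟶ B) (hA : A.Letterless) (hB : B.Letterless) :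
    fromBot A hA ≫ f = fromBot B hB := by
  obtain ⟨f, rfl⟩ := exists_arr f
  induction f with
  | one => exact Category.comp_id _
  | comp f g hf hg =>
    rw [arr_comp, ← Category.assoc, hf hA (hA.of_hom (arr f)), hg]
  | veeHom f g hf hg =>
    rw [arr_veeHom, fromBot, fromBot, ← hf hA.left_of_vee hB.left_of_vee,
      ← hg hA.right_of_vee hB.right_of_vee, Category.assoc, veeMap_comp]
  | wedgeHom f g hf hg =>
    rw [arr_wedgeHom, fromBot, fromBot, ← hf hA.left_of_wedge hB.left_of_wedge,
      ← hg hA.right_of_wedge hB.right_of_wedge, Category.assoc, wedgeMap_comp]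
  | bVeeHom A B C => exact bVeeHom_fromBot A B C hA hB
  | bVeeInv A B C => exact comp_inv_eq_of_comp_eq (bVeeHom_fromBot A B C hB hA) (bVee_hom_inv A B C)
  | bWedgeHom A B C => exact bWedgeHom_fromBot A B C hA hB
  | bWedgeInv A B C => exact comp_inv_eq_of_comp_eq (bWedgeHom_fromBot A B C hB hA) (bWedge_hom_inv A B C)
  | cVee A B => exact cVee_fromBot A B hA hB
  | cWedge A B => exact cWedge_fromBot A B hA hB
  | deltaVeeHom A => exact deltaVeeHom_fromBot A hB hA
  | deltaVeeInv A => exact comp_inv_eq_of_comp_eq (deltaVeeHom_fromBot A hA hB) (deltaVee_hom_inv A)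
  | deltaWedgeHom A => exact deltaWedgeHom_fromBot A hB hA
  | deltaWedgeInv A => exact comp_inv_eq_of_comp_eq (deltaWedgeHom_fromBot A hA hB) (deltaWedge_hom_inv A)
  | sigmaVeeHom A =>
    rw [← cVee_deltaVeeHom, ← Category.assoc, cVee_fromBot _ _ _ (hB.vee (B := ⊥') rfl),
      deltaVeeHom_fromBot]
  | sigmaVeeInv A =>
    refine comp_inv_eq_of_comp_eq ?_ (sigmaVee_hom_inv A)
    rw [← cVee_deltaVeeHom, ← Category.assoc, cVee_fromBot _ _ hB (hA.vee rfl),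
      deltaVeeHom_fromBot]
  | sigmaWedgeHom A =>
    rw [← cWedge_deltaWedgeHom, ← Category.assoc, cWedge_fromBot _ _ _ (hB.wedge (B := ⊤') rfl),
      deltaWedgeHom_fromBot]
  | sigmaWedgeInv A =>
    refine comp_inv_eq_of_comp_eq ?_ (sigmaWedge_hom_inv A)
    rw [← cWedge_deltaWedgeHom, ← Category.assoc, cWedge_fromBot _ _ hB (hA.wedge rfl),
      deltaWedgeHom_fromBot]
  | ck A B C D => exact ck_fromBot A B C D hA hB
  | wBotHom => simp [fromBot, wedgeMap_id, wBot_inv_hom]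
  | wBotInv => simp [fromBot, wedgeMap_id]
  | wTopHom =>
    simp only [fromBot]
    rw [kappa_vee_kappa, reassoc_of% deltaVee_inv_hom, Category.assoc, wTop_inv_hom,
      Category.comp_id]
  | wTopInv =>
    simp only [fromBot]
    rw [kappa_vee_kappa, reassoc_of% deltaVee_inv_hom]
  | kappa => simp [fromBot]

/-! ### Invertible arrows, and how truth values detect them -/

section IsIso

variable {A A' B B' : Formula P}

instance isIso_veeMap (f : A ⟶ A') (g : B ⟶ B') [IsIso f] [IsIso g] : IsIso (f ⋎ₘ g) :=
  ⟨inv f ⋎ₘ inv g, by rw [veeMap_comp, IsIso.hom_inv_id, IsIso.hom_inv_id, veeMap_id],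
    by rw [veeMap_comp, IsIso.inv_hom_id, IsIso.inv_hom_id, veeMap_id]⟩

instance isIso_wedgeMap (f : A ⟶ A') (g : B ⟶ B') [IsIso f] [IsIso g] : IsIso (f ⋏ₘ g) :=
  ⟨inv f ⋏ₘ inv g, by rw [wedgeMap_comp, IsIso.hom_inv_id, IsIso.hom_inv_id, wedgeMap_id],
    by rw [wedgeMap_comp, IsIso.inv_hom_id, IsIso.inv_hom_id, wedgeMap_id]⟩

instance isIso_deltaVeeHom (A : Formula P) : IsIso (arr (.deltaVeeHom A)) :=
  ⟨_, deltaVee_hom_inv A, deltaVee_inv_hom A⟩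

instance isIso_deltaVeeInv (A : Formula P) : IsIso (arr (.deltaVeeInv A)) :=
  ⟨_, deltaVee_inv_hom A, deltaVee_hom_inv A⟩

instance isIso_sigmaVeeHom (A : Formula P) : IsIso (arr (.sigmaVeeHom A)) :=
  ⟨_, sigmaVee_hom_inv A, sigmaVee_inv_hom A⟩

instance isIso_deltaWedgeHom (A : Formula P) : IsIso (arr (.deltaWedgeHom A)) :=
  ⟨_, deltaWedge_hom_inv A, deltaWedge_inv_hom A⟩

instance isIso_deltaWedgeInv (A : Formula P) : IsIso (arr (.deltaWedgeInv A)) :=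
  ⟨_, deltaWedge_inv_hom A, deltaWedge_hom_inv A⟩

instance isIso_sigmaWedgeInv (A : Formula P) : IsIso (arr (.sigmaWedgeInv A)) :=
  ⟨_, sigmaWedge_inv_hom A, sigmaWedge_hom_inv A⟩

instance isIso_sigmaWedgeHom (A : Formula P) : IsIso (arr (.sigmaWedgeHom A)) :=
  ⟨_, sigmaWedge_hom_inv A, sigmaWedge_inv_hom A⟩

instance isIso_wBotHom : IsIso (arr (P := P) .wBotHom) := ⟨_, wBot_hom_inv, wBot_inv_hom⟩

instance isIso_wBotInv : IsIso (arr (P := P) .wBotInv) := ⟨_, wBot_inv_hom, wBot_hom_inv⟩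

instance isIso_wTopHom : IsIso (arr (P := P) .wTopHom) := ⟨_, wTop_hom_inv, wTop_inv_hom⟩

instance isIso_wTopInv : IsIso (arr (P := P) .wTopInv) := ⟨_, wTop_inv_hom, wTop_hom_inv⟩

instance isIso_cVee (A B : Formula P) : IsIso (arr (.cVee A B)) :=
  ⟨_, cVee_cVee A B, cVee_cVee B A⟩

instance isIso_cWedge (A B : Formula P) : IsIso (arr (.cWedge A B)) :=
  ⟨_, cWedge_cWedge A B, cWedge_cWedge B A⟩

end IsIso

/-- The case of a true `A` and a false `B`: up to `B ≅ ⊥` the arrow on `B` is `κ`, and `1 ∨ κ` at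
`⊤` is invertible. -/
theorem isIso_toTop_vee {A B : Formula P} (h : (A ⋎ B).Letterless)
    (hA : IsIso (toTop A h.left_of_vee)) (hB : IsIso (fromBot B h.right_of_vee)) :
    IsIso (toTop _ h) := by
  have e : toTop B h.right_of_vee = inv (fromBot B h.right_of_vee) ≫ arr .kappa := by
    rw [IsIso.eq_inv_comp]
    exact comp_toTop (A := ⊥') _ rfl _
  rw [toTop, e, veeMap_comp_right, top_vee_kappa, Category.assoc, Category.assoc, wTop_inv_hom]
  infer_instance

theorem isIso_fromBot_wedge {A B : Formula P} (h : (A ⋏ B).Letterless)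
    (hA : IsIso (fromBot A h.left_of_wedge)) (hB : IsIso (toTop B h.right_of_wedge)) :
    IsIso (fromBot _ h) := by
  have e : fromBot B h.right_of_wedge = arr .kappa ≫ inv (toTop B h.right_of_wedge) := by
    rw [IsIso.eq_comp_inv]
    exact fromBot_comp (B := ⊤') _ _ rfl
  rw [fromBot, e, wedgeMap_comp_right', bot_wedge_kappa, Category.assoc,
    reassoc_of% wBot_inv_hom]
  infer_instance

/-- A formula whose components have the same truth value is handled by functoriality and the
isomorphisms at the units. Mixed values need `isIso_toTop_vee` and `isIso_fromBot_wedge`. -/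
theorem isIso_toTop_and_isIso_fromBot (v : P → Bool) (A : Formula P) (h : A.Letterless) :
    (A.eval v = true → IsIso (toTop A h)) ∧ (A.eval v = false → IsIso (fromBot A h)) := by
  induction A with
  | letter p => exact (List.cons_ne_nil _ _ h).elim
  | bot => exact ⟨fun e => Bool.noConfusion e, fun _ => inferInstanceAs (IsIso (𝟙 _))⟩
  | top => exact ⟨fun _ => inferInstanceAs (IsIso (𝟙 _)), fun e => Bool.noConfusion e⟩
  | vee A B ihA ihB =>
    obtain ⟨hA, hA'⟩ := ihA h.left_of_vee
    obtain ⟨hB, hB'⟩ := ihB h.right_of_vee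
    rcases eA : A.eval v <;> rcases eB : B.eval v <;>
      simp only [Formula.eval, eA, eB, Bool.or_self, Bool.or_true, Bool.or_false, forall_const,
        reduceCtorEq, false_implies, true_and, and_true]
    · have := hA' eA
      have := hB' eB
      rw [fromBot]
      infer_instance
    · have := isIso_toTop_vee (h.right_of_vee.vee h.left_of_vee) (hB eB) (hA' eA)
      -- `toTop` absorbs the invertible commutativity, so the disjuncts may be swapped.
      rw [← comp_toTop (arr (.cVee A B)) h (h.right_of_vee.vee h.left_of_vee)]
      infer_instance
    · exact isIso_toTop_vee h (hA eA) (hB' eB)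
    · have := hA eA
      have := hB eB
      rw [toTop]
      infer_instance
  | wedge A B ihA ihB =>
    obtain ⟨hA, hA'⟩ := ihA h.left_of_wedge
    obtain ⟨hB, hB'⟩ := ihB h.right_of_wedge
    rcases eA : A.eval v <;> rcases eB : B.eval v <;>
      simp only [Formula.eval, eA, eB, Bool.and_self, Bool.and_true, Bool.and_false, forall_const,
        reduceCtorEq, false_implies, true_and, and_true]
    · have := hA' eA
      have := hB' eB
      rw [fromBot]
      infer_instance
    · exact isIso_fromBot_wedge h (hA' eA) (hB eB)
    · have := isIso_fromBot_wedge (h.right_of_wedge.wedge h.left_of_wedge) (hB' eB) (hA eA)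
      rw [← fromBot_comp (arr (.cWedge B A)) (h.right_of_wedge.wedge h.left_of_wedge) h]
      infer_instance
    · have := hA eA
      have := hB eB
      rw [toTop]
      infer_instance

theorem isIso_toTop {A : Formula P} (h : A.Letterless) {v : P → Bool} (e : A.eval v = true) :
    IsIso (toTop A h) :=
  (isIso_toTop_and_isIso_fromBot v A h).1 e

theorem isIso_fromBot {A : Formula P} (h : A.Letterless) {v : P → Bool} (e : A.eval v = false) :
    IsIso (fromBot A h) :=
  (isIso_toTop_and_isIso_fromBot v A h).2 e

/-- Coherence for letterless formulae. -/
theorem Formula.Letterless.hom_ext {A B : Formula P} (hA : A.Letterless) (hB : B.Letterless)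
    (f g : A ⟶ B) : f = g := by
  -- Any valuation serves, as there are no letters. If `A` is false then `A ≅ ⊥` is initial; if `A`
  -- is true then so is `B`, and `B ≅ ⊤` is terminal.
  rcases eA : A.eval fun _ => false with _ | _
  · have := isIso_fromBot hA eA
    rw [← cancel_epi (fromBot A hA), fromBot_comp _ _ hB, fromBot_comp _ _ hB]
  · have := isIso_toTop hB (eval_le _ f eA)
    rw [← cancel_mono (toTop B hB), comp_toTop _ hA, comp_toTop _ hA]

theorem nonempty_hom_bot {A : Formula P} (h : A.Letterless) {v : P → Bool}
    (e : A.eval v = false) : Nonempty (A ⟶ ⊥') := by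
  have := isIso_fromBot h e
  exact ⟨inv (fromBot A h)⟩

theorem eval_eq_false {A : Formula P} (f : A ⟶ ⊥') (v : P → Bool) : A.eval v = false := by
  by_contra h
  exact Bool.noConfusion (eval_le v f (by simpa using h))

/-! ## Formulae with a single letter -/

section Unitors

variable (A B : Formula P)

theorem bVeeHom_sigmaVeeHom :
    arr (.bVeeHom ⊥' A B) ≫ (arr (.sigmaVeeHom A) ⋎ₘ 𝟙 B) = arr (.sigmaVeeHom (A ⋎ B)) :=
  letI := veeMonoidal (P := P)
  (MonoidalCategory.leftUnitor_tensor_hom A B).symm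

theorem bWedgeHom_sigmaWedgeHom :
    arr (.bWedgeHom ⊤' A B) ≫ (arr (.sigmaWedgeHom A) ⋏ₘ 𝟙 B) = arr (.sigmaWedgeHom (A ⋏ B)) :=
  letI := wedgeMonoidal (P := P)
  (MonoidalCategory.leftUnitor_tensor_hom A B).symm

end Unitors

section Vee

variable {A B C D : Formula P}

/-- This lemma and the next two treat the three positions of the surviving disjunct: deleting the
other two does not depend on the bracketing. -/
theorem bVeeHom_contract_left (c : A ⟶ D) (j : B ⟶ ⊥') (k : C ⟶ ⊥') :
    arr (.bVeeHom A B C) ≫ ((((c ⋎ₘ j) ≫ arr (.deltaVeeHom D)) ⋎ₘ k) ≫ arr (.deltaVeeHom D)) =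
      (c ⋎ₘ ((j ⋎ₘ k) ≫ arr (.deltaVeeHom ⊥'))) ≫ arr (.deltaVeeHom D) := by
  simp only [veeMap_comp_left, veeMap_comp_right, Category.assoc]
  rw [← reassoc_of% bVeeHom_natural, reassoc_of% bVeeHom_deltaVeeHom, sigmaVeeHom_bot]

theorem bVeeHom_contract_middle (j : A ⟶ ⊥') (c : B ⟶ D) (k : C ⟶ ⊥') :
    arr (.bVeeHom A B C) ≫ ((((j ⋎ₘ c) ≫ arr (.sigmaVeeHom D)) ⋎ₘ k) ≫ arr (.deltaVeeHom D)) =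
      (j ⋎ₘ ((c ⋎ₘ k) ≫ arr (.deltaVeeHom D))) ≫ arr (.sigmaVeeHom D) := by
  simp only [veeMap_comp_left, veeMap_comp_right, Category.assoc]
  rw [← reassoc_of% bVeeHom_natural, reassoc_of% bVeeHom_sigmaVeeHom, sigmaVeeHom_natural]

theorem bVeeHom_contract_right (j : A ⟶ ⊥') (k : B ⟶ ⊥') (c : C ⟶ D) :
    arr (.bVeeHom A B C) ≫ ((((j ⋎ₘ k) ≫ arr (.deltaVeeHom ⊥')) ⋎ₘ c) ≫ arr (.sigmaVeeHom D)) =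
      (j ⋎ₘ ((k ⋎ₘ c) ≫ arr (.sigmaVeeHom D))) ≫ arr (.sigmaVeeHom D) := by
  simp only [veeMap_comp_left, veeMap_comp_right, Category.assoc]
  rw [← reassoc_of% bVeeHom_natural, reassoc_of% bVeeHom_deltaVeeHom]

end Vee

section Wedge

variable {A B C D : Formula P}

theorem bWedgeHom_contract_left (c : A ⟶ D) (j : B ⟶ ⊤') (k : C ⟶ ⊤') :
    arr (.bWedgeHom A B C) ≫ ((((c ⋏ₘ j) ≫ arr (.deltaWedgeHom D)) ⋏ₘ k) ≫ arr (.deltaWedgeHom D)) =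
      (c ⋏ₘ ((j ⋏ₘ k) ≫ arr (.deltaWedgeHom ⊤'))) ≫ arr (.deltaWedgeHom D) := by
  simp only [wedgeMap_comp_left, wedgeMap_comp_right, Category.assoc]
  rw [← reassoc_of% bWedgeHom_natural, reassoc_of% bWedgeHom_deltaWedgeHom, sigmaWedgeHom_top]

theorem bWedgeHom_contract_middle (j : A ⟶ ⊤') (c : B ⟶ D) (k : C ⟶ ⊤') :
    arr (.bWedgeHom A B C) ≫ ((((j ⋏ₘ c) ≫ arr (.sigmaWedgeHom D)) ⋏ₘ k) ≫ arr (.deltaWedgeHom D)) =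
      (j ⋏ₘ ((c ⋏ₘ k) ≫ arr (.deltaWedgeHom D))) ≫ arr (.sigmaWedgeHom D) := by
  simp only [wedgeMap_comp_left, wedgeMap_comp_right, Category.assoc]
  rw [← reassoc_of% bWedgeHom_natural, reassoc_of% bWedgeHom_sigmaWedgeHom, sigmaWedgeHom_natural]

theorem bWedgeHom_contract_right (j : A ⟶ ⊤') (k : B ⟶ ⊤') (c : C ⟶ D) :
    arr (.bWedgeHom A B C) ≫ ((((j ⋏ₘ k) ≫ arr (.deltaWedgeHom ⊤')) ⋏ₘ c) ≫ arr (.sigmaWedgeHom D)) =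
      (j ⋏ₘ ((k ⋏ₘ c) ≫ arr (.sigmaWedgeHom D))) ≫ arr (.sigmaWedgeHom D) := by
  simp only [wedgeMap_comp_left, wedgeMap_comp_right, Category.assoc]
  rw [← reassoc_of% bWedgeHom_natural, reassoc_of% bWedgeHom_deltaWedgeHom]

end Wedge

/-- The arrows to the letter `p` that delete disjuncts with an arrow to `⊥` and conjuncts with an
arrow to `⊤`. -/
inductive Contracts (p : P) : ∀ X : Formula P, (X ⟶ .letter p) → Prop
  | letter : Contracts p (.letter p) (𝟙 _)
  | vee_left {X Y : Formula P} {c : X ⟶ .letter p} (h : Contracts p X c) (j : Y ⟶ ⊥') :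
      Contracts p (X ⋎ Y) ((c ⋎ₘ j) ≫ arr (.deltaVeeHom _))
  | vee_right {X Y : Formula P} {c : X ⟶ .letter p} (h : Contracts p X c) (j : Y ⟶ ⊥') :
      Contracts p (Y ⋎ X) ((j ⋎ₘ c) ≫ arr (.sigmaVeeHom _))
  | wedge_left {X Y : Formula P} {c : X ⟶ .letter p} (h : Contracts p X c) (j : Y ⟶ ⊤') :
      Contracts p (X ⋏ Y) ((c ⋏ₘ j) ≫ arr (.deltaWedgeHom _))
  | wedge_right {X Y : Formula P} {c : X ⟶ .letter p} (h : Contracts p X c) (j : Y ⟶ ⊤') :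
      Contracts p (Y ⋏ X) ((j ⋏ₘ c) ≫ arr (.sigmaWedgeHom _))

theorem not_letterless {p : P} {A : Formula P} (c : A ⟶ .letter p) : ¬ A.Letterless :=
  fun h => List.cons_ne_nil p [] (h.of_hom c)

/-- Precomposition with `f` preserves contractions. -/
def Pulls (p : P) {A B : Formula P} (f : A ⟶ B) : Prop :=
  ∀ c, Contracts p B c → Contracts p A (f ≫ c)

theorem letterless_bot : (⊥' : Formula P).Letterless := rfl

theorem letterless_top : (⊤' : Formula P).Letterless := rfl

theorem Contracts.of_eq {p : P} {A : Formula P} {c c' : A ⟶ .letter p} (h : Contracts p A c)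
    (e : c' = c) : Contracts p A c' := e ▸ h

/-- Both disjuncts are letterless and false, so each has an arrow to `⊥`, and letterless coherence
gives the equation. Thus a deleted disjunction can be deleted one disjunct at a time. -/
theorem exists_eq_veeMap {A B : Formula P} (j : A ⋎ B ⟶ ⊥') :
    ∃ (k : A ⟶ ⊥') (l : B ⟶ ⊥'), j = (k ⋎ₘ l) ≫ arr (.deltaVeeHom ⊥') := by
  have h := letterless_bot.of_hom' j
  have e := Bool.or_eq_false_iff.1 (eval_eq_false j fun _ => false)
  obtain ⟨k⟩ := nonempty_hom_bot h.left_of_vee e.1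
  obtain ⟨l⟩ := nonempty_hom_bot h.right_of_vee e.2
  exact ⟨k, l, h.hom_ext letterless_bot _ _⟩

theorem exists_eq_wedgeMap {A B : Formula P} (j : A ⋏ B ⟶ ⊤') :
    ∃ (k : A ⟶ ⊤') (l : B ⟶ ⊤'), j = (k ⋏ₘ l) ≫ arr (.deltaWedgeHom ⊤') := by
  have h := letterless_top.of_hom' j
  exact ⟨toTop A h.left_of_wedge, toTop B h.right_of_wedge, h.hom_ext letterless_top _ _⟩

section Pulls

variable {p : P} {A A' B B' : Formula P}

theorem Pulls.comp {C : Formula P} {f : A ⟶ B} {g : B ⟶ C} (hf : Pulls p f) (hg : Pulls p g) :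
    Pulls p (f ≫ g) := fun c hc => by
  rw [Category.assoc]
  exact hf _ (hg c hc)

/-- Vacuous, since a letterless formula has no arrow to a letter. -/
theorem pulls_of_target_letterless (f : A ⟶ B) (h : B.Letterless) : Pulls p f :=
  fun c _ => (not_letterless c h).elim

theorem Pulls.veeMap {f : A ⟶ A'} {g : B ⟶ B'} (hf : Pulls p f) (hg : Pulls p g) :
    Pulls p (f ⋎ₘ g) := fun c hc => by
  cases hc with
  | vee_left h j =>
    refine (Contracts.vee_left (hf _ h) (g ≫ j)).of_eq ?_
    rw [reassoc_of% veeMap_comp]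
  | vee_right h j =>
    refine (Contracts.vee_right (hg _ h) (f ≫ j)).of_eq ?_
    rw [reassoc_of% veeMap_comp]

theorem Pulls.wedgeMap {f : A ⟶ A'} {g : B ⟶ B'} (hf : Pulls p f) (hg : Pulls p g) :
    Pulls p (f ⋏ₘ g) := fun c hc => by
  cases hc with
  | wedge_left h j =>
    refine (Contracts.wedge_left (hf _ h) (g ≫ j)).of_eq ?_
    rw [reassoc_of% wedgeMap_comp]
  | wedge_right h j =>
    refine (Contracts.wedge_right (hg _ h) (f ≫ j)).of_eq ?_
    rw [reassoc_of% wedgeMap_comp]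

theorem pulls_cVee (A B : Formula P) : Pulls p (arr (.cVee A B)) := fun c hc => by
  cases hc with
  | vee_left h j =>
    refine (Contracts.vee_right h j).of_eq ?_
    rw [← reassoc_of% cVee_natural, cVee_deltaVeeHom]
  | vee_right h j =>
    refine (Contracts.vee_left h j).of_eq ?_
    rw [← reassoc_of% cVee_natural, cVee_sigmaVeeHom]

theorem pulls_bVeeHom (A B C : Formula P) : Pulls p (arr (.bVeeHom A B C)) := fun c hc => by
  cases hc with
  | vee_left h k =>
    cases h with
    | vee_left h j => exact (Contracts.vee_left h _).of_eq (bVeeHom_contract_left _ j k)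
    | vee_right h j =>
      exact (Contracts.vee_right (.vee_left h _) _).of_eq (bVeeHom_contract_middle j _ k)
  | vee_right h j =>
    obtain ⟨j, k, rfl⟩ := exists_eq_veeMap j
    exact (Contracts.vee_right (.vee_right h _) _).of_eq (bVeeHom_contract_right j k _)

theorem pulls_bVeeInv (A B C : Formula P) : Pulls p (arr (.bVeeInv A B C)) := fun c hc => by
  cases hc with
  | vee_left h j =>
    obtain ⟨j, k, rfl⟩ := exists_eq_veeMap j
    exact (Contracts.vee_left (.vee_left h _) _).of_eq
      (inv_comp_eq_of_comp_eq (bVeeHom_contract_left _ j k) (bVee_inv_hom A B C))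
  | vee_right h j =>
    cases h with
    | vee_left h k =>
      exact (Contracts.vee_left (.vee_right h _) _).of_eq
        (inv_comp_eq_of_comp_eq (bVeeHom_contract_middle j _ k) (bVee_inv_hom A B C))
    | vee_right h k =>
      exact (Contracts.vee_right h _).of_eq
        (inv_comp_eq_of_comp_eq (bVeeHom_contract_right j k _) (bVee_inv_hom A B C))

theorem pulls_deltaVeeHom (A : Formula P) : Pulls p (arr (.deltaVeeHom A)) := fun c hc =>
  (Contracts.vee_left hc (𝟙 _)).of_eq (deltaVeeHom_natural c).symm

theorem pulls_sigmaVeeHom (A : Formula P) : Pulls p (arr (.sigmaVeeHom A)) := fun c hc =>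
  (Contracts.vee_right hc (𝟙 _)).of_eq (sigmaVeeHom_natural c).symm

theorem pulls_deltaVeeInv (A : Formula P) : Pulls p (arr (.deltaVeeInv A)) := fun c hc => by
  cases hc with
  | vee_left h j =>
    -- Letterless coherence leaves only the identity of `⊥`.
    obtain rfl : j = 𝟙 _ := letterless_bot.hom_ext letterless_bot _ _
    refine h.of_eq ?_
    rw [deltaVeeHom_natural, reassoc_of% deltaVee_inv_hom]
  -- The surviving disjunct would be `⊥`, which has no contraction.
  | vee_right h j => cases h

theorem pulls_sigmaVeeInv (A : Formula P) : Pulls p (arr (.sigmaVeeInv A)) := fun c hc => by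
  cases hc with
  | vee_left h j => cases h
  | vee_right h j =>
    obtain rfl : j = 𝟙 _ := letterless_bot.hom_ext letterless_bot _ _
    refine h.of_eq ?_
    rw [sigmaVeeHom_natural, reassoc_of% sigmaVee_inv_hom]

theorem pulls_cWedge (A B : Formula P) : Pulls p (arr (.cWedge A B)) := fun c hc => by
  cases hc with
  | wedge_left h j =>
    refine (Contracts.wedge_right h j).of_eq ?_
    rw [← reassoc_of% cWedge_natural, cWedge_deltaWedgeHom]
  | wedge_right h j =>
    refine (Contracts.wedge_left h j).of_eq ?_
    rw [← reassoc_of% cWedge_natural, cWedge_sigmaWedgeHom]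

theorem pulls_bWedgeHom (A B C : Formula P) : Pulls p (arr (.bWedgeHom A B C)) := fun c hc => by
  cases hc with
  | wedge_left h k =>
    cases h with
    | wedge_left h j => exact (Contracts.wedge_left h _).of_eq (bWedgeHom_contract_left _ j k)
    | wedge_right h j =>
      exact (Contracts.wedge_right (.wedge_left h _) _).of_eq (bWedgeHom_contract_middle j _ k)
  | wedge_right h j =>
    obtain ⟨j, k, rfl⟩ := exists_eq_wedgeMap j
    exact (Contracts.wedge_right (.wedge_right h _) _).of_eq (bWedgeHom_contract_right j k _)

theorem pulls_bWedgeInv (A B C : Formula P) : Pulls p (arr (.bWedgeInv A B C)) := fun c hc => by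
  cases hc with
  | wedge_left h j =>
    obtain ⟨j, k, rfl⟩ := exists_eq_wedgeMap j
    exact (Contracts.wedge_left (.wedge_left h _) _).of_eq
      (inv_comp_eq_of_comp_eq (bWedgeHom_contract_left _ j k) (bWedge_inv_hom A B C))
  | wedge_right h j =>
    cases h with
    | wedge_left h k =>
      exact (Contracts.wedge_left (.wedge_right h _) _).of_eq
        (inv_comp_eq_of_comp_eq (bWedgeHom_contract_middle j _ k) (bWedge_inv_hom A B C))
    | wedge_right h k =>
      exact (Contracts.wedge_right h _).of_eq
        (inv_comp_eq_of_comp_eq (bWedgeHom_contract_right j k _) (bWedge_inv_hom A B C))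

theorem pulls_deltaWedgeHom (A : Formula P) : Pulls p (arr (.deltaWedgeHom A)) := fun c hc =>
  (Contracts.wedge_left hc (𝟙 _)).of_eq (deltaWedgeHom_natural c).symm

theorem pulls_sigmaWedgeHom (A : Formula P) : Pulls p (arr (.sigmaWedgeHom A)) := fun c hc =>
  (Contracts.wedge_right hc (𝟙 _)).of_eq (sigmaWedgeHom_natural c).symm

theorem pulls_deltaWedgeInv (A : Formula P) : Pulls p (arr (.deltaWedgeInv A)) := fun c hc => by
  cases hc with
  | wedge_left h j =>
    obtain rfl : j = 𝟙 _ := letterless_top.hom_ext letterless_top _ _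
    refine h.of_eq ?_
    rw [deltaWedgeHom_natural, reassoc_of% deltaWedge_inv_hom]
  | wedge_right h j => cases h

theorem pulls_sigmaWedgeInv (A : Formula P) : Pulls p (arr (.sigmaWedgeInv A)) := fun c hc => by
  cases hc with
  | wedge_left h j => cases h
  | wedge_right h j =>
    obtain rfl : j = 𝟙 _ := letterless_top.hom_ext letterless_top _ _
    refine h.of_eq ?_
    rw [sigmaWedgeHom_natural, reassoc_of% sigmaWedge_inv_hom]

/-- As `B ⋎ D` has an arrow to `⊤`, so do `B` and `D`. By `ck_top`, intermuting and then deleting `B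
⋎ D` amounts to deleting `B` and `D` separately. -/
theorem contracts_ck_left {A B C D : Formula P} {c : A ⋎ C ⟶ .letter p}
    (h : Contracts p (A ⋎ C) c) (j : B ⋎ D ⟶ ⊤') :
    Contracts p ((A ⋏ B) ⋎ (C ⋏ D)) (arr (.ck A B C D) ≫ (c ⋏ₘ j) ≫ arr (.deltaWedgeHom _)) := by
  have hBD := letterless_top.of_hom' j
  obtain ⟨k, l, rfl⟩ : ∃ (k : B ⟶ ⊤') (l : D ⟶ ⊤'), j = (k ⋎ₘ l) ≫ arr .wTopHom :=
    ⟨toTop B hBD.left_of_vee, toTop D hBD.right_of_vee, hBD.hom_ext letterless_top _ _⟩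
  -- The arrow `d` stands for either unitor, with `F` or `E` equal to `⊥` according to the surviving
  -- disjunct.
  have key : ∀ {E F G : Formula P} (a : A ⟶ E) (b : C ⟶ F) (d : E ⋎ F ⟶ G),
      arr (.ck A B C D) ≫ (((a ⋎ₘ b) ≫ d) ⋏ₘ ((k ⋎ₘ l) ≫ arr .wTopHom)) ≫
        arr (.deltaWedgeHom G) =
      (((a ⋏ₘ k) ≫ arr (.deltaWedgeHom E)) ⋎ₘ ((b ⋏ₘ l) ≫ arr (.deltaWedgeHom F))) ≫ d := by
    intro E F G a b d
    rw [← wedgeMap_comp, Category.assoc, ← reassoc_of% ck_natural, ck_top]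
    simp only [Category.assoc, reassoc_of% wedgeMap_comp, Category.id_comp, wTop_inv_hom,
      deltaWedgeHom_natural, reassoc_of% deltaWedge_inv_hom, reassoc_of% veeMap_comp]
  cases h with
  | vee_left h m => exact (Contracts.vee_left (.wedge_left h k) _).of_eq (key ..)
  | vee_right h m => exact (Contracts.vee_right (.wedge_left h l) _).of_eq (key ..)

theorem pulls_ck (A B C D : Formula P) : Pulls p (arr (.ck A B C D)) := fun c hc => by
  cases hc with
  | wedge_left h j => exact contracts_ck_left h j
  | wedge_right h j =>
    -- Commuting the conjuncts on both sides of the intermutation reduces a surviving right conjunct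
    -- to a surviving left one.
    have := ((pulls_cWedge A B).veeMap (pulls_cWedge C D)) _ (contracts_ck_left h j)
    refine this.of_eq ?_
    have e := arr_eq (Rel.ck_cWedge A B C D)
    simp only [arr_comp, arr_veeHom] at e
    rw [← reassoc_of% e, ← reassoc_of% cWedge_natural, cWedge_deltaWedgeHom]

theorem pulls (f : A ⟶ B) : Pulls p f := by
  obtain ⟨f, rfl⟩ := exists_arr f
  induction f with
  | one => exact fun c hc => hc.of_eq (Category.id_comp c)
  | comp f g hf hg => exact hf.comp hg
  | veeHom f g hf hg => exact hf.veeMap hg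
  | wedgeHom f g hf hg => exact hf.wedgeMap hg
  | bVeeHom => exact pulls_bVeeHom _ _ _
  | bVeeInv => exact pulls_bVeeInv _ _ _
  | bWedgeHom => exact pulls_bWedgeHom _ _ _
  | bWedgeInv => exact pulls_bWedgeInv _ _ _
  | cVee => exact pulls_cVee _ _
  | cWedge => exact pulls_cWedge _ _
  | deltaVeeHom => exact pulls_deltaVeeHom _
  | deltaVeeInv => exact pulls_deltaVeeInv _
  | deltaWedgeHom => exact pulls_deltaWedgeHom _
  | deltaWedgeInv => exact pulls_deltaWedgeInv _
  | sigmaVeeHom => exact pulls_sigmaVeeHom _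
  | sigmaVeeInv => exact pulls_sigmaVeeInv _
  | sigmaWedgeHom => exact pulls_sigmaWedgeHom _
  | sigmaWedgeInv => exact pulls_sigmaWedgeInv _
  | ck => exact pulls_ck _ _ _ _
  -- What remains is `κ` and the isomorphisms `w`, whose targets are letterless.
  | _ => exact pulls_of_target_letterless _ rfl

end Pulls

/-- The identity is a contraction, hence so is `f` followed by it; and the identity is the only
contraction of a bare letter. -/
theorem eq_id_of_letter {p : P} (f : Formula.letter p ⟶ .letter p) : f = 𝟙 _ := by
  have h := pulls f _ Contracts.letter
  rw [Category.comp_id] at h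
  cases h
  rfl

/-! ## Exchange of the two middle factors -/

/-- The symmetry `(A ∧ B) ∧ (C ∧ D) ⟶ (A ∧ C) ∧ (B ∧ D)`. -/
def wedgeMu (A B C D : Formula P) : (A ⋏ B) ⋏ (C ⋏ D) ⟶ (A ⋏ C) ⋏ (B ⋏ D) :=
  arr (.bWedgeInv A B (C ⋏ D)) ≫ (𝟙 A ⋏ₘ arr (.bWedgeHom B C D)) ≫
    (𝟙 A ⋏ₘ arr (.cWedge B C) ⋏ₘ 𝟙 D) ≫ (𝟙 A ⋏ₘ arr (.bWedgeInv C B D)) ≫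
      arr (.bWedgeHom A C (B ⋏ D))

/-- The symmetry `(A ∨ B) ∨ (C ∨ D) ⟶ (A ∨ C) ∨ (B ∨ D)`. -/
def veeMu (A B C D : Formula P) : (A ⋎ B) ⋎ (C ⋎ D) ⟶ (A ⋎ C) ⋎ (B ⋎ D) :=
  arr (.bVeeInv A B (C ⋎ D)) ≫ (𝟙 A ⋎ₘ arr (.bVeeHom B C D)) ≫
    (𝟙 A ⋎ₘ arr (.cVee B C) ⋎ₘ 𝟙 D) ≫ (𝟙 A ⋎ₘ arr (.bVeeInv C B D)) ≫
      arr (.bVeeHom A C (B ⋎ D))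

section Mu

variable {A A' B B' C C' D D' E E' F F' : Formula P}

/-- `wedgeMu` and `veeMu` unfold to `tensorμ` of the two monoidal structures, so facts about
`tensorμ` transfer by definitional equality. -/
theorem wedgeMu_natural (f : A ⟶ A') (g : B ⟶ B') (h : C ⟶ C') (k : D ⟶ D') :
    ((f ⋏ₘ g) ⋏ₘ h ⋏ₘ k) ≫ wedgeMu A' B' C' D' =
      wedgeMu A B C D ≫ ((f ⋏ₘ h) ⋏ₘ g ⋏ₘ k) :=
  letI := wedgeMonoidal (P := P)
  letI := wedgeSymmetric (P := P)
  MonoidalCategory.tensorμ_natural f g h k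

theorem veeMu_natural (f : A ⟶ A') (g : B ⟶ B') (h : C ⟶ C') (k : D ⟶ D') :
    ((f ⋎ₘ g) ⋎ₘ h ⋎ₘ k) ≫ veeMu A' B' C' D' =
      veeMu A B C D ≫ ((f ⋎ₘ h) ⋎ₘ g ⋎ₘ k) :=
  letI := veeMonoidal (P := P)
  letI := veeSymmetric (P := P)
  MonoidalCategory.tensorμ_natural f g h k

variable (A A' B B' C C' D D' E F)

theorem wedgeMu_wedgeMu : wedgeMu A B C D ≫ wedgeMu A C B D = 𝟙 _ := by
  simp only [wedgeMu, Category.assoc, reassoc_of% bWedge_hom_inv, reassoc_of% wedgeMap_comp,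
    reassoc_of% bWedge_inv_hom, bWedge_inv_hom, bWedge_hom_inv, cWedge_cWedge, Category.comp_id, wedgeMap_id, Category.id_comp]

theorem veeMu_veeMu : veeMu A B C D ≫ veeMu A C B D = 𝟙 _ := by
  simp only [veeMu, Category.assoc, reassoc_of% bVee_hom_inv, reassoc_of% veeMap_comp,
    reassoc_of% bVee_inv_hom, bVee_inv_hom, bVee_hom_inv, cVee_cVee, Category.comp_id, veeMap_id, Category.id_comp]

instance isIso_wedgeMu : IsIso (wedgeMu A B C D) :=
  ⟨_, wedgeMu_wedgeMu A B C D, wedgeMu_wedgeMu A C B D⟩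

instance isIso_veeMu : IsIso (veeMu A B C D) :=
  ⟨_, veeMu_veeMu A B C D, veeMu_veeMu A C B D⟩

theorem wedgeMu_cWedge :
    wedgeMu A B C D ≫ (arr (.cWedge A C) ⋏ₘ arr (.cWedge B D)) =
      arr (.cWedge (A ⋏ B) (C ⋏ D)) ≫ wedgeMu C D A B :=
  letI := wedgeMonoidal (P := P)
  letI := wedgeSymmetric (P := P)
  MonoidalCategory.tensorμ_braiding A B C D

theorem cVee_veeMu :
    (arr (.cVee A B) ⋎ₘ arr (.cVee C D)) ≫ veeMu B A D C =
      veeMu A B C D ≫ arr (.cVee (A ⋎ C) (B ⋎ D)) := by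
  let := veeMonoidal (P := P)
  let := veeSymmetric (P := P)
  have h : veeMu A C B D ≫ (arr (.cVee A B) ⋎ₘ arr (.cVee C D)) =
      arr (.cVee (A ⋎ C) (B ⋎ D)) ≫ veeMu B D A C := MonoidalCategory.tensorμ_braiding A C B D
  -- Precomposition with an exchange, which is undone by the next one, turns the goal into
  -- `tensorμ_braiding`.
  rw [← cancel_epi (veeMu A C B D), reassoc_of% h, veeMu_veeMu, reassoc_of% veeMu_veeMu,
    Category.comp_id]

theorem wedgeMu_bWedgeInv :
    (wedgeMu A B C D ⋏ₘ 𝟙 (E ⋏ F)) ≫ wedgeMu (A ⋏ C) (B ⋏ D) E F ≫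
        (arr (.bWedgeInv A C E) ⋏ₘ arr (.bWedgeInv B D F)) =
      arr (.bWedgeInv (A ⋏ B) (C ⋏ D) (E ⋏ F)) ≫ (𝟙 (A ⋏ B) ⋏ₘ wedgeMu C D E F) ≫
        wedgeMu A B (C ⋏ E) (D ⋏ F) :=
  letI := wedgeMonoidal (P := P)
  letI := wedgeSymmetric (P := P)
  MonoidalCategory.tensor_associativity A B C D E F

theorem veeMu_bVeeInv :
    veeMu (A ⋎ B) C (D ⋎ E) F ≫ (veeMu A B D E ⋎ₘ 𝟙 (C ⋎ F)) ≫
        arr (.bVeeInv (A ⋎ D) (B ⋎ E) (C ⋎ F)) =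
      (arr (.bVeeInv A B C) ⋎ₘ arr (.bVeeInv D E F)) ≫ veeMu A (B ⋎ C) D (E ⋎ F) ≫
        (𝟙 (A ⋎ D) ⋎ₘ veeMu B C E F) :=
  letI := veeMonoidal (P := P)
  letI := veeSymmetric (P := P)
  MonoidalCategory.associator_monoidal A B C D E F

theorem wedgeMu_deltaWedgeHom :
    arr (.deltaWedgeHom (A ⋏ B)) = (𝟙 (A ⋏ B) ⋏ₘ arr (.sigmaWedgeInv ⊤')) ≫ wedgeMu A B ⊤' ⊤' ≫
      (arr (.deltaWedgeHom A) ⋏ₘ arr (.deltaWedgeHom B)) :=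
  letI := wedgeMonoidal (P := P)
  letI := wedgeSymmetric (P := P)
  MonoidalCategory.tensor_right_unitality A B

theorem veeMu_deltaVeeHom :
    arr (.deltaVeeHom A) ⋎ₘ arr (.deltaVeeHom B) =
      veeMu A ⊥' B ⊥' ≫ (𝟙 (A ⋎ B) ⋎ₘ arr (.sigmaVeeHom ⊥')) ≫ arr (.deltaVeeHom (A ⋎ B)) :=
  letI := veeMonoidal (P := P)
  letI := veeSymmetric (P := P)
  MonoidalCategory.rightUnitor_monoidal A B

/-- Commutativity of `⊥ ∧ ⊥` is the identity, so only rebracketings that cancel remain. This settles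
the naturality of `split` at `wBotHom`. -/
theorem wedgeMu_bot : wedgeMu ⊥' ⊥' ⊥' (⊥' : Formula P) = 𝟙 _ := by
  simp only [wedgeMu, cWedge_bot, wedgeMap_id, Category.id_comp, reassoc_of% wedgeMap_comp,
    bWedge_hom_inv, bWedge_inv_hom]

theorem veeMu_top : veeMu ⊤' ⊤' ⊤' (⊤' : Formula P) = 𝟙 _ := by
  simp only [veeMu, cVee_top, veeMap_id, Category.id_comp, reassoc_of% veeMap_comp,
    bVee_hom_inv, bVee_inv_hom]

/-! Intermutation commutes with associativity, commutativity and the exchange of middle factors. -/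

theorem ck_bWedgeHom :
    arr (.ck A (B ⋏ C) D (E ⋏ F)) ≫ (𝟙 (A ⋎ D) ⋏ₘ arr (.ck B C E F)) ≫
        arr (.bWedgeHom (A ⋎ D) (B ⋎ E) (C ⋎ F)) =
      (arr (.bWedgeHom A B C) ⋎ₘ arr (.bWedgeHom D E F)) ≫ arr (.ck (A ⋏ B) C (D ⋏ E) F) ≫
        (arr (.ck A B D E) ⋏ₘ 𝟙 (C ⋎ F)) :=
  arr_eq (Rel.ck_bWedge A B C D E F)

theorem bVeeHom_ck :
    arr (.bVeeHom (A ⋏ D) (B ⋏ E) (C ⋏ F)) ≫ (arr (.ck A D B E) ⋎ₘ 𝟙 (C ⋏ F)) ≫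
        arr (.ck (A ⋎ B) (D ⋎ E) C F) =
      (𝟙 (A ⋏ D) ⋎ₘ arr (.ck B E C F)) ≫ arr (.ck A D (B ⋎ C) (E ⋎ F)) ≫
        (arr (.bVeeHom A B C) ⋏ₘ arr (.bVeeHom D E F)) :=
  arr_eq (Rel.ck_bVee A B C D E F)

theorem ck_bWedgeInv :
    arr (.ck (A ⋏ B) C (D ⋏ E) F) ≫ (arr (.ck A B D E) ⋏ₘ 𝟙 (C ⋎ F)) ≫
        arr (.bWedgeInv (A ⋎ D) (B ⋎ E) (C ⋎ F)) =
      (arr (.bWedgeInv A B C) ⋎ₘ arr (.bWedgeInv D E F)) ≫ arr (.ck A (B ⋏ C) D (E ⋏ F)) ≫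
        (𝟙 (A ⋎ D) ⋏ₘ arr (.ck B C E F)) := by
  have h := congr_arg (fun k => (arr (.bWedgeInv A B C) ⋎ₘ arr (.bWedgeInv D E F)) ≫ k ≫
    arr (.bWedgeInv (A ⋎ D) (B ⋎ E) (C ⋎ F))) (ck_bWedgeHom A B C D E F)
  simp only [Category.assoc, bWedge_hom_inv, reassoc_of% veeMap_comp, bWedge_inv_hom, veeMap_id,
    Category.comp_id, Category.id_comp] at h
  exact h.symm

theorem bVeeInv_ck :
    arr (.bVeeInv (A ⋏ D) (B ⋏ E) (C ⋏ F)) ≫ (𝟙 (A ⋏ D) ⋎ₘ arr (.ck B E C F)) ≫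
        arr (.ck A D (B ⋎ C) (E ⋎ F)) =
      (arr (.ck A D B E) ⋎ₘ 𝟙 (C ⋏ F)) ≫ arr (.ck (A ⋎ B) (D ⋎ E) C F) ≫
        (arr (.bVeeInv A B C) ⋏ₘ arr (.bVeeInv D E F)) := by
  have h := congr_arg (fun k => arr (.bVeeInv (A ⋏ D) (B ⋏ E) (C ⋏ F)) ≫ k ≫
    (arr (.bVeeInv A B C) ⋏ₘ arr (.bVeeInv D E F))) (bVeeHom_ck A B C D E F)
  simp only [Category.assoc, bVee_hom_inv, wedgeMap_comp, wedgeMap_id,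
    reassoc_of% bVee_inv_hom, Category.comp_id] at h
  exact h.symm

theorem ck_cWedge :
    arr (.ck A B C D) ≫ arr (.cWedge (A ⋎ C) (B ⋎ D)) =
      (arr (.cWedge A B) ⋎ₘ arr (.cWedge C D)) ≫ arr (.ck B A D C) :=
  arr_eq (Rel.ck_cWedge A B C D)

theorem cVee_ck :
    arr (.cVee (A ⋏ C) (B ⋏ D)) ≫ arr (.ck B D A C) =
      arr (.ck A C B D) ≫ (arr (.cVee A B) ⋏ₘ arr (.cVee C D)) :=
  arr_eq (Rel.ck_cVee A B C D)

end Mu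

/-! ### Intermutation of four conjuncts or four disjuncts -/

section CkMu

variable {A B C D A' B' C' D' X X' Y Y' Z Z' : Formula P}

/-- Strips the untouched first conjunct, so that an exchange among four conjuncts becomes one among
the last three. -/
theorem ck_wedge_square {g : X ⟶ X'} {g' : Y ⟶ Y'} {k : X ⋎ Y ⟶ Z} {k' : X' ⋎ Y' ⟶ Z'}
    {m : Z ⟶ Z'} (e : k ≫ m = (g ⋎ₘ g') ≫ k') :
    (arr (.ck A X B Y) ≫ (𝟙 _ ⋏ₘ k)) ≫ (𝟙 (A ⋎ B) ⋏ₘ m) =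
      ((𝟙 A ⋏ₘ g) ⋎ₘ (𝟙 B ⋏ₘ g')) ≫ arr (.ck A X' B Y') ≫ (𝟙 _ ⋏ₘ k') := by
  rw [reassoc_of% ck_natural, Category.assoc, wedgeMap_comp, wedgeMap_comp, e, veeMap_id]

theorem vee_ck_square {g : X ⟶ X'} {g' : Y ⟶ Y'} {k : Z ⟶ X ⋏ Y} {k' : Z' ⟶ X' ⋏ Y'}
    {m : Z ⟶ Z'} (e : m ≫ k' = k ≫ (g ⋏ₘ g')) :
    (𝟙 (A ⋏ B) ⋎ₘ m) ≫ (𝟙 _ ⋎ₘ k') ≫ arr (.ck A B X' Y') =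
      ((𝟙 _ ⋎ₘ k) ≫ arr (.ck A B X Y)) ≫ ((𝟙 A ⋎ₘ g) ⋏ₘ (𝟙 B ⋎ₘ g')) := by
  rw [Category.assoc, ← ck_natural, reassoc_of% veeMap_comp, reassoc_of% veeMap_comp, e,
    wedgeMap_id]

variable (A B C D A' B' C' D')

/-- Intermutation for conjunctions of four formulae, associated to the right. -/
def ckWedge : (A ⋏ B ⋏ C ⋏ D) ⋎ (A' ⋏ B' ⋏ C' ⋏ D') ⟶
    (A ⋎ A') ⋏ (B ⋎ B') ⋏ (C ⋎ C') ⋏ (D ⋎ D') :=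
  arr (.ck A (B ⋏ C ⋏ D) A' (B' ⋏ C' ⋏ D')) ≫
    (𝟙 _ ⋏ₘ (arr (.ck B (C ⋏ D) B' (C' ⋏ D')) ≫ (𝟙 _ ⋏ₘ arr (.ck C D C' D'))))

/-- Intermutation for disjunctions of four formulae, associated to the right. -/
def ckVee : (A ⋏ A') ⋎ (B ⋏ B') ⋎ (C ⋏ C') ⋎ (D ⋏ D') ⟶
    (A ⋎ B ⋎ C ⋎ D) ⋏ (A' ⋎ B' ⋎ C' ⋎ D') :=
  (𝟙 _ ⋎ₘ ((𝟙 _ ⋎ₘ arr (.ck C C' D D')) ≫ arr (.ck B B' (C ⋎ D) (C' ⋎ D')))) ≫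
    arr (.ck A A' (B ⋎ C ⋎ D) (B' ⋎ C' ⋎ D'))

/-- Brings a nested intermutation into right-associated form, in which the factors to be exchanged
are adjacent. -/
theorem ck_ck_bWedgeInv :
    arr (.ck (A ⋏ B) (C ⋏ D) (A' ⋏ B') (C' ⋏ D')) ≫
        (arr (.ck A B A' B') ⋏ₘ arr (.ck C D C' D')) ≫ arr (.bWedgeInv _ _ _) =
      (arr (.bWedgeInv A B (C ⋏ D)) ⋎ₘ arr (.bWedgeInv A' B' (C' ⋏ D'))) ≫
        ckWedge A B C D A' B' C' D' := by
  have e : arr (.ck A B A' B') ⋏ₘ arr (.ck C D C' D') =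
      (arr (.ck A B A' B') ⋏ₘ 𝟙 _) ≫ ((𝟙 _ ⋏ₘ 𝟙 _) ⋏ₘ arr (.ck C D C' D')) := by
    rw [wedgeMap_id, wedgeMap_comp, Category.id_comp, Category.comp_id]
  rw [e, Category.assoc, bWedgeInv_natural, ckWedge, reassoc_of% ck_bWedgeInv, wedgeMap_comp,
    Category.comp_id]

theorem bVeeHom_ck_ck :
    arr (.bVeeHom (A ⋏ A') (B ⋏ B') ((C ⋏ C') ⋎ (D ⋏ D'))) ≫
        (arr (.ck A A' B B') ⋎ₘ arr (.ck C C' D D')) ≫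
          arr (.ck (A ⋎ B) (A' ⋎ B') (C ⋎ D) (C' ⋎ D')) =
      ckVee A B C D A' B' C' D' ≫
        (arr (.bVeeHom A B (C ⋎ D)) ⋏ₘ arr (.bVeeHom A' B' (C' ⋎ D'))) := by
  have e : arr (.ck A A' B B') ⋎ₘ arr (.ck C C' D D') =
      ((𝟙 _ ⋎ₘ 𝟙 _) ⋎ₘ arr (.ck C C' D D')) ≫ (arr (.ck A A' B B') ⋎ₘ 𝟙 _) := by
    rw [veeMap_id, veeMap_comp, Category.id_comp, Category.comp_id]
  rw [e, Category.assoc, ← reassoc_of% bVeeHom_natural, bVeeHom_ck, ckVee,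
    reassoc_of% veeMap_comp, Category.id_comp, Category.assoc]

/-- Intermutation commutes with the exchange of conjuncts. -/
theorem ckWedge_exchange :
    ckWedge A B C D A' B' C' D' ≫ (𝟙 _ ⋏ₘ arr (.bWedgeHom _ _ _)) ≫
        (𝟙 _ ⋏ₘ arr (.cWedge _ _) ⋏ₘ 𝟙 _) ≫ (𝟙 _ ⋏ₘ arr (.bWedgeInv _ _ _)) =
      ((𝟙 A ⋏ₘ (arr (.bWedgeHom B C D) ≫ (arr (.cWedge B C) ⋏ₘ 𝟙 D) ≫ arr (.bWedgeInv C B D))) ⋎ₘ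
        (𝟙 A' ⋏ₘ (arr (.bWedgeHom B' C' D') ≫ (arr (.cWedge B' C') ⋏ₘ 𝟙 D') ≫
          arr (.bWedgeInv C' B' D')))) ≫ ckWedge A C B D A' C' B' D' := by
  rw [wedgeMap_comp, wedgeMap_comp, Category.id_comp, Category.id_comp, ckWedge, ckWedge]
  refine ck_wedge_square ?_
  rw [Category.assoc, reassoc_of% ck_bWedgeHom]
  -- On the two conjuncts that are swapped, this is the compatibility of intermutation with
  -- commutativity.
  have e : (arr (.ck B C B' C') ⋏ₘ 𝟙 (D ⋎ D')) ≫ (arr (.cWedge _ _) ⋏ₘ 𝟙 (D ⋎ D')) =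
      ((arr (.cWedge _ _) ⋎ₘ arr (.cWedge _ _)) ⋏ₘ (𝟙 D ⋎ₘ 𝟙 D')) ≫
        (arr (.ck C B C' B') ⋏ₘ 𝟙 _) := by
    rw [wedgeMap_comp, wedgeMap_comp, ck_cWedge, veeMap_id, Category.comp_id]
  rw [reassoc_of% e, ← reassoc_of% ck_natural, ck_bWedgeInv, reassoc_of% veeMap_comp,
    reassoc_of% veeMap_comp, Category.assoc, Category.assoc]

/-- Intermutation commutes with the exchange of disjuncts. -/
theorem ckVee_exchange :
    (𝟙 _ ⋎ₘ arr (.bVeeHom _ _ _)) ≫ (𝟙 _ ⋎ₘ arr (.cVee _ _) ⋎ₘ 𝟙 _) ≫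
        (𝟙 _ ⋎ₘ arr (.bVeeInv _ _ _)) ≫ ckVee A C B D A' C' B' D' =
      ckVee A B C D A' B' C' D' ≫
      ((𝟙 A ⋎ₘ (arr (.bVeeHom B C D) ≫ (arr (.cVee B C) ⋎ₘ 𝟙 D) ≫ arr (.bVeeInv C B D))) ⋏ₘ
        (𝟙 A' ⋎ₘ (arr (.bVeeHom B' C' D') ≫ (arr (.cVee B' C') ⋎ₘ 𝟙 D') ≫
          arr (.bVeeInv C' B' D')))) := by
  rw [reassoc_of% veeMap_comp, reassoc_of% veeMap_comp, Category.id_comp, Category.id_comp,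
    ckVee, ckVee]
  refine vee_ck_square ?_
  rw [Category.assoc, Category.assoc, bVeeInv_ck]
  have e : (arr (.cVee _ _) ⋎ₘ 𝟙 (D ⋏ D')) ≫ (arr (.ck C C' B B') ⋎ₘ 𝟙 (D ⋏ D')) =
      (arr (.ck B B' C C') ⋎ₘ 𝟙 _) ≫
        ((arr (.cVee _ _) ⋏ₘ arr (.cVee _ _)) ⋎ₘ (𝟙 D ⋏ₘ 𝟙 D')) := by
    rw [veeMap_comp, veeMap_comp, cVee_ck, wedgeMap_id, Category.comp_id]
  rw [reassoc_of% e, reassoc_of% ck_natural, reassoc_of% bVeeHom_ck, wedgeMap_comp,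
    wedgeMap_comp, Category.assoc]

/-- The square behind the naturality of `split` at an intermutation. Both routes are rebracketed to
`ckWedge`, where the exchange passes through. -/
theorem ck_wedgeMu :
    arr (.ck (A ⋏ B) (C ⋏ D) (A' ⋏ B') (C' ⋏ D')) ≫
        (arr (.ck A B A' B') ⋏ₘ arr (.ck C D C' D')) ≫ wedgeMu _ _ _ _ =
      (wedgeMu A B C D ⋎ₘ wedgeMu A' B' C' D') ≫
        arr (.ck (A ⋏ C) (B ⋏ D) (A' ⋏ C') (B' ⋏ D')) ≫
          (arr (.ck A C A' C') ⋏ₘ arr (.ck B D B' D')) := by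
  have e : ckWedge A C B D A' C' B' D' ≫ arr (.bWedgeHom _ _ _) =
      (arr (.bWedgeHom A C (B ⋏ D)) ⋎ₘ arr (.bWedgeHom A' C' (B' ⋏ D'))) ≫
        arr (.ck (A ⋏ C) (B ⋏ D) (A' ⋏ C') (B' ⋏ D')) ≫
          (arr (.ck A C A' C') ⋏ₘ arr (.ck B D B' D')) := by
    have h := congr_arg (fun k =>
      (arr (.bWedgeHom A C (B ⋏ D)) ⋎ₘ arr (.bWedgeHom A' C' (B' ⋏ D'))) ≫ k ≫
        arr (.bWedgeHom _ _ _)) (ck_ck_bWedgeInv A C B D A' C' B' D')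
    simp only [Category.assoc, bWedge_inv_hom, reassoc_of% veeMap_comp, bWedge_hom_inv, veeMap_id,
      Category.comp_id, Category.id_comp] at h
    exact h.symm
  have h := ckWedge_exchange A B C D A' B' C' D'
  simp only [wedgeMu]
  rw [reassoc_of% ck_ck_bWedgeInv, reassoc_of% h, e]
  simp only [reassoc_of% veeMap_comp, reassoc_of% wedgeMap_comp, Category.id_comp]

/-- The dual square, behind the naturality of `merge` at an intermutation. -/
theorem veeMu_ck :
    veeMu _ _ _ _ ≫ (arr (.ck A A' C C') ⋎ₘ arr (.ck B B' D D')) ≫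
        arr (.ck (A ⋎ C) (A' ⋎ C') (B ⋎ D) (B' ⋎ D')) =
      (arr (.ck A A' B B') ⋎ₘ arr (.ck C C' D D')) ≫
        arr (.ck (A ⋎ B) (A' ⋎ B') (C ⋎ D) (C' ⋎ D')) ≫
          (veeMu A B C D ⋏ₘ veeMu A' B' C' D') := by
  have e : arr (.bVeeInv (A ⋏ A') (B ⋏ B') ((C ⋏ C') ⋎ (D ⋏ D'))) ≫
      ckVee A B C D A' B' C' D' =
      (arr (.ck A A' B B') ⋎ₘ arr (.ck C C' D D')) ≫
        arr (.ck (A ⋎ B) (A' ⋎ B') (C ⋎ D) (C' ⋎ D')) ≫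
        (arr (.bVeeInv A B (C ⋎ D)) ⋏ₘ arr (.bVeeInv A' B' (C' ⋎ D'))) := by
    have h := congr_arg (fun k => arr (.bVeeInv _ _ _) ≫ k ≫
      (arr (.bVeeInv A B (C ⋎ D)) ⋏ₘ arr (.bVeeInv A' B' (C' ⋎ D'))))
      (bVeeHom_ck_ck A B C D A' B' C' D')
    simp only [Category.assoc, bVee_hom_inv, wedgeMap_comp, wedgeMap_id,
      reassoc_of% bVee_inv_hom, Category.comp_id] at h
    exact h.symm
  have h := ckVee_exchange A B C D A' B' C' D'
  simp only [veeMu, Category.assoc]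
  rw [bVeeHom_ck_ck, reassoc_of% h, reassoc_of% e]
  simp only [wedgeMap_comp, reassoc_of% veeMap_comp, Category.id_comp]

end CkMu

/-! ## Splitting a formula into a conjunction -/

section Split

variable {σ₁ σ₂ : P → Formula P} (s : ∀ p, .letter p ⟶ σ₁ p ⋏ σ₂ p)

/-- The natural arrow that splits every formula into a conjunction of two substitution instances,
given its values at the letters. -/
def split : ∀ A : Formula P, A ⟶ A.subst σ₁ ⋏ A.subst σ₂
  | .letter p => s p
  | .bot => arr .wBotInv
  | .top => arr (.sigmaWedgeInv ⊤')
  | .vee A B => (split A ⋎ₘ split B) ≫ arr (.ck (A.subst σ₁) (A.subst σ₂) _ _)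
  | .wedge A B => (split A ⋏ₘ split B) ≫ wedgeMu (A.subst σ₁) (A.subst σ₂) _ _

/-- Naturality of the splitting at the arrow represented by an arrow term. -/
def SplitNatural {A B : Formula P} (f : ArrowTerm A B) : Prop :=
  arr f ≫ split s B = split s A ≫ (arr (f.subst σ₁) ⋏ₘ arr (f.subst σ₂))

variable {s}

/-- Conjugating the square by the inverses means that only one of two mutually inverse primitive
terms needs a computation. -/
theorem SplitNatural.of_inv {A B : Formula P} {f : ArrowTerm A B} {g : ArrowTerm B A}
    (h : SplitNatural s f) (hfg : Rel (.comp f g) (.one A)) (hgf : Rel (.comp g f) (.one B)) :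
    SplitNatural s g := by
  have e : arr g ≫ arr f = 𝟙 _ := arr_eq hgf
  have e₁ : arr (f.subst σ₁) ≫ arr (g.subst σ₁) = 𝟙 _ := arr_eq (hfg.subst σ₁)
  have e₂ : arr (f.subst σ₂) ≫ arr (g.subst σ₂) = 𝟙 _ := arr_eq (hfg.subst σ₂)
  have h' := congr_arg (fun k => arr g ≫ k ≫ (arr (g.subst σ₁) ⋏ₘ arr (g.subst σ₂))) h
  simp only [Category.assoc, wedgeMap_comp, e₁, e₂, wedgeMap_id, reassoc_of% e] at h'
  rw [SplitNatural, h', Category.comp_id]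

theorem sigmaWedgeInv_top :
    arr (.sigmaWedgeInv (⊤' : Formula P)) = arr (.deltaWedgeInv ⊤') := by
  rw [← cancel_epi (arr (.sigmaWedgeHom ⊤')), sigmaWedge_hom_inv, sigmaWedgeHom_top,
    deltaWedge_hom_inv]

variable (A B C D : Formula P)

/-- Here and in the lemmas that follow, the values of `split` at subformulae slide out by
naturality, leaving a coherence equation for intermutation, the exchange or the units. -/
theorem splitNatural_bVeeHom : SplitNatural s (.bVeeHom A B C) := by
  simp only [SplitNatural, split, ArrowTerm.subst, Formula.subst, veeMap_comp_left,
    veeMap_comp_right, Category.assoc]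
  rw [← bVeeHom_ck, reassoc_of% bVeeHom_natural]

theorem splitNatural_cVee : SplitNatural s (.cVee A B) := by
  simp only [SplitNatural, split, ArrowTerm.subst, Formula.subst, Category.assoc]
  rw [← cVee_ck, reassoc_of% cVee_natural]

theorem splitNatural_deltaVeeHom : SplitNatural s (.deltaVeeHom A) := by
  simp only [SplitNatural, split, ArrowTerm.subst, Formula.subst, Category.assoc]
  rw [ck_bot, Category.assoc, Category.assoc, wedgeMap_comp, deltaVee_inv_hom, deltaVee_inv_hom,
    wedgeMap_id, Category.comp_id, reassoc_of% veeMap_comp, wBot_inv_hom, Category.comp_id,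
    deltaVeeHom_natural]

theorem splitNatural_bWedgeInv : SplitNatural s (.bWedgeInv A B C) := by
  simp only [SplitNatural, split, ArrowTerm.subst, Formula.subst, wedgeMap_comp_left,
    wedgeMap_comp_right, Category.assoc]
  rw [wedgeMu_bWedgeInv, reassoc_of% bWedgeInv_natural]

theorem splitNatural_cWedge : SplitNatural s (.cWedge A B) := by
  simp only [SplitNatural, split, ArrowTerm.subst, Formula.subst, Category.assoc]
  rw [wedgeMu_cWedge, reassoc_of% cWedge_natural]

theorem splitNatural_deltaWedgeHom : SplitNatural s (.deltaWedgeHom A) := by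
  simp only [SplitNatural, split, ArrowTerm.subst, Formula.subst, Category.assoc]
  rw [← deltaWedgeHom_natural, wedgeMu_deltaWedgeHom, reassoc_of% wedgeMap_comp,
    Category.comp_id, Category.id_comp]

theorem splitNatural_ck : SplitNatural s (.ck A B C D) := by
  simp only [SplitNatural, split, ArrowTerm.subst, Formula.subst, Category.assoc,
    ← wedgeMap_comp, ← veeMap_comp]
  rw [← ck_wedgeMu, reassoc_of% ck_natural]

theorem splitNatural_wBotHom : SplitNatural s .wBotHom := by
  simp only [SplitNatural, split, ArrowTerm.subst, Formula.subst]
  rw [wedgeMu_bot, Category.comp_id, wedgeMap_comp, wBot_inv_hom, wBot_hom_inv, wedgeMap_id]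

theorem splitNatural_wTopHom : SplitNatural s .wTopHom := by
  simp only [SplitNatural, split, ArrowTerm.subst, Formula.subst]
  rw [sigmaWedgeInv_top, ck_top, reassoc_of% veeMap_comp, deltaWedge_inv_hom, veeMap_id,
    Category.id_comp, Category.assoc, wedgeMap_comp, wTop_inv_hom, Category.id_comp,
    deltaWedgeInv_natural]

theorem splitNatural_kappa : SplitNatural s .kappa := by
  simp only [SplitNatural, split, ArrowTerm.subst, Formula.subst]
  rw [kappa_wedge_kappa, reassoc_of% wBot_inv_hom, sigmaWedgeInv_top]

variable {A B C D}

theorem SplitNatural.comp {f : ArrowTerm A B} {g : ArrowTerm B C} (hf : SplitNatural s f)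
    (hg : SplitNatural s g) : SplitNatural s (.comp f g) := by
  simp only [SplitNatural] at hf hg
  simp only [SplitNatural, ArrowTerm.subst, arr_comp, ← wedgeMap_comp, ← reassoc_of% hf, ← hg,
    Category.assoc]

theorem SplitNatural.of_rel {f g : ArrowTerm A B} (h : SplitNatural s f) (e : Rel f g) :
    SplitNatural s g := by
  rw [SplitNatural, ← arr_eq e, ← arr_eq (e.subst σ₁), ← arr_eq (e.subst σ₂)]
  exact h

theorem rel_of_arr_eq {f g : ArrowTerm A B} (h : arr f = arr g) : Rel f g := Quotient.exact h

theorem splitNatural_sigmaVeeHom : SplitNatural s (.sigmaVeeHom A) :=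
  ((splitNatural_cVee ⊥' A).comp (splitNatural_deltaVeeHom A)).of_rel
    (rel_of_arr_eq (cVee_deltaVeeHom A))

theorem splitNatural_sigmaWedgeHom : SplitNatural s (.sigmaWedgeHom A) :=
  ((splitNatural_cWedge ⊤' A).comp (splitNatural_deltaWedgeHom A)).of_rel
    (rel_of_arr_eq (cWedge_deltaWedgeHom A))

theorem splitNatural (f : ArrowTerm A B) : SplitNatural s f := by
  induction f with
  | one A => rw [SplitNatural, arr_one, Category.id_comp]; exact
      (congr_arg (split s A ≫ ·) (wedgeMap_id _ _) |>.trans (Category.comp_id _)).symm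
  | comp f g hf hg => exact hf.comp hg
  | veeHom f g hf hg =>
    simp only [SplitNatural] at hf hg
    simp only [SplitNatural, split, ArrowTerm.subst, Formula.subst, arr_veeHom, Category.assoc]
    rw [← ck_natural, reassoc_of% veeMap_comp, reassoc_of% veeMap_comp, hf, hg]
  | wedgeHom f g hf hg =>
    simp only [SplitNatural] at hf hg
    simp only [SplitNatural, split, ArrowTerm.subst, Formula.subst, arr_wedgeHom, Category.assoc]
    rw [← wedgeMu_natural, reassoc_of% wedgeMap_comp, reassoc_of% wedgeMap_comp, hf, hg]
  | bVeeHom A B C => exact splitNatural_bVeeHom A B C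
  | bVeeInv A B C =>
    exact (splitNatural_bVeeHom A B C).of_inv (.bVee_hom_inv ..) (.bVee_inv_hom ..)
  | bWedgeHom A B C =>
    exact (splitNatural_bWedgeInv A B C).of_inv (.bWedge_inv_hom ..) (.bWedge_hom_inv ..)
  | bWedgeInv A B C => exact splitNatural_bWedgeInv A B C
  | cVee A B => exact splitNatural_cVee A B
  | cWedge A B => exact splitNatural_cWedge A B
  | deltaVeeHom A => exact splitNatural_deltaVeeHom A
  | deltaVeeInv A =>
    exact (splitNatural_deltaVeeHom A).of_inv (.deltaVee_hom_inv _) (.deltaVee_inv_hom _)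
  | deltaWedgeHom A => exact splitNatural_deltaWedgeHom A
  | deltaWedgeInv A =>
    exact (splitNatural_deltaWedgeHom A).of_inv (.deltaWedge_hom_inv _) (.deltaWedge_inv_hom _)
  | sigmaVeeHom A => exact splitNatural_sigmaVeeHom
  | sigmaVeeInv A =>
    exact splitNatural_sigmaVeeHom.of_inv (.sigmaVee_hom_inv _) (.sigmaVee_inv_hom _)
  | sigmaWedgeHom A => exact splitNatural_sigmaWedgeHom
  | sigmaWedgeInv A =>
    exact splitNatural_sigmaWedgeHom.of_inv (.sigmaWedge_hom_inv _) (.sigmaWedge_inv_hom _)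
  | ck A B C D => exact splitNatural_ck A B C D
  | wBotHom => exact splitNatural_wBotHom
  | wBotInv => exact splitNatural_wBotHom.of_inv .wBot_hom_inv .wBot_inv_hom
  | wTopHom => exact splitNatural_wTopHom
  | wTopInv => exact splitNatural_wTopHom.of_inv .wTop_hom_inv .wTop_inv_hom
  | kappa => exact splitNatural_kappa

/-- Where `split s B` is monic, `f` is therefore determined by its two substitution instances. -/
theorem split_natural (f : A ⟶ B) :
    f ≫ split s B = split s A ≫ (substMap σ₁ f ⋏ₘ substMap σ₂ f) := by
  obtain ⟨f, rfl⟩ := exists_arr f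
  exact splitNatural f

end Split

/-! ## Merging a disjunction into a formula -/

section Merge

variable {σ₁ σ₂ : P → Formula P} (s : ∀ p, σ₁ p ⋎ σ₂ p ⟶ .letter p)

/-- The natural arrow that merges into every formula a disjunction of two substitution instances,
given its values at the letters. -/
def merge : ∀ A : Formula P, A.subst σ₁ ⋎ A.subst σ₂ ⟶ A
  | .letter p => s p
  | .bot => arr (.sigmaVeeHom ⊥')
  | .top => arr .wTopHom
  | .vee A B => veeMu (A.subst σ₁) (B.subst σ₁) _ _ ≫ (merge A ⋎ₘ merge B)
  | .wedge A B => arr (.ck (A.subst σ₁) (B.subst σ₁) _ _) ≫ (merge A ⋏ₘ merge B)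

/-- Naturality of the merging at the arrow represented by an arrow term. -/
def MergeNatural {A B : Formula P} (f : ArrowTerm A B) : Prop :=
  (arr (f.subst σ₁) ⋎ₘ arr (f.subst σ₂)) ≫ merge s B = merge s A ≫ arr f

variable {s}

theorem MergeNatural.of_inv {A B : Formula P} {f : ArrowTerm A B} {g : ArrowTerm B A}
    (h : MergeNatural s f) (hfg : Rel (.comp f g) (.one A)) (hgf : Rel (.comp g f) (.one B)) :
    MergeNatural s g := by
  have e : arr f ≫ arr g = 𝟙 _ := arr_eq hfg
  have e₁ : arr (g.subst σ₁) ≫ arr (f.subst σ₁) = 𝟙 _ := arr_eq (hgf.subst σ₁)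
  have e₂ : arr (g.subst σ₂) ≫ arr (f.subst σ₂) = 𝟙 _ := arr_eq (hgf.subst σ₂)
  have h' := congr_arg (fun k => (arr (g.subst σ₁) ⋎ₘ arr (g.subst σ₂)) ≫ k ≫ arr g) h
  simp only [Category.assoc, reassoc_of% veeMap_comp, e₁, e₂, veeMap_id, e, Category.comp_id,
    Category.id_comp] at h'
  exact h'.symm

variable (A B C D : Formula P)

/-- Dual to the splitting: now disjunctions are handled by the exchange and conjunctions by
intermutation. -/
theorem mergeNatural_bVeeInv : MergeNatural s (.bVeeInv A B C) := by
  simp only [MergeNatural, merge, ArrowTerm.subst, Formula.subst, veeMap_comp_left',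
    veeMap_comp_right', Category.assoc]
  rw [bVeeInv_natural, reassoc_of% veeMu_bVeeInv]

theorem mergeNatural_cVee : MergeNatural s (.cVee A B) := by
  simp only [MergeNatural, merge, ArrowTerm.subst, Formula.subst, Category.assoc]
  rw [reassoc_of% cVee_veeMu, cVee_natural]

theorem mergeNatural_deltaVeeHom : MergeNatural s (.deltaVeeHom A) := by
  simp only [MergeNatural, merge, ArrowTerm.subst, Formula.subst, Category.assoc]
  rw [veeMu_deltaVeeHom, Category.assoc, Category.assoc, ← deltaVeeHom_natural,
    reassoc_of% veeMap_comp, Category.comp_id, Category.id_comp]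

theorem mergeNatural_bWedgeHom : MergeNatural s (.bWedgeHom A B C) := by
  simp only [MergeNatural, merge, ArrowTerm.subst, Formula.subst, wedgeMap_comp_left',
    wedgeMap_comp_right', Category.assoc]
  rw [bWedgeHom_natural, reassoc_of% ck_bWedgeHom]

theorem mergeNatural_cWedge : MergeNatural s (.cWedge A B) := by
  simp only [MergeNatural, merge, ArrowTerm.subst, Formula.subst, Category.assoc]
  rw [← reassoc_of% ck_cWedge, cWedge_natural]

theorem mergeNatural_deltaWedgeHom : MergeNatural s (.deltaWedgeHom A) := by
  simp only [MergeNatural, merge, ArrowTerm.subst, Formula.subst, Category.assoc]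
  rw [ck_top, Category.assoc, Category.assoc, reassoc_of% wedgeMap_comp, wTop_inv_hom,
    Category.id_comp, deltaWedgeHom_natural, reassoc_of% deltaWedge_inv_hom]

theorem mergeNatural_ck : MergeNatural s (.ck A B C D) := by
  simp only [MergeNatural, merge, ArrowTerm.subst, Formula.subst, Category.assoc,
    ← wedgeMap_comp, ← veeMap_comp]
  rw [ck_natural, reassoc_of% veeMu_ck]

theorem mergeNatural_wBotHom : MergeNatural s .wBotHom := by
  simp only [MergeNatural, merge, ArrowTerm.subst, Formula.subst]
  rw [sigmaVeeHom_bot, ck_bot, Category.assoc, Category.assoc, Category.assoc,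
    reassoc_of% wedgeMap_comp, deltaVee_inv_hom, wedgeMap_id, Category.id_comp,
    ← deltaVeeHom_natural, reassoc_of% veeMap_comp, Category.comp_id, Category.id_comp]

theorem mergeNatural_wTopHom : MergeNatural s .wTopHom := by
  simp only [MergeNatural, merge, ArrowTerm.subst, Formula.subst]
  rw [veeMu_top, Category.id_comp]

theorem mergeNatural_kappa : MergeNatural s .kappa := by
  simp only [MergeNatural, merge, ArrowTerm.subst, Formula.subst]
  rw [kappa_vee_kappa, Category.assoc, Category.assoc, wTop_inv_hom, sigmaVeeHom_bot,
    Category.comp_id]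

variable {A B C D}

theorem MergeNatural.comp {f : ArrowTerm A B} {g : ArrowTerm B C} (hf : MergeNatural s f)
    (hg : MergeNatural s g) : MergeNatural s (.comp f g) := by
  simp only [MergeNatural] at hf hg
  simp only [MergeNatural, ArrowTerm.subst, arr_comp, ← veeMap_comp, ← reassoc_of% hf, hg,
    Category.assoc]

theorem MergeNatural.of_rel {f g : ArrowTerm A B} (h : MergeNatural s f) (e : Rel f g) :
    MergeNatural s g := by
  rw [MergeNatural, ← arr_eq e, ← arr_eq (e.subst σ₁), ← arr_eq (e.subst σ₂)]
  exact h

theorem mergeNatural_sigmaVeeHom : MergeNatural s (.sigmaVeeHom A) :=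
  ((mergeNatural_cVee ⊥' A).comp (mergeNatural_deltaVeeHom A)).of_rel
    (rel_of_arr_eq (cVee_deltaVeeHom A))

theorem mergeNatural_sigmaWedgeHom : MergeNatural s (.sigmaWedgeHom A) :=
  ((mergeNatural_cWedge ⊤' A).comp (mergeNatural_deltaWedgeHom A)).of_rel
    (rel_of_arr_eq (cWedge_deltaWedgeHom A))

theorem mergeNatural (f : ArrowTerm A B) : MergeNatural s f := by
  induction f with
  | one A => rw [MergeNatural, arr_one, Category.comp_id]; exact
      congr_arg (· ≫ merge s A) (veeMap_id _ _) |>.trans (Category.id_comp _)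
  | comp f g hf hg => exact hf.comp hg
  | veeHom f g hf hg =>
    simp only [MergeNatural] at hf hg
    simp only [MergeNatural, merge, ArrowTerm.subst, Formula.subst, arr_veeHom, Category.assoc]
    rw [reassoc_of% veeMu_natural, veeMap_comp, veeMap_comp, hf, hg]
  | wedgeHom f g hf hg =>
    simp only [MergeNatural] at hf hg
    simp only [MergeNatural, merge, ArrowTerm.subst, Formula.subst, arr_wedgeHom, Category.assoc]
    rw [reassoc_of% ck_natural, wedgeMap_comp, wedgeMap_comp, hf, hg]
  | bVeeHom A B C =>
    exact (mergeNatural_bVeeInv A B C).of_inv (.bVee_inv_hom ..) (.bVee_hom_inv ..)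
  | bVeeInv A B C => exact mergeNatural_bVeeInv A B C
  | bWedgeHom A B C => exact mergeNatural_bWedgeHom A B C
  | bWedgeInv A B C =>
    exact (mergeNatural_bWedgeHom A B C).of_inv (.bWedge_hom_inv ..) (.bWedge_inv_hom ..)
  | cVee A B => exact mergeNatural_cVee A B
  | cWedge A B => exact mergeNatural_cWedge A B
  | deltaVeeHom A => exact mergeNatural_deltaVeeHom A
  | deltaVeeInv A =>
    exact (mergeNatural_deltaVeeHom A).of_inv (.deltaVee_hom_inv _) (.deltaVee_inv_hom _)
  | deltaWedgeHom A => exact mergeNatural_deltaWedgeHom A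
  | deltaWedgeInv A =>
    exact (mergeNatural_deltaWedgeHom A).of_inv (.deltaWedge_hom_inv _) (.deltaWedge_inv_hom _)
  | sigmaVeeHom A => exact mergeNatural_sigmaVeeHom
  | sigmaVeeInv A =>
    exact mergeNatural_sigmaVeeHom.of_inv (.sigmaVee_hom_inv _) (.sigmaVee_inv_hom _)
  | sigmaWedgeHom A => exact mergeNatural_sigmaWedgeHom
  | sigmaWedgeInv A =>
    exact mergeNatural_sigmaWedgeHom.of_inv (.sigmaWedge_hom_inv _) (.sigmaWedge_inv_hom _)
  | ck A B C D => exact mergeNatural_ck A B C D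
  | wBotHom => exact mergeNatural_wBotHom
  | wBotInv => exact mergeNatural_wBotHom.of_inv .wBot_hom_inv .wBot_inv_hom
  | wTopHom => exact mergeNatural_wTopHom
  | wTopInv => exact mergeNatural_wTopHom.of_inv .wTop_hom_inv .wTop_inv_hom
  | kappa => exact mergeNatural_kappa

theorem merge_natural (f : A ⟶ B) :
    (substMap σ₁ f ⋎ₘ substMap σ₂ f) ≫ merge s B = merge s A ≫ f := by
  obtain ⟨f, rfl⟩ := exists_arr f
  exact mergeNatural f

end Merge

namespace Formula

/-! ## Formulae without units -/

/-- Neither `⊥` nor `⊤` occurs in the formula. -/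
def UnitFree (A : Formula P) : Prop := ¬ A.BotOccurs ∧ ¬ A.TopOccurs

section UnitFree

variable {A B : Formula P}

theorem unitFree_vee : (A ⋎ B).UnitFree ↔ A.UnitFree ∧ B.UnitFree := by
  simp only [UnitFree, BotOccurs, TopOccurs]
  tauto

theorem unitFree_wedge : (A ⋏ B).UnitFree ↔ A.UnitFree ∧ B.UnitFree := by
  simp only [UnitFree, BotOccurs, TopOccurs]
  tauto

theorem not_unitFree_bot : ¬ (⊥' : Formula P).UnitFree := fun h => h.1 trivial

theorem not_unitFree_top : ¬ (⊤' : Formula P).UnitFree := fun h => h.2 trivial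

theorem unitFree_letter (p : P) : (letter p).UnitFree := ⟨id, id⟩

/-- Every proper reduction clause has a unit among its arguments, so here `reduceVee` is plain
disjunction. -/
theorem UnitFree.reduceVee (hA : A.UnitFree) (hB : B.UnitFree) : (A.reduceVee B).UnitFree := by
  have h := unitFree_vee.2 ⟨hA, hB⟩
  cases A <;> cases B <;> first
    | exact (not_unitFree_bot hA).elim | exact (not_unitFree_bot hB).elim
    | exact (not_unitFree_top hA).elim | exact (not_unitFree_top hB).elim | exact h

theorem UnitFree.reduceWedge (hA : A.UnitFree) (hB : B.UnitFree) :
    (A.reduceWedge B).UnitFree := by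
  have h := unitFree_wedge.2 ⟨hA, hB⟩
  cases A <;> cases B <;> first
    | exact (not_unitFree_bot hA).elim | exact (not_unitFree_bot hB).elim
    | exact (not_unitFree_top hA).elim | exact (not_unitFree_top hB).elim | exact h

theorem reduceVee_bot (A : Formula P) : A.reduceVee ⊥' = A := by cases A <;> rfl

theorem bot_reduceVee (A : Formula P) : reduceVee ⊥' A = A := by cases A <;> rfl

theorem reduceWedge_top (A : Formula P) : A.reduceWedge ⊤' = A := by cases A <;> rfl

theorem top_reduceWedge (A : Formula P) : reduceWedge ⊤' A = A := by cases A <;> rfl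

theorem UnitFree.exists_mem (h : A.UnitFree) : ∃ p, p ∈ A.letters := by
  induction A with
  | letter p => exact ⟨p, List.mem_singleton_self p⟩
  | bot => exact (not_unitFree_bot h).elim
  | top => exact (not_unitFree_top h).elim
  | vee A B ihA _ =>
    obtain ⟨p, hp⟩ := ihA (unitFree_vee.1 h).1
    exact ⟨p, List.mem_append_left _ hp⟩
  | wedge A B ihA _ =>
    obtain ⟨p, hp⟩ := ihA (unitFree_wedge.1 h).1
    exact ⟨p, List.mem_append_left _ hp⟩

/-- A binary connective would contribute at least two letters, one from each unit-free component. -/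
theorem UnitFree.exists_eq_letter (h : A.UnitFree) {p : P} (e : A.letters.Perm [p]) :
    A = letter p := by
  have two : ∀ {A B : Formula P}, A.UnitFree → B.UnitFree →
      ¬ (A.letters ++ B.letters).Perm [p] := by
    intro A B hA hB e
    have hl := e.length_eq
    obtain ⟨a, ha⟩ := hA.exists_mem
    obtain ⟨b, hb⟩ := hB.exists_mem
    have := List.length_pos_of_mem ha
    have := List.length_pos_of_mem hb
    simp only [List.length_append, List.length_singleton] at hl
    omega
  cases A with
  | letter q => rw [List.singleton_perm_singleton.1 e]
  | bot => exact (not_unitFree_bot h).elim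
  | top => exact (not_unitFree_top h).elim
  | vee A B => exact (two (unitFree_vee.1 h).1 (unitFree_vee.1 h).2 e).elim
  | wedge A B => exact (two (unitFree_wedge.1 h).1 (unitFree_wedge.1 h).2 e).elim

end UnitFree

/-- Some occurrences of `p` and `q` are joined by a disjunction. -/
def Disj (p q : P) : Formula P → Prop
  | letter _ => False
  | bot => False
  | top => False
  | wedge A B => A.Disj p q ∨ B.Disj p q
  | vee A B => A.Disj p q ∨ B.Disj p q ∨ (p ∈ A.letters ∧ q ∈ B.letters) ∨
      (q ∈ A.letters ∧ p ∈ B.letters)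

theorem eval_mono {v w : P → Bool} (h : ∀ p, v p → w p) (A : Formula P) :
    A.eval v → A.eval w := by
  induction A with
  | letter p => exact h p
  | bot => exact id
  | top => exact id
  | vee A B ihA ihB => simpa only [eval, Bool.or_eq_true] using Or.imp ihA ihB
  | wedge A B ihA ihB => simpa only [eval, Bool.and_eq_true] using And.imp ihA ihB

end Formula

/-- Arrows reflect these joins: into `(A ⋎ C) ⋏ (B ⋎ D)`, intermutation keeps only the joins of `A`
with `C` and of `B` with `D`, out of all those between `A ⋏ B` and `C ⋏ D`. -/
theorem disj_of_disj {A B : Formula P} {p q : P} (f : A ⟶ B) : B.Disj p q → A.Disj p q := by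
  obtain ⟨f, rfl⟩ := exists_arr f
  induction f with
  | one => exact id
  | comp f g hf hg => exact fun h => hf (hg h)
  | wedgeHom f g hf hg => exact Or.imp hf hg
  | veeHom f g hf hg =>
    simp only [Formula.Disj, f.letters_perm.mem_iff, g.letters_perm.mem_iff]
    tauto
  | _ => simp only [Formula.Disj, Formula.letters, List.mem_append, List.not_mem_nil]; tauto

/-! ### Isomorphism of a formula with its reduced form -/

theorem nonempty_iso_reduceVee (A B : Formula P) : Nonempty (A ⋎ B ≅ A.reduceVee B) := by
  unfold Formula.reduceVee
  split
  · exact ⟨asIso (arr (.deltaVeeHom _))⟩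
  · exact ⟨asIso (arr (.sigmaVeeHom _))⟩
  · exact ⟨asIso (arr .wTopHom)⟩
  · exact ⟨Iso.refl _⟩

theorem nonempty_iso_reduceWedge (A B : Formula P) : Nonempty (A ⋏ B ≅ A.reduceWedge B) := by
  unfold Formula.reduceWedge
  split
  · exact ⟨asIso (arr (.deltaWedgeHom _))⟩
  · exact ⟨asIso (arr (.sigmaWedgeHom _))⟩
  · exact ⟨asIso (arr .wBotHom)⟩
  · exact ⟨Iso.refl _⟩

/-- Each replacement made by `nu` is a unitor or one of the isomorphisms `w`. -/
theorem nonempty_iso_nu (A : Formula P) : Nonempty (A ≅ A.nu) := by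
  induction A with
  | letter p => exact ⟨Iso.refl _⟩
  | bot => exact ⟨Iso.refl _⟩
  | top => exact ⟨Iso.refl _⟩
  | vee A B ihA ihB =>
    obtain ⟨a⟩ := ihA
    obtain ⟨b⟩ := ihB
    obtain ⟨c⟩ := nonempty_iso_reduceVee A.nu B.nu
    exact ⟨asIso (a.hom ⋎ₘ b.hom) ≪≫ c⟩
  | wedge A B ihA ihB =>
    obtain ⟨a⟩ := ihA
    obtain ⟨b⟩ := ihB
    obtain ⟨c⟩ := nonempty_iso_reduceWedge A.nu B.nu
    exact ⟨asIso (a.hom ⋏ₘ b.hom) ≪≫ c⟩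

/-! ### Replacing the letters outside a set by a unit -/

namespace Formula

open Classical in
/-- The substitution that replaces the letters outside `S` by `D`. -/
noncomputable def keep (S : P → Prop) (D : Formula P) (p : P) : Formula P :=
  if S p then letter p else D

open Classical in
theorem letters_subst_keep (S : P → Prop) {D : Formula P} (hD : D.Letterless) (A : Formula P) :
    (A.subst (keep S D)).letters = A.letters.filter fun p => S p := by
  induction A with
  | letter p =>
    have hD' : D.letters = [] := hD
    by_cases h : S p <;> simp [subst, keep, letters, h, hD']
  | bot => rfl
  | top => rfl
  | vee A B ihA ihB => simp [subst, letters, ihA, ihB]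
  | wedge A B ihA ihB => simp [subst, letters, ihA, ihB]

theorem Diversified.subst_keep {A : Formula P} (h : A.Diversified) (S : P → Prop) {D : Formula P}
    (hD : D.Letterless) : (A.subst (keep S D)).Diversified := by
  rw [Diversified, letters_subst_keep S hD]
  exact List.Nodup.filter _ h

theorem length_letters_subst_keep_lt {A : Formula P} (S : P → Prop) {D : Formula P}
    (hD : D.Letterless) {p : P} (hp : p ∈ A.letters) (h : ¬ S p) :
    (A.subst (keep S D)).letters.length < A.letters.length := by
  rw [letters_subst_keep S hD, List.length_filter_lt_length_iff_exists]
  exact ⟨p, hp, by simpa using h⟩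

theorem letterless_subst_keep {A : Formula P} {S : P → Prop} {D : Formula P}
    (hD : D.Letterless) (h : ∀ p ∈ A.letters, ¬ S p) : (A.subst (keep S D)).Letterless := by
  rw [Letterless, letters_subst_keep S hD, List.filter_eq_nil_iff]
  simpa using h

theorem Conj.mem {p q : P} {A : Formula P} (h : A.Conj p q) : p ∈ A.letters ∧ q ∈ A.letters := by
  induction A with
  | letter p => exact h.elim
  | bot => exact h.elim
  | top => exact h.elim
  | vee A B ihA ihB =>
    simp only [letters, List.mem_append]
    rcases h with h | h
    · exact ⟨.inl (ihA h).1, .inl (ihA h).2⟩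
    · exact ⟨.inr (ihB h).1, .inr (ihB h).2⟩
  | wedge A B ihA ihB =>
    simp only [letters, List.mem_append]
    rcases h with h | h | h | h
    · exact ⟨.inl (ihA h).1, .inl (ihA h).2⟩
    · exact ⟨.inr (ihB h).1, .inr (ihB h).2⟩
    · exact ⟨.inl h.1, .inr h.2⟩
    · exact ⟨.inr h.2, .inl h.1⟩

theorem Disj.mem {p q : P} {A : Formula P} (h : A.Disj p q) : p ∈ A.letters ∧ q ∈ A.letters := by
  induction A with
  | letter p => exact h.elim
  | bot => exact h.elim
  | top => exact h.elim
  | wedge A B ihA ihB =>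
    simp only [letters, List.mem_append]
    rcases h with h | h
    · exact ⟨.inl (ihA h).1, .inl (ihA h).2⟩
    · exact ⟨.inr (ihB h).1, .inr (ihB h).2⟩
  | vee A B ihA ihB =>
    simp only [letters, List.mem_append]
    rcases h with h | h | h | h
    · exact ⟨.inl (ihA h).1, .inl (ihA h).2⟩
    · exact ⟨.inr (ihB h).1, .inr (ihB h).2⟩
    · exact ⟨.inl h.1, .inr h.2⟩
    · exact ⟨.inr h.2, .inl h.1⟩

/-! ## Restricting a formula along a conjunction -/

/-- In every disjunction inside the formula, both or neither of the components have a letter in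
`S`. -/
def VeeBalanced (S : P → Prop) : Formula P → Prop
  | letter _ => True
  | bot => True
  | top => True
  | wedge A B => A.VeeBalanced S ∧ B.VeeBalanced S
  | vee A B => A.VeeBalanced S ∧ B.VeeBalanced S ∧
      ((∃ p ∈ A.letters, S p) ↔ ∃ p ∈ B.letters, S p)

/-- In a unit-free formula both disjuncts contain letters, and here all of these lie on the same
side of `S`. -/
theorem veeBalanced_of_forall {S : P → Prop} {A : Formula P} (hA : A.UnitFree)
    (h : (∀ p ∈ A.letters, S p) ∨ ∀ p ∈ A.letters, ¬ S p) : A.VeeBalanced S := by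
  induction A with
  | letter p => trivial
  | bot => trivial
  | top => trivial
  | wedge A B ihA ihB =>
    simp only [letters, List.forall_mem_append] at h
    have hA := unitFree_wedge.1 hA
    exact ⟨ihA hA.1 (h.imp And.left And.left), ihB hA.2 (h.imp And.right And.right)⟩
  | vee A B ihA ihB =>
    simp only [letters, List.forall_mem_append] at h
    have hA := unitFree_vee.1 hA
    refine ⟨ihA hA.1 (h.imp And.left And.left), ihB hA.2 (h.imp And.right And.right), ?_⟩
    obtain ⟨a, ha⟩ := hA.1.exists_mem
    obtain ⟨b, hb⟩ := hA.2.exists_mem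
    rcases h with h | h
    · exact ⟨fun _ => ⟨b, hb, h.2 b hb⟩, fun _ => ⟨a, ha, h.1 a ha⟩⟩
    · exact ⟨fun ⟨p, hp, hS⟩ => (h.1 p hp hS).elim, fun ⟨p, hp, hS⟩ => (h.2 p hp hS).elim⟩

/-- Parts that miss `S` reduce to `⊤`, which a conjunction absorbs. A disjunction with a single
disjunct `⊤` would be stuck; balance leaves only `⊤ ∨ ⊤`. -/
theorem nu_subst_keep_top {S : P → Prop} {A : Formula P} (hA : A.UnitFree)
    (h : A.VeeBalanced S) :
    ((∃ p ∈ A.letters, S p) ∧ (A.subst (keep S ⊤')).nu.UnitFree) ∨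
      ((∀ p ∈ A.letters, ¬ S p) ∧ (A.subst (keep S ⊤')).nu = ⊤') := by
  induction A with
  | letter p =>
    by_cases hp : S p
    · left
      simpa [letters, subst, keep, hp, nu] using unitFree_letter p
    · right
      simp [letters, subst, keep, hp, nu]
  | bot => exact (not_unitFree_bot hA).elim
  | top => exact (not_unitFree_top hA).elim
  | wedge A B ihA ihB =>
    have hA := unitFree_wedge.1 hA
    simp only [letters, List.forall_mem_append, subst, nu]
    rcases ihA hA.1 h.1 with ⟨⟨p, hp, hS⟩, uA⟩ | ⟨nA, eA⟩
    · refine .inl ⟨⟨p, List.mem_append_left _ hp, hS⟩, ?_⟩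
      rcases ihB hA.2 h.2 with ⟨-, uB⟩ | ⟨-, eB⟩
      · exact uA.reduceWedge uB
      · rwa [eB, reduceWedge_top]
    · rw [eA, top_reduceWedge]
      rcases ihB hA.2 h.2 with ⟨⟨p, hp, hS⟩, uB⟩ | ⟨nB, eB⟩
      · exact .inl ⟨⟨p, List.mem_append_right _ hp, hS⟩, uB⟩
      · exact .inr ⟨⟨nA, nB⟩, eB⟩
  | vee A B ihA ihB =>
    have hA := unitFree_vee.1 hA
    simp only [letters, List.forall_mem_append, subst, nu]
    rcases ihA hA.1 h.1 with ⟨⟨p, hp, hS⟩, uA⟩ | ⟨nA, eA⟩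
    · refine .inl ⟨⟨p, List.mem_append_left _ hp, hS⟩, ?_⟩
      rcases ihB hA.2 h.2.1 with ⟨-, uB⟩ | ⟨nB, -⟩
      · exact uA.reduceVee uB
      · obtain ⟨q, hq, hS'⟩ := h.2.2.1 ⟨p, hp, hS⟩
        exact (nB q hq hS').elim
    · rcases ihB hA.2 h.2.1 with ⟨hB, -⟩ | ⟨nB, eB⟩
      · obtain ⟨q, hq, hS'⟩ := h.2.2.2 hB
        exact (nA q hq hS').elim
      · exact .inr ⟨⟨nA, nB⟩, by rw [eA, eB]; rfl⟩

theorem pure_subst_keep_top {S : P → Prop} {A : Formula P} (hA : A.UnitFree)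
    (h : A.VeeBalanced S) (hS : ∃ p ∈ A.letters, S p) : (A.subst (keep S ⊤')).Pure := by
  rcases nu_subst_keep_top hA h with h | h
  · exact h.2
  · obtain ⟨p, hp, hS⟩ := hS
    exact (h.1 p hp hS).elim

theorem eval_eq_true_of_forall {v : P → Bool} {A : Formula P} (hA : A.UnitFree)
    (h : ∀ p ∈ A.letters, v p = true) : A.eval v = true := by
  induction A with
  | letter p => exact h p (List.mem_singleton_self p)
  | bot => exact (not_unitFree_bot hA).elim
  | top => exact (not_unitFree_top hA).elim
  | vee A B ihA ihB =>
    simp only [letters, List.forall_mem_append] at h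
    rw [eval, ihA (unitFree_vee.1 hA).1 h.1, ihB (unitFree_vee.1 hA).2 h.2]
    rfl
  | wedge A B ihA ihB =>
    simp only [letters, List.forall_mem_append] at h
    rw [eval, ihA (unitFree_wedge.1 hA).1 h.1, ihB (unitFree_wedge.1 hA).2 h.2]
    rfl

theorem eval_subst_keep_top {S : P → Prop} {A : Formula P} (v : P → Bool) (hA : A.UnitFree)
    (h : ∀ p ∈ A.letters, ¬ S p) : (A.subst (keep S ⊤')).eval v = true := by
  -- Substituting before evaluation is the same as changing the valuation.
  have key : ∀ A : Formula P,
      (A.subst (keep S ⊤')).eval v = A.eval fun p => (keep S ⊤' p).eval v := by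
    intro A
    induction A with
    | letter p => rfl
    | bot => rfl
    | top => rfl
    | vee A B ihA ihB => simp only [subst, eval, ihA, ihB]
    | wedge A B ihA ihB => simp only [subst, eval, ihA, ihB]
  rw [key]
  exact eval_eq_true_of_forall hA fun p hp => by rw [keep, if_neg (h p hp)]; rfl

/-- Take `x` in `S` from the disjunct of an unbalanced disjunction that meets `S`. The other
disjunct misses `S`, so it has no false letter and is true. Truth climbs to the root: a false letter
in a conjunct met on the way would be joined to the false letter `x` by a conjunction. -/
theorem exists_of_not_veeBalanced {S : P → Prop} {A : Formula P} (hA : A.UnitFree)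
    (h : ¬ A.VeeBalanced S) :
    ∃ x ∈ A.letters, S x ∧ ∀ v : P → Bool, v x = false →
      (∀ p ∈ A.letters, v p = false → S p) →
      (∀ p q, v p = false → v q = false → ¬ A.Conj p q) → A.eval v = true := by
  induction A with
  | letter p => exact (h trivial).elim
  | bot => exact (h trivial).elim
  | top => exact (h trivial).elim
  | wedge A B ihA ihB =>
    have hA := unitFree_wedge.1 hA
    by_cases hb : A.VeeBalanced S
    · obtain ⟨x, hx, hS, H⟩ := ihB hA.2 fun h' => h ⟨hb, h'⟩
      refine ⟨x, List.mem_append_right _ hx, hS, fun v hv hvS hvC => ?_⟩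
      have e := H v hv (fun p hp => hvS p (List.mem_append_right _ hp))
        fun p q hp hq hC => hvC p q hp hq (.inr (.inl hC))
      have e' : A.eval v = true := eval_eq_true_of_forall hA.1 fun p hp => by
        by_contra hp'
        exact hvC p x (by simpa using hp') hv (.inr (.inr (.inl ⟨hp, hx⟩)))
      rw [eval, e, e']
      rfl
    · obtain ⟨x, hx, hS, H⟩ := ihA hA.1 hb
      refine ⟨x, List.mem_append_left _ hx, hS, fun v hv hvS hvC => ?_⟩
      have e := H v hv (fun p hp => hvS p (List.mem_append_left _ hp))
        fun p q hp hq hC => hvC p q hp hq (.inl hC)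
      have e' : B.eval v = true := eval_eq_true_of_forall hA.2 fun p hp => by
        by_contra hp'
        exact hvC x p hv (by simpa using hp') (.inr (.inr (.inl ⟨hx, hp⟩)))
      rw [eval, e, e']
      rfl
  | vee A B ihA ihB =>
    have hA := unitFree_vee.1 hA
    have of_left : ∀ v : P → Bool, A.eval v = true → (A ⋎ B).eval v = true := by
      intro v e
      rw [eval, e]
      simp
    have of_right : ∀ v : P → Bool, B.eval v = true → (A ⋎ B).eval v = true := by
      intro v e
      rw [eval, e]
      simp
    by_cases hb : A.VeeBalanced S
    · by_cases hb' : B.VeeBalanced S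
      · have hn : ¬ ((∃ p ∈ A.letters, S p) ↔ ∃ p ∈ B.letters, S p) := fun h' => h ⟨hb, hb', h'⟩
        by_cases hex : ∃ p ∈ A.letters, S p
        · have hB : ∀ p ∈ B.letters, ¬ S p := fun p hp hS =>
            hn ⟨fun _ => ⟨p, hp, hS⟩, fun _ => hex⟩
          obtain ⟨x, hx, hS⟩ := hex
          refine ⟨x, List.mem_append_left _ hx, hS, fun v hv hvS _ => of_right v ?_⟩
          refine eval_eq_true_of_forall hA.2 fun p hp => ?_
          by_contra hp'
          exact hB p hp (hvS p (List.mem_append_right _ hp) (by simpa using hp'))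
        · obtain ⟨x, hx, hS⟩ : ∃ p ∈ B.letters, S p := by
            by_contra hex'
            exact hn ⟨fun h => (hex h).elim, fun h => (hex' h).elim⟩
          refine ⟨x, List.mem_append_right _ hx, hS, fun v hv hvS _ => of_left v ?_⟩
          refine eval_eq_true_of_forall hA.1 fun p hp => ?_
          by_contra hp'
          exact hex ⟨p, hp, hvS p (List.mem_append_left _ hp) (by simpa using hp')⟩
      · obtain ⟨x, hx, hS, H⟩ := ihB hA.2 hb'
        exact ⟨x, List.mem_append_right _ hx, hS, fun v hv hvS hvC => of_right v <|
          H v hv (fun p hp => hvS p (List.mem_append_right _ hp))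
            fun p q hp hq hC => hvC p q hp hq (.inr hC)⟩
    · obtain ⟨x, hx, hS, H⟩ := ihA hA.1 hb
      exact ⟨x, List.mem_append_left _ hx, hS, fun v hv hvS hvC => of_left v <|
        H v hv (fun p hp => hvS p (List.mem_append_left _ hp))
          fun p q hp hq hC => hvC p q hp hq (.inl hC)⟩

open Classical in
-- Falsify both disjuncts of a disjunction but only one conjunct of a conjunction, chosen to contain
-- `x`. Since letters do not repeat, the choices made in different components do not interfere.
theorem exists_eval_eq_false {A : Formula P} (hA : A.UnitFree) (hd : A.Diversified) {x : P}
    (hx : x ∈ A.letters) :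
    ∃ v : P → Bool, v x = false ∧ (∀ p, v p = false → p ∈ A.letters) ∧
      (∀ p q, v p = false → v q = false → ¬ A.Conj p q) ∧ A.eval v = false := by
  induction A generalizing x with
  | letter p =>
    obtain rfl := List.mem_singleton.1 hx
    exact ⟨fun q => decide (q ≠ x), by simp, by simp [letters], fun _ _ _ _ => id, by simp [eval]⟩
  | bot => exact (not_unitFree_bot hA).elim
  | top => exact (not_unitFree_top hA).elim
  | wedge A B ihA ihB =>
    have hA := unitFree_wedge.1 hA
    obtain ⟨dA, dB, dAB⟩ := List.nodup_append'.1 hd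
    rcases List.mem_append.1 hx with hx | hx
    · obtain ⟨v, h₁, h₂, h₃, h₄⟩ := ihA hA.1 dA hx
      refine ⟨v, h₁, fun p hp => List.mem_append_left _ (h₂ p hp), ?_, by rw [eval, h₄]; simp⟩
      rintro p q hp hq (h | h | h | h)
      · exact h₃ p q hp hq h
      · exact dAB (h₂ p hp) h.mem.1
      · exact dAB (h₂ q hq) h.2
      · exact dAB (h₂ p hp) h.2
    · obtain ⟨v, h₁, h₂, h₃, h₄⟩ := ihB hA.2 dB hx
      refine ⟨v, h₁, fun p hp => List.mem_append_right _ (h₂ p hp), ?_, by rw [eval, h₄]; simp⟩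
      rintro p q hp hq (h | h | h | h)
      · exact dAB h.mem.1 (h₂ p hp)
      · exact h₃ p q hp hq h
      · exact dAB h.1 (h₂ p hp)
      · exact dAB h.1 (h₂ q hq)
  | vee A B ihA ihB =>
    have hA := unitFree_vee.1 hA
    obtain ⟨dA, dB, dAB⟩ := List.nodup_append'.1 hd
    -- The union of the two sets of false letters works for the disjunction.
    have key : ∀ v w : P → Bool, (∀ p, v p = false → p ∈ A.letters) →
        (∀ p q, v p = false → v q = false → ¬ A.Conj p q) → A.eval v = false →
        (∀ p, w p = false → p ∈ B.letters) →
        (∀ p q, w p = false → w q = false → ¬ B.Conj p q) → B.eval w = false →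
        (∀ p, (v p && w p) = false → p ∈ (A ⋎ B).letters) ∧
        (∀ p q, (v p && w p) = false → (v q && w q) = false → ¬ (A ⋎ B).Conj p q) ∧
        (A ⋎ B).eval (fun p => v p && w p) = false := by
      intro v w hv hvC hvE hw hwC hwE
      have hor : ∀ p, (v p && w p) = false → v p = false ∨ w p = false :=
        fun p hp => Bool.and_eq_false_iff.1 hp
      refine ⟨fun p hp => List.mem_append.2 ((hor p hp).imp (hv p) (hw p)), ?_, ?_⟩
      · rintro p q hp hq (h | h)
        · exact hvC p q ((hor p hp).resolve_right fun h' => dAB h.mem.1 (hw p h'))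
            ((hor q hq).resolve_right fun h' => dAB h.mem.2 (hw q h')) h
        · exact hwC p q ((hor p hp).resolve_left fun h' => dAB (hv p h') h.mem.1)
            ((hor q hq).resolve_left fun h' => dAB (hv q h') h.mem.2) h
      · have eA : A.eval (fun p => v p && w p) = false := by
          rw [← Bool.not_eq_true] at hvE ⊢
          exact fun h => hvE (eval_mono (fun p hp => (Bool.and_eq_true_iff.1 hp).1) A h)
        have eB : B.eval (fun p => v p && w p) = false := by
          rw [← Bool.not_eq_true] at hwE ⊢
          exact fun h => hwE (eval_mono (fun p hp => (Bool.and_eq_true_iff.1 hp).2) B h)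
        rw [eval, eA, eB]
        rfl
    rcases List.mem_append.1 hx with hx | hx
    -- The other disjunct has to be falsified too, starting from an arbitrary letter of it.
    · obtain ⟨y, hy⟩ := hA.2.exists_mem
      obtain ⟨v, h₁, h₂, h₃, h₄⟩ := ihA hA.1 dA hx
      obtain ⟨w, -, k₂, k₃, k₄⟩ := ihB hA.2 dB hy
      exact ⟨fun p => v p && w p, by simp [h₁], key v w h₂ h₃ h₄ k₂ k₃ k₄⟩
    · obtain ⟨y, hy⟩ := hA.1.exists_mem
      obtain ⟨v, -, h₂, h₃, h₄⟩ := ihA hA.1 dA hy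
      obtain ⟨w, k₁, k₂, k₃, k₄⟩ := ihB hA.2 dB hx
      exact ⟨fun p => v p && w p, by simp [k₁], key v w h₂ h₃ h₄ k₂ k₃ k₄⟩

/-! ## Restricting a formula along a disjunction -/

/-- In every conjunction inside the formula, both or neither of the components have a letter in
`S`. -/
def WedgeBalanced (S : P → Prop) : Formula P → Prop
  | letter _ => True
  | bot => True
  | top => True
  | vee A B => A.WedgeBalanced S ∧ B.WedgeBalanced S
  | wedge A B => A.WedgeBalanced S ∧ B.WedgeBalanced S ∧
      ((∃ p ∈ A.letters, S p) ↔ ∃ p ∈ B.letters, S p)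

theorem wedgeBalanced_of_forall {S : P → Prop} {A : Formula P} (hA : A.UnitFree)
    (h : (∀ p ∈ A.letters, S p) ∨ ∀ p ∈ A.letters, ¬ S p) : A.WedgeBalanced S := by
  induction A with
  | letter p => trivial
  | bot => trivial
  | top => trivial
  | vee A B ihA ihB =>
    simp only [letters, List.forall_mem_append] at h
    have hA := unitFree_vee.1 hA
    exact ⟨ihA hA.1 (h.imp And.left And.left), ihB hA.2 (h.imp And.right And.right)⟩
  | wedge A B ihA ihB =>
    simp only [letters, List.forall_mem_append] at h
    have hA := unitFree_wedge.1 hA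
    refine ⟨ihA hA.1 (h.imp And.left And.left), ihB hA.2 (h.imp And.right And.right), ?_⟩
    obtain ⟨a, ha⟩ := hA.1.exists_mem
    obtain ⟨b, hb⟩ := hA.2.exists_mem
    rcases h with h | h
    · exact ⟨fun _ => ⟨b, hb, h.2 b hb⟩, fun _ => ⟨a, ha, h.1 a ha⟩⟩
    · exact ⟨fun ⟨p, hp, hS⟩ => (h.1 p hp hS).elim, fun ⟨p, hp, hS⟩ => (h.2 p hp hS).elim⟩

/-- Dually, disjunctions absorb `⊥`, and balance excludes a conjunction with a single conjunct `⊥`.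
-/
theorem nu_subst_keep_bot {S : P → Prop} {A : Formula P} (hA : A.UnitFree)
    (h : A.WedgeBalanced S) :
    ((∃ p ∈ A.letters, S p) ∧ (A.subst (keep S ⊥')).nu.UnitFree) ∨
      ((∀ p ∈ A.letters, ¬ S p) ∧ (A.subst (keep S ⊥')).nu = ⊥') := by
  induction A with
  | letter p =>
    by_cases hp : S p
    · left
      simpa [letters, subst, keep, hp, nu] using unitFree_letter p
    · right
      simp [letters, subst, keep, hp, nu]
  | bot => exact (not_unitFree_bot hA).elim
  | top => exact (not_unitFree_top hA).elim
  | vee A B ihA ihB =>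
    have hA := unitFree_vee.1 hA
    simp only [letters, List.forall_mem_append, subst, nu]
    rcases ihA hA.1 h.1 with ⟨⟨p, hp, hS⟩, uA⟩ | ⟨nA, eA⟩
    · refine .inl ⟨⟨p, List.mem_append_left _ hp, hS⟩, ?_⟩
      rcases ihB hA.2 h.2 with ⟨-, uB⟩ | ⟨-, eB⟩
      · exact uA.reduceVee uB
      · rwa [eB, reduceVee_bot]
    · rw [eA, bot_reduceVee]
      rcases ihB hA.2 h.2 with ⟨⟨p, hp, hS⟩, uB⟩ | ⟨nB, eB⟩
      · exact .inl ⟨⟨p, List.mem_append_right _ hp, hS⟩, uB⟩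
      · exact .inr ⟨⟨nA, nB⟩, eB⟩
  | wedge A B ihA ihB =>
    have hA := unitFree_wedge.1 hA
    simp only [letters, List.forall_mem_append, subst, nu]
    rcases ihA hA.1 h.1 with ⟨⟨p, hp, hS⟩, uA⟩ | ⟨nA, eA⟩
    · refine .inl ⟨⟨p, List.mem_append_left _ hp, hS⟩, ?_⟩
      rcases ihB hA.2 h.2.1 with ⟨-, uB⟩ | ⟨nB, -⟩
      · exact uA.reduceWedge uB
      · obtain ⟨q, hq, hS'⟩ := h.2.2.1 ⟨p, hp, hS⟩
        exact (nB q hq hS').elim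
    · rcases ihB hA.2 h.2.1 with ⟨hB, -⟩ | ⟨nB, eB⟩
      · obtain ⟨q, hq, hS'⟩ := h.2.2.2 hB
        exact (nA q hq hS').elim
      · exact .inr ⟨⟨nA, nB⟩, by rw [eA, eB]; rfl⟩

theorem pure_subst_keep_bot {S : P → Prop} {A : Formula P} (hA : A.UnitFree)
    (h : A.WedgeBalanced S) (hS : ∃ p ∈ A.letters, S p) : (A.subst (keep S ⊥')).Pure := by
  rcases nu_subst_keep_bot hA h with h | h
  · exact h.2
  · obtain ⟨p, hp, hS⟩ := hS
    exact (h.1 p hp hS).elim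

theorem eval_eq_false_of_forall {v : P → Bool} {A : Formula P} (hA : A.UnitFree)
    (h : ∀ p ∈ A.letters, v p = false) : A.eval v = false := by
  induction A with
  | letter p => exact h p (List.mem_singleton_self p)
  | bot => exact (not_unitFree_bot hA).elim
  | top => exact (not_unitFree_top hA).elim
  | vee A B ihA ihB =>
    simp only [letters, List.forall_mem_append] at h
    rw [eval, ihA (unitFree_vee.1 hA).1 h.1, ihB (unitFree_vee.1 hA).2 h.2]
    rfl
  | wedge A B ihA ihB =>
    simp only [letters, List.forall_mem_append] at h
    rw [eval, ihA (unitFree_wedge.1 hA).1 h.1, ihB (unitFree_wedge.1 hA).2 h.2]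
    rfl

theorem eval_subst_keep_bot {S : P → Prop} {A : Formula P} (v : P → Bool) (hA : A.UnitFree)
    (h : ∀ p ∈ A.letters, ¬ S p) : (A.subst (keep S ⊥')).eval v = false := by
  have key : ∀ A : Formula P,
      (A.subst (keep S ⊥')).eval v = A.eval fun p => (keep S ⊥' p).eval v := by
    intro A
    induction A with
    | letter p => rfl
    | bot => rfl
    | top => rfl
    | vee A B ihA ihB => simp only [subst, eval, ihA, ihB]
    | wedge A B ihA ihB => simp only [subst, eval, ihA, ihB]
  rw [key]
  exact eval_eq_false_of_forall hA fun p hp => by rw [keep, if_neg (h p hp)]; rfl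

/-- Dually, the conjunct that misses `S` is false, and falsity climbs: a true letter in a disjunct
met on the way would be joined to `x` by a disjunction. -/
theorem exists_of_not_wedgeBalanced {S : P → Prop} {A : Formula P} (hA : A.UnitFree)
    (h : ¬ A.WedgeBalanced S) :
    ∃ x ∈ A.letters, S x ∧ ∀ v : P → Bool, v x = true →
      (∀ p ∈ A.letters, v p = true → S p) →
      (∀ p q, v p = true → v q = true → ¬ A.Disj p q) → A.eval v = false := by
  induction A with
  | letter p => exact (h trivial).elim
  | bot => exact (h trivial).elim
  | top => exact (h trivial).elim
  | vee A B ihA ihB =>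
    have hA := unitFree_vee.1 hA
    by_cases hb : A.WedgeBalanced S
    · obtain ⟨x, hx, hS, H⟩ := ihB hA.2 fun h' => h ⟨hb, h'⟩
      refine ⟨x, List.mem_append_right _ hx, hS, fun v hv hvS hvC => ?_⟩
      have e := H v hv (fun p hp => hvS p (List.mem_append_right _ hp))
        fun p q hp hq hC => hvC p q hp hq (.inr (.inl hC))
      have e' : A.eval v = false := eval_eq_false_of_forall hA.1 fun p hp => by
        by_contra hp'
        exact hvC p x (by simpa using hp') hv (.inr (.inr (.inl ⟨hp, hx⟩)))
      rw [eval, e, e']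
      rfl
    · obtain ⟨x, hx, hS, H⟩ := ihA hA.1 hb
      refine ⟨x, List.mem_append_left _ hx, hS, fun v hv hvS hvC => ?_⟩
      have e := H v hv (fun p hp => hvS p (List.mem_append_left _ hp))
        fun p q hp hq hC => hvC p q hp hq (.inl hC)
      have e' : B.eval v = false := eval_eq_false_of_forall hA.2 fun p hp => by
        by_contra hp'
        exact hvC x p hv (by simpa using hp') (.inr (.inr (.inl ⟨hx, hp⟩)))
      rw [eval, e, e']
      rfl
  | wedge A B ihA ihB =>
    have hA := unitFree_wedge.1 hA
    have of_left : ∀ v : P → Bool, A.eval v = false → (A ⋏ B).eval v = false := by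
      intro v e
      rw [eval, e]
      simp
    have of_right : ∀ v : P → Bool, B.eval v = false → (A ⋏ B).eval v = false := by
      intro v e
      rw [eval, e]
      simp
    by_cases hb : A.WedgeBalanced S
    · by_cases hb' : B.WedgeBalanced S
      · have hn : ¬ ((∃ p ∈ A.letters, S p) ↔ ∃ p ∈ B.letters, S p) := fun h' => h ⟨hb, hb', h'⟩
        by_cases hex : ∃ p ∈ A.letters, S p
        · have hB : ∀ p ∈ B.letters, ¬ S p := fun p hp hS =>
            hn ⟨fun _ => ⟨p, hp, hS⟩, fun _ => hex⟩
          obtain ⟨x, hx, hS⟩ := hex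
          refine ⟨x, List.mem_append_left _ hx, hS, fun v hv hvS _ => of_right v ?_⟩
          refine eval_eq_false_of_forall hA.2 fun p hp => ?_
          by_contra hp'
          exact hB p hp (hvS p (List.mem_append_right _ hp) (by simpa using hp'))
        · obtain ⟨x, hx, hS⟩ : ∃ p ∈ B.letters, S p := by
            by_contra hex'
            exact hn ⟨fun h => (hex h).elim, fun h => (hex' h).elim⟩
          refine ⟨x, List.mem_append_right _ hx, hS, fun v hv hvS _ => of_left v ?_⟩
          refine eval_eq_false_of_forall hA.1 fun p hp => ?_
          by_contra hp'
          exact hex ⟨p, hp, hvS p (List.mem_append_left _ hp) (by simpa using hp')⟩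
      · obtain ⟨x, hx, hS, H⟩ := ihB hA.2 hb'
        exact ⟨x, List.mem_append_right _ hx, hS, fun v hv hvS hvC => of_right v <|
          H v hv (fun p hp => hvS p (List.mem_append_right _ hp))
            fun p q hp hq hC => hvC p q hp hq (.inr hC)⟩
    · obtain ⟨x, hx, hS, H⟩ := ihA hA.1 hb
      exact ⟨x, List.mem_append_left _ hx, hS, fun v hv hvS hvC => of_left v <|
        H v hv (fun p hp => hvS p (List.mem_append_left _ hp))
          fun p q hp hq hC => hvC p q hp hq (.inl hC)⟩

open Classical in
-- Dually, verify both conjuncts of a conjunction but only one disjunct of a disjunction.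
theorem exists_eval_eq_true {A : Formula P} (hA : A.UnitFree) (hd : A.Diversified) {x : P}
    (hx : x ∈ A.letters) :
    ∃ v : P → Bool, v x = true ∧ (∀ p, v p = true → p ∈ A.letters) ∧
      (∀ p q, v p = true → v q = true → ¬ A.Disj p q) ∧ A.eval v = true := by
  induction A generalizing x with
  | letter p =>
    obtain rfl := List.mem_singleton.1 hx
    exact ⟨fun q => decide (q = x), by simp, by simp [letters], fun _ _ _ _ => id, by simp [eval]⟩
  | bot => exact (not_unitFree_bot hA).elim
  | top => exact (not_unitFree_top hA).elim
  | vee A B ihA ihB =>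
    have hA := unitFree_vee.1 hA
    obtain ⟨dA, dB, dAB⟩ := List.nodup_append'.1 hd
    rcases List.mem_append.1 hx with hx | hx
    · obtain ⟨v, h₁, h₂, h₃, h₄⟩ := ihA hA.1 dA hx
      refine ⟨v, h₁, fun p hp => List.mem_append_left _ (h₂ p hp), ?_, by rw [eval, h₄]; simp⟩
      rintro p q hp hq (h | h | h | h)
      · exact h₃ p q hp hq h
      · exact dAB (h₂ p hp) h.mem.1
      · exact dAB (h₂ q hq) h.2
      · exact dAB (h₂ p hp) h.2
    · obtain ⟨v, h₁, h₂, h₃, h₄⟩ := ihB hA.2 dB hx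
      refine ⟨v, h₁, fun p hp => List.mem_append_right _ (h₂ p hp), ?_, by rw [eval, h₄]; simp⟩
      rintro p q hp hq (h | h | h | h)
      · exact dAB h.mem.1 (h₂ p hp)
      · exact h₃ p q hp hq h
      · exact dAB h.1 (h₂ p hp)
      · exact dAB h.1 (h₂ q hq)
  | wedge A B ihA ihB =>
    have hA := unitFree_wedge.1 hA
    obtain ⟨dA, dB, dAB⟩ := List.nodup_append'.1 hd
    have key : ∀ v w : P → Bool, (∀ p, v p = true → p ∈ A.letters) →
        (∀ p q, v p = true → v q = true → ¬ A.Disj p q) → A.eval v = true →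
        (∀ p, w p = true → p ∈ B.letters) →
        (∀ p q, w p = true → w q = true → ¬ B.Disj p q) → B.eval w = true →
        (∀ p, (v p || w p) = true → p ∈ (A ⋏ B).letters) ∧
        (∀ p q, (v p || w p) = true → (v q || w q) = true → ¬ (A ⋏ B).Disj p q) ∧
        (A ⋏ B).eval (fun p => v p || w p) = true := by
      intro v w hv hvC hvE hw hwC hwE
      have hor : ∀ p, (v p || w p) = true → v p = true ∨ w p = true :=
        fun p hp => Bool.or_eq_true_iff.1 hp
      refine ⟨fun p hp => List.mem_append.2 ((hor p hp).imp (hv p) (hw p)), ?_, ?_⟩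
      · rintro p q hp hq (h | h)
        · exact hvC p q ((hor p hp).resolve_right fun h' => dAB h.mem.1 (hw p h'))
            ((hor q hq).resolve_right fun h' => dAB h.mem.2 (hw q h')) h
        · exact hwC p q ((hor p hp).resolve_left fun h' => dAB (hv p h') h.mem.1)
            ((hor q hq).resolve_left fun h' => dAB (hv q h') h.mem.2) h
      · have eA : A.eval (fun p => v p || w p) = true :=
          eval_mono (fun p hp => Bool.or_eq_true_iff.2 (.inl hp)) A hvE
        have eB : B.eval (fun p => v p || w p) = true :=
          eval_mono (fun p hp => Bool.or_eq_true_iff.2 (.inr hp)) B hwE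
        rw [eval, eA, eB]
        rfl
    rcases List.mem_append.1 hx with hx | hx
    · obtain ⟨y, hy⟩ := hA.2.exists_mem
      obtain ⟨v, h₁, h₂, h₃, h₄⟩ := ihA hA.1 dA hx
      obtain ⟨w, -, k₂, k₃, k₄⟩ := ihB hA.2 dB hy
      exact ⟨fun p => v p || w p, by simp [h₁], key v w h₂ h₃ h₄ k₂ k₃ k₄⟩
    · obtain ⟨y, hy⟩ := hA.1.exists_mem
      obtain ⟨v, -, h₂, h₃, h₄⟩ := ihA hA.1 dA hy
      obtain ⟨w, k₁, k₂, k₃, k₄⟩ := ihB hA.2 dB hx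
      exact ⟨fun p => v p || w p, by simp [k₁], key v w h₂ h₃ h₄ k₂ k₃ k₄⟩

end Formula

/-! ### Balance forced by the existence of an arrow -/

namespace Formula

/-- Lack of balance singles out a letter `x` of `S`, which must lie in `B₂`. Falsify `B₂` by letters
including `x`, no two of them joined by a conjunction. By `conj_of_conj` they are not joined in `A`
either, so `A` is true, contrary to `eval_le`. -/
theorem veeBalanced_of_hom {A B₁ B₂ : Formula P} (f : A ⟶ B₁ ⋏ B₂)
    (hA : A.UnitFree) (h₂ : B₂.UnitFree) (hd : (B₁ ⋏ B₂).Diversified) {S : P → Prop}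
    (hS₁ : ∀ p ∈ B₁.letters, ¬ S p) (hS₂ : ∀ p ∈ B₂.letters, S p) : A.VeeBalanced S := by
  by_contra h
  obtain ⟨x, hx, hS, H⟩ := exists_of_not_veeBalanced hA h
  obtain ⟨-, d₂, d⟩ := List.nodup_append'.1 hd
  have hx' : x ∈ B₂.letters := (List.mem_append.1 ((letters_perm f).mem_iff.1 hx)).resolve_left
    fun h => hS₁ x h hS
  obtain ⟨v, hv, hvm, hvC, hve⟩ := exists_eval_eq_false h₂ d₂ hx'
  have e : A.eval v = true := H v hv (fun p _ hp => hS₂ p (hvm p hp)) fun p q hp hq hC => by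
    -- All false letters lie in `B₂`, so joins that involve `B₁` are impossible.
    rcases conj_of_conj f hC with h | h | h | h
    · exact d h.mem.1 (hvm p hp)
    · exact hvC p q hp hq h
    · exact d h.1 (hvm p hp)
    · exact d h.1 (hvm q hq)
  have := eval_le v f e
  rw [eval, hve, Bool.and_false] at this
  exact Bool.noConfusion this

/-- Dually, `disj_of_disj` carries unjoined true letters of `B₂` forward to `A`, which would then be
false although the source is true. -/
theorem wedgeBalanced_of_hom {A B₁ B₂ : Formula P} (f : B₁ ⋎ B₂ ⟶ A)
    (hA : A.UnitFree) (h₂ : B₂.UnitFree) (hd : (B₁ ⋎ B₂).Diversified) {S : P → Prop}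
    (hS₁ : ∀ p ∈ B₁.letters, ¬ S p) (hS₂ : ∀ p ∈ B₂.letters, S p) : A.WedgeBalanced S := by
  by_contra h
  obtain ⟨x, hx, hS, H⟩ := exists_of_not_wedgeBalanced hA h
  obtain ⟨-, d₂, d⟩ := List.nodup_append'.1 hd
  have hx' : x ∈ B₂.letters := (List.mem_append.1 ((letters_perm f).mem_iff.2 hx)).resolve_left
    fun h => hS₁ x h hS
  obtain ⟨v, hv, hvm, hvC, hve⟩ := exists_eval_eq_true h₂ d₂ hx'
  have e : A.eval v = false := H v hv (fun p _ hp => hS₂ p (hvm p hp)) fun p q hp hq hC => by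
    rcases disj_of_disj f hC with h | h | h | h
    · exact d h.mem.1 (hvm p hp)
    · exact hvC p q hp hq h
    · exact d h.1 (hvm p hp)
    · exact d h.1 (hvm q hq)
  have := eval_le v f (by rw [eval, hve, Bool.or_true])
  rw [e] at this
  exact Bool.noConfusion this

end Formula

open Formula

/-! ## Invertible instances of the intermutation -/

section IsIso

variable {A B C D : Formula P} {v : P → Bool}

/-- Since `B` and `D` are isomorphic to `⊤`, naturality reduces this to `ck_top`, a composite of
isomorphisms. -/
theorem isIso_ck_of_eval_eq_true_right (hB : B.Letterless) (hD : D.Letterless)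
    (eB : B.eval v = true) (eD : D.eval v = true) : IsIso (arr (.ck A B C D)) := by
  have := isIso_toTop hB eB
  have := isIso_toTop hD eD
  have h := ck_natural (𝟙 A) (toTop B hB) (𝟙 C) (toTop D hD)
  rw [ck_top] at h
  have : IsIso (arr (.ck A B C D) ≫ ((𝟙 A ⋎ₘ 𝟙 C) ⋏ₘ (toTop B hB ⋎ₘ toTop D hD))) := by
    rw [← h]
    infer_instance
  exact IsIso.of_isIso_comp_right _ ((𝟙 A ⋎ₘ 𝟙 C) ⋏ₘ (toTop B hB ⋎ₘ toTop D hD))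

theorem isIso_ck_of_eval_eq_true_left (hA : A.Letterless) (hC : C.Letterless)
    (eA : A.eval v = true) (eC : C.eval v = true) : IsIso (arr (.ck A B C D)) := by
  have := isIso_ck_of_eval_eq_true_right (A := B) (C := D) hA hC eA eC
  have : IsIso (arr (.ck A B C D) ≫ arr (.cWedge (A ⋎ C) (B ⋎ D))) := by
    rw [ck_cWedge]
    infer_instance
  exact IsIso.of_isIso_comp_right _ (arr (.cWedge (A ⋎ C) (B ⋎ D)))

/-- Since `C` and `D` are isomorphic to `⊥`, naturality reduces this to `ck_bot`. -/
theorem isIso_ck_of_eval_eq_false_right (hC : C.Letterless) (hD : D.Letterless)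
    (eC : C.eval v = false) (eD : D.eval v = false) : IsIso (arr (.ck A B C D)) := by
  have := isIso_fromBot hC eC
  have := isIso_fromBot hD eD
  have h := ck_natural (𝟙 A) (𝟙 B) (fromBot C hC) (fromBot D hD)
  rw [ck_bot] at h
  have : IsIso (((𝟙 A ⋏ₘ 𝟙 B) ⋎ₘ (fromBot C hC ⋏ₘ fromBot D hD)) ≫ arr (.ck A B C D)) := by
    rw [h]
    infer_instance
  exact IsIso.of_isIso_comp_left ((𝟙 A ⋏ₘ 𝟙 B) ⋎ₘ (fromBot C hC ⋏ₘ fromBot D hD)) _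

theorem isIso_ck_of_eval_eq_false_left (hA : A.Letterless) (hB : B.Letterless)
    (eA : A.eval v = false) (eB : B.eval v = false) : IsIso (arr (.ck A B C D)) := by
  have := isIso_ck_of_eval_eq_false_right (A := C) (B := D) hA hB eA eB
  have : IsIso (arr (.cVee (C ⋏ D) (A ⋏ B)) ≫ arr (.ck A B C D)) := by
    rw [cVee_ck]
    infer_instance
  exact IsIso.of_isIso_comp_left (arr (.cVee (C ⋏ D) (A ⋏ B))) _

end IsIso

/-! ## Arrows into a conjunction -/

theorem exists_isIso_splitLetter (S : P → Prop) (p : P) :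
    ∃ s : letter p ⟶ keep S ⊤' p ⋏ keep (fun q => ¬ S q) ⊤' p, IsIso s := by
  by_cases h : S p
  · rw [keep, keep, if_pos h, if_neg (not_not_intro h)]
    exact ⟨arr (.deltaWedgeInv _), inferInstance⟩
  · rw [keep, keep, if_neg h, if_pos h]
    exact ⟨arr (.sigmaWedgeInv _), inferInstance⟩

/-- Only disjunctions are in question, because exchange is always invertible. One of the two
substitution instances is letterless and true throughout `A`, so each intermutation that occurs is
of an invertible kind. -/
theorem isIso_split {S : P → Prop}
    (s : ∀ p, letter p ⟶ keep S ⊤' p ⋏ keep (fun q => ¬ S q) ⊤' p) [∀ p, IsIso (s p)]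
    {A : Formula P} (hA : A.UnitFree) (h : (∀ p ∈ A.letters, S p) ∨ ∀ p ∈ A.letters, ¬ S p) :
    IsIso (split s A) := by
  induction A with
  | letter p => exact inferInstanceAs (IsIso (s p))
  | bot => exact (not_unitFree_bot hA).elim
  | top => exact (not_unitFree_top hA).elim
  | vee A B ihA ihB =>
    simp only [letters, List.forall_mem_append] at h
    have hA := unitFree_vee.1 hA
    have := ihA hA.1 (h.imp And.left And.left)
    have := ihB hA.2 (h.imp And.right And.right)
    have : IsIso (arr (.ck (A.subst (keep S ⊤')) (A.subst (keep (fun q => ¬ S q) ⊤'))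
        (B.subst (keep S ⊤')) (B.subst (keep (fun q => ¬ S q) ⊤')))) := by
      rcases h with h | h
      · exact isIso_ck_of_eval_eq_true_right
          (letterless_subst_keep rfl fun p hp => not_not_intro (h.1 p hp))
          (letterless_subst_keep rfl fun p hp => not_not_intro (h.2 p hp))
          (eval_subst_keep_top (fun _ => true) hA.1 fun p hp => not_not_intro (h.1 p hp))
          (eval_subst_keep_top (fun _ => true) hA.2 fun p hp => not_not_intro (h.2 p hp))
      · exact isIso_ck_of_eval_eq_true_left
          (letterless_subst_keep rfl h.1) (letterless_subst_keep rfl h.2)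
          (eval_subst_keep_top (fun _ => true) hA.1 h.1)
          (eval_subst_keep_top (fun _ => true) hA.2 h.2)
    exact inferInstanceAs (IsIso ((split s A ⋎ₘ split s B) ≫ arr (.ck _ _ _ _)))
  | wedge A B ihA ihB =>
    simp only [letters, List.forall_mem_append] at h
    have hA := unitFree_wedge.1 hA
    have := ihA hA.1 (h.imp And.left And.left)
    have := ihB hA.2 (h.imp And.right And.right)
    exact inferInstanceAs (IsIso ((split s A ⋏ₘ split s B) ≫ wedgeMu _ _ _ _))

/-- With `S` the letters of `B₁`, the splitting of the target is invertible. So `f` is determined by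
two substitution instances, each of which has lost the letters of one conjunct. -/
theorem eq_of_wedge {A B₁ B₂ : Formula P} (hA : A.UnitFree) (h₁ : B₁.UnitFree) (h₂ : B₂.UnitFree)
    (dA : A.Diversified) (dB : (B₁ ⋏ B₂).Diversified)
    (ih : ∀ A' B' : Formula P, A'.Pure → A'.Diversified → B'.Pure → B'.Diversified →
      A'.letters.length < A.letters.length → ∀ f g : A' ⟶ B', f = g)
    (f g : A ⟶ B₁ ⋏ B₂) : f = g := by
  obtain ⟨-, -, d⟩ := List.nodup_append'.1 dB
  let S : P → Prop := (· ∈ B₁.letters)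
  have hS : ∀ p ∈ B₂.letters, ¬ S p := fun p hp hp' => d hp' hp
  obtain ⟨x, hx⟩ := h₁.exists_mem
  obtain ⟨y, hy⟩ := h₂.exists_mem
  have hxA : x ∈ A.letters := (letters_perm f).mem_iff.2 (List.mem_append_left _ hx)
  have hyA : y ∈ A.letters := (letters_perm f).mem_iff.2 (List.mem_append_right _ hy)
  choose s hs using exists_isIso_splitLetter S
  have := isIso_split s h₁ (.inl fun p hp => hp)
  have := isIso_split s h₂ (.inr hS)
  -- Although the letters of `B₁ ⋏ B₂` lie on both sides of `S`, its outer connective involves the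
  -- exchange and not an intermutation.
  have : IsIso (split s (B₁ ⋏ B₂)) := by
    exact inferInstanceAs (IsIso ((split s B₁ ⋏ₘ split s B₂) ≫ wedgeMu _ _ _ _))
  -- Balance makes both ends pure, a letter in `S` keeps them from reducing to `⊤`, and a letter
  -- outside `S` makes the count drop.
  have key : ∀ S : P → Prop, A.VeeBalanced S → (B₁ ⋏ B₂).VeeBalanced S →
      (∃ p ∈ A.letters, S p) → (∃ p ∈ A.letters, ¬ S p) →
      substMap (keep S ⊤') f = substMap (keep S ⊤') g := by
    rintro S bA bB ⟨p, hp, hS⟩ ⟨q, hq, hS'⟩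
    exact ih _ _ (pure_subst_keep_top hA bA ⟨p, hp, hS⟩) (dA.subst_keep S rfl)
      (pure_subst_keep_top (unitFree_wedge.2 ⟨h₁, h₂⟩) bB
        ⟨p, (letters_perm f).mem_iff.1 hp, hS⟩)
      (dB.subst_keep S rfl) (length_letters_subst_keep_lt S rfl hq hS') _ _
  -- The balance lemma takes `S` in the second conjunct, whence the commutativity after `f`.
  have e₁ := key S
    (veeBalanced_of_hom (f ≫ arr (.cWedge B₁ B₂)) hA h₁ (List.perm_append_comm.nodup_iff.1 dB) hS
      fun p hp => hp)
    ⟨veeBalanced_of_forall h₁ (.inl fun p hp => hp), veeBalanced_of_forall h₂ (.inr hS)⟩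
    ⟨x, hxA, hx⟩ ⟨y, hyA, hS y hy⟩
  have e₂ := key (fun p => ¬ S p)
    (veeBalanced_of_hom f hA h₂ dB (fun p hp => not_not_intro hp) hS)
    ⟨veeBalanced_of_forall h₁ (.inr fun p hp => not_not_intro hp),
      veeBalanced_of_forall h₂ (.inl hS)⟩
    ⟨y, hyA, hS y hy⟩ ⟨x, hxA, not_not_intro hx⟩
  rw [← cancel_mono (split s (B₁ ⋏ B₂)), split_natural, split_natural, e₁, e₂]

/-! ## Arrows out of a disjunction -/

theorem exists_isIso_mergeLetter (S : P → Prop) (p : P) :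
    ∃ s : keep S ⊥' p ⋎ keep (fun q => ¬ S q) ⊥' p ⟶ letter p, IsIso s := by
  by_cases h : S p
  · rw [keep, keep, if_pos h, if_neg (not_not_intro h)]
    exact ⟨arr (.deltaVeeHom _), inferInstance⟩
  · rw [keep, keep, if_neg h, if_pos h]
    exact ⟨arr (.sigmaVeeHom _), inferInstance⟩

/-- Dual to `isIso_split`: each intermutation at a conjunction has a letterless false pair. -/
theorem isIso_merge {S : P → Prop}
    (s : ∀ p, keep S ⊥' p ⋎ keep (fun q => ¬ S q) ⊥' p ⟶ letter p) [∀ p, IsIso (s p)]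
    {A : Formula P} (hA : A.UnitFree) (h : (∀ p ∈ A.letters, S p) ∨ ∀ p ∈ A.letters, ¬ S p) :
    IsIso (merge s A) := by
  induction A with
  | letter p => exact inferInstanceAs (IsIso (s p))
  | bot => exact (not_unitFree_bot hA).elim
  | top => exact (not_unitFree_top hA).elim
  | wedge A B ihA ihB =>
    simp only [letters, List.forall_mem_append] at h
    have hA := unitFree_wedge.1 hA
    have := ihA hA.1 (h.imp And.left And.left)
    have := ihB hA.2 (h.imp And.right And.right)
    have : IsIso (arr (.ck (A.subst (keep S ⊥')) (B.subst (keep S ⊥'))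
        (A.subst (keep (fun q => ¬ S q) ⊥')) (B.subst (keep (fun q => ¬ S q) ⊥')))) := by
      rcases h with h | h
      · exact isIso_ck_of_eval_eq_false_right
          (letterless_subst_keep rfl fun p hp => not_not_intro (h.1 p hp))
          (letterless_subst_keep rfl fun p hp => not_not_intro (h.2 p hp))
          (eval_subst_keep_bot (fun _ => false) hA.1 fun p hp => not_not_intro (h.1 p hp))
          (eval_subst_keep_bot (fun _ => false) hA.2 fun p hp => not_not_intro (h.2 p hp))
      · exact isIso_ck_of_eval_eq_false_left
          (letterless_subst_keep rfl h.1) (letterless_subst_keep rfl h.2)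
          (eval_subst_keep_bot (fun _ => false) hA.1 h.1)
          (eval_subst_keep_bot (fun _ => false) hA.2 h.2)
    exact inferInstanceAs (IsIso (arr (.ck _ _ _ _) ≫ (merge s A ⋏ₘ merge s B)))
  | vee A B ihA ihB =>
    simp only [letters, List.forall_mem_append] at h
    have hA := unitFree_vee.1 hA
    have := ihA hA.1 (h.imp And.left And.left)
    have := ihB hA.2 (h.imp And.right And.right)
    exact inferInstanceAs (IsIso (veeMu _ _ _ _ ≫ (merge s A ⋎ₘ merge s B)))

/-- Dual to `eq_of_wedge`; as `A` is now the target, the letters counted in `ih` are those of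
targets. -/
theorem eq_of_vee {A B₁ B₂ : Formula P} (hA : A.UnitFree) (h₁ : B₁.UnitFree) (h₂ : B₂.UnitFree)
    (dA : A.Diversified) (dB : (B₁ ⋎ B₂).Diversified)
    (ih : ∀ A' B' : Formula P, A'.Pure → A'.Diversified → B'.Pure → B'.Diversified →
      A'.letters.length < A.letters.length → ∀ f g : B' ⟶ A', f = g)
    (f g : B₁ ⋎ B₂ ⟶ A) : f = g := by
  obtain ⟨-, -, d⟩ := List.nodup_append'.1 dB
  let S : P → Prop := (· ∈ B₁.letters)
  have hS : ∀ p ∈ B₂.letters, ¬ S p := fun p hp hp' => d hp' hp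
  obtain ⟨x, hx⟩ := h₁.exists_mem
  obtain ⟨y, hy⟩ := h₂.exists_mem
  have hxA : x ∈ A.letters := (letters_perm f).mem_iff.1 (List.mem_append_left _ hx)
  have hyA : y ∈ A.letters := (letters_perm f).mem_iff.1 (List.mem_append_right _ hy)
  choose s hs using exists_isIso_mergeLetter S
  have := isIso_merge s h₁ (.inl fun p hp => hp)
  have := isIso_merge s h₂ (.inr hS)
  have : IsIso (merge s (B₁ ⋎ B₂)) := by
    exact inferInstanceAs (IsIso (veeMu _ _ _ _ ≫ (merge s B₁ ⋎ₘ merge s B₂)))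
  have key : ∀ S : P → Prop, A.WedgeBalanced S → (B₁ ⋎ B₂).WedgeBalanced S →
      (∃ p ∈ A.letters, S p) → (∃ p ∈ A.letters, ¬ S p) →
      substMap (keep S ⊥') f = substMap (keep S ⊥') g := by
    rintro S bA bB ⟨p, hp, hS⟩ ⟨q, hq, hS'⟩
    exact ih _ _ (pure_subst_keep_bot hA bA ⟨p, hp, hS⟩) (dA.subst_keep S rfl)
      (pure_subst_keep_bot (unitFree_vee.2 ⟨h₁, h₂⟩) bB
        ⟨p, (letters_perm f).mem_iff.2 hp, hS⟩)
      (dB.subst_keep S rfl) (length_letters_subst_keep_lt S rfl hq hS') _ _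
  have e₁ := key S
    (wedgeBalanced_of_hom (arr (.cVee B₂ B₁) ≫ f) hA h₁ (List.perm_append_comm.nodup_iff.1 dB) hS
      fun p hp => hp)
    ⟨wedgeBalanced_of_forall h₁ (.inl fun p hp => hp), wedgeBalanced_of_forall h₂ (.inr hS)⟩
    ⟨x, hxA, hx⟩ ⟨y, hyA, hS y hy⟩
  have e₂ := key (fun p => ¬ S p)
    (wedgeBalanced_of_hom f hA h₂ dB (fun p hp => not_not_intro hp) hS)
    ⟨wedgeBalanced_of_forall h₁ (.inr fun p hp => not_not_intro hp),
      wedgeBalanced_of_forall h₂ (.inl hS)⟩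
    ⟨y, hyA, hS y hy⟩ ⟨x, hxA, not_not_intro hx⟩
  rw [← cancel_epi (merge s (B₁ ⋎ B₂)), ← merge_natural, ← merge_natural, e₁, e₂]

/-! ## Coherence -/

/-- Joins by conjunctions are preserved by arrows and never lead from `B₁` to `B₂`, yet any two
letters of `A₁ ⋏ A₂` are linked by at most two of them. -/
theorem isEmpty_hom_wedge_vee {A₁ A₂ B₁ B₂ : Formula P} (hA : (A₁ ⋏ A₂).UnitFree)
    (hB : (B₁ ⋎ B₂).UnitFree) (dB : (B₁ ⋎ B₂).Diversified) : IsEmpty (A₁ ⋏ A₂ ⟶ B₁ ⋎ B₂) := by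
  refine ⟨fun f => ?_⟩
  obtain ⟨-, -, d⟩ := List.nodup_append'.1 dB
  have hA := unitFree_wedge.1 hA
  have hB := unitFree_vee.1 hB
  have key : ∀ p q, (A₁ ⋏ A₂).Conj p q → p ∈ B₁.letters → q ∈ B₂.letters → False := by
    intro p q h hp hq
    rcases conj_of_conj f h with h | h
    · exact d h.mem.2 hq
    · exact d hp h.mem.1
  have mem : ∀ z, z ∈ A₁.letters ∨ z ∈ A₂.letters ↔ z ∈ B₁.letters ∨ z ∈ B₂.letters := by
    intro z
    rw [← List.mem_append, ← List.mem_append]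
    exact (letters_perm f).mem_iff
  obtain ⟨x, hx⟩ := hB.1.exists_mem
  obtain ⟨y, hy⟩ := hB.2.exists_mem
  rcases (mem x).2 (.inl hx) with hxA | hxA <;> rcases (mem y).2 (.inr hy) with hyA | hyA
  -- A letter of the opposite conjunct is joined to both `x` and `y`, whichever of `B₁` and `B₂` it
  -- belongs to.
  · obtain ⟨z, hz⟩ := hA.2.exists_mem
    rcases (mem z).1 (.inr hz) with h | h
    · exact key z y (.inr (.inr (.inr ⟨hyA, hz⟩))) h hy
    · exact key x z (.inr (.inr (.inl ⟨hxA, hz⟩))) hx h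
  · exact key x y (.inr (.inr (.inl ⟨hxA, hyA⟩))) hx hy
  · exact key x y (.inr (.inr (.inr ⟨hyA, hxA⟩))) hx hy
  · obtain ⟨z, hz⟩ := hA.1.exists_mem
    rcases (mem z).1 (.inl hz) with h | h
    · exact key z y (.inr (.inr (.inl ⟨hz, hyA⟩))) h hy
    · exact key x z (.inr (.inr (.inr ⟨hz, hxA⟩))) hx h

theorem eq_of_unitFree {A B : Formula P} (hA : A.UnitFree) (hB : B.UnitFree)
    (dA : A.Diversified) (dB : B.Diversified)
    (ih : ∀ A' B' : Formula P, A'.Pure → A'.Diversified → B'.Pure → B'.Diversified →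
      A'.letters.length < A.letters.length → ∀ f g : A' ⟶ B', f = g)
    (f g : A ⟶ B) : f = g := by
  -- Source and target of an arrow have equally many letters, so the induction can be measured on
  -- targets as well.
  have ih' : ∀ B' A' : Formula P, B'.Pure → B'.Diversified → A'.Pure → A'.Diversified →
      B'.letters.length < B.letters.length → ∀ f g : A' ⟶ B', f = g :=
    fun B' A' pB dB pA dA hl f g => ih A' B' pA dA pB dB
      (by rwa [(letters_perm f).length_eq, (letters_perm ‹A ⟶ B›).length_eq]) f g
  cases B with
  | bot => exact (not_unitFree_bot hB).elim
  | top => exact (not_unitFree_top hB).elim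
  | letter p =>
    obtain rfl := hA.exists_eq_letter (letters_perm f)
    rw [eq_id_of_letter f, eq_id_of_letter g]
  | wedge B₁ B₂ =>
    have hB := unitFree_wedge.1 hB
    exact eq_of_wedge hA hB.1 hB.2 dA dB ih f g
  | vee B₁ B₂ =>
    cases A with
    | bot => exact (not_unitFree_bot hA).elim
    | top => exact (not_unitFree_top hA).elim
    | letter p =>
      cases hB.exists_eq_letter (letters_perm f).symm
    | vee A₁ A₂ =>
      have hA := unitFree_vee.1 hA
      exact eq_of_vee hB hA.1 hA.2 dB dA ih' f g
    | wedge A₁ A₂ => exact (isEmpty_hom_wedge_vee hA hB dB).elim f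

/-- The induction runs over pure formulae, since replacing letters by units leads out of the
unit-free ones. -/
theorem eq_of_pure (n : ℕ) {A B : Formula P} (hA : A.Pure) (dA : A.Diversified) (hB : B.Pure)
    (dB : B.Diversified) (hn : A.letters.length = n) (f g : A ⟶ B) : f = g := by
  induction n using Nat.strong_induction_on generalizing A B with
  | h n ih =>
    obtain ⟨a⟩ := nonempty_iso_nu A
    obtain ⟨b⟩ := nonempty_iso_nu B
    have pa := letters_perm a.hom
    have pb := letters_perm b.hom
    -- Purity of `A` is by definition unit-freeness of `A.nu`, so the unit-free case applies to the
    -- conjugates of `f` and `g` by the reduction isomorphisms.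
    have := eq_of_unitFree hA hB (pa.nodup_iff.1 dA) (pb.nodup_iff.1 dB)
      (fun A' B' hA' dA' hB' dB' hl f g =>
        ih _ (by rwa [← hn, pa.length_eq]) hA' dA' hB' dB' rfl f g)
      (a.inv ≫ f ≫ b.hom) (a.inv ≫ g ≫ b.hom)
    simpa using this

end FreeSMI

theorem theorem3p1 {P : Type*} [Infinite P] (A B : FreeSMI.Formula P)
    (hAB : (A.Pure ∧ A.Diversified ∧ B.Pure ∧ B.Diversified) ∨ (A.Letterless ∧ B.Letterless))
    (f g : A ⟶ B) : f = g := by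
  rcases hAB with ⟨hA, dA, hB, dB⟩ | ⟨hA, hB⟩
  · exact FreeSMI.eq_of_pure _ hA dA hB dB rfl f g
  · exact hA.hom_ext hB f g
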